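/- **Notation.** Let $n,m$ be non-negative integers and $N\ge 0$ an integer. The Yangian $Y(\mathfrak{gl}_N)$ is the unital associative $\mathbb C$-algebra with generators $t_{ij}^{(r)}$ ($1\le i,j\le N$, $r\ge1$) and relations $$(u-v)[t_{ij}(u),t_{kl}(v)]=t_{kj}(u)t_{il}(v)-t_{kj}(v)t_{il}(u),\qquad t_{ij}(u)=\delta_{ij}+\sum_{r\ge1}t_{ij}^{(r)}u^{-r},$$ i.e. $R(u-v)T_1(u)T_2(v)=T_2(v)T_1(u)R(u-v)$ with $R(u)=u-\sum_{i,j}E_{ij}\otimes E_{ji}$ and $T(u)=(t_{ij}(u))$. A homomorphism of algebras is extended to Laurent series in $u^{-1}$, and to difference operators, coefficientwise. Let $e_{ij}$ be the standard basis of $\mathfrak{gl}_N$ and let $ev_N:Y(\mathfrak{gl}_N)\to U(\mathfrak{gl}_N)$ be the homomorphism $t_{ij}(u)\mapsto\delta_{ij}+e_{ij}u^{-1}$. Let $\omega_N$ and $\delta_N$ be the automorphisms of $Y(\mathfrak{gl}_N)$ given by $$\omega_N:\ T(u)\mapsto T(-u)^{-1},\qquad \delta_N:\ t_{ij}(u)\mapsto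 t_{N+1-j,\,N+1-i}(-u).$$ For $k\le N$ let $i_k,j_k:Y(\mathfrak{gl}_k)\to Y(\mathfrak{gl}_N)$ be the homomorphisms $i_k(t_{ab}(u))=t_{ab}(u)$ and $j_k(t_{ab}(u))=t_{N-k+a,\,N-k+b}(u)$, and put $$\psi_k=\omega_N\circ j_k\circ\omega_k,\qquad \phi_k=\delta_N\circ\psi_k\circ\delta_k,$$ so that $\phi_k\circ\delta_k=\delta_N\circ\psi_k$ (as $\delta_k^2=\mathrm{id}$). Below, $N=n+m$ in $i_n,j_m,\psi_m,\phi_n$. For a unital associative $\mathbb C$-algebra $\mathcal A$ let $D(\mathcal A)\subset\operatorname{End}\,\mathcal A((u^{-1}))$ be the unital subalgebra generated by left multiplications by elements of $\mathcal A((u^{-1}))$ and by the shift $(\tau f)(u)=f(u+1)$; each element is uniquely a finite sum $\sum_{i\ge 0} b_i(u)\tau^i$. For $l\in\mathbb Z$ let $\widehat\delta_l\bigl(\sum_i b_i(u)\tau^i\bigr)=\sum_i\tau^i\,b_i(-u+l-1)$. Put $$D_N=\sum_{\sigma\in S_N}(-1)^\sigma D_{\sigma(1),1}D_{\sigma(2),2}\cdots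 D_{\sigma(N),N}\in D(Y(\mathfrak{gl}_N)),\qquad D_{ij}=\delta_{ij}\tau-t_{ij}(u-j+1),$$ $$\operatorname{qdet}_N(u)=\sum_{\sigma\in S_N}(-1)^\sigma t_{\sigma(1),1}(u)\,t_{\sigma(2),2}(u-1)\cdots t_{\sigma(N),N}(u-N+1),$$ and $u^{\underline j}=u(u-1)\cdots(u-j+1)$. Define the following elements of $D(U(\mathfrak{gl}_{n+m}))$: $$\overline D_m=(u+n)^{\underline{n+m}}\;ev_{n+m}\bigl[i_n(\operatorname{qdet}_n(u+n))\,\psi_m(D_m)\bigr],$$ $$\overline D_n=(u+m)^{\underline{n+m}}\;ev_{n+m}\bigl[j_m(\operatorname{qdet}_m(-u-1))\,\phi_n(\widehat\delta_nD_n)\bigr].$$ (When $n=m$ the subscripts $n$ and $m$ still distinguish the two constructions.) Let $d=\tau-1$. For $c\in\mathbb C$ let $\mathcal P(c)\subset D(\mathbb C)$ be the unital subalgebra generated by $u$ and $(u-c)d$, and identify $a\otimes p\in U(\mathfrak{gl}_{n+m})\otimes\mathcal P(c)$ with $a\,p\in D(U(\mathfrak{gl}_{n+m}))$. **Theorem.**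 One has $\overline D_n\in U(\mathfrak{gl}_{n+m})\otimes\mathcal P(n-1)$ and $\overline D_m\in U(\mathfrak{gl}_{n+m})\otimes\mathcal P(m-1)$. Moreover there is an anti-isomorphism of algebras $\mathcal F_{n,m}:\mathcal P(n-1)\to\mathcal P(m-1)$ with $$(u-n+1)d\mapsto u+n,\qquad u+m\mapsto(u-m+1)d$$ (it is unique, since these elements generate), and $$(\mathrm{id}\otimes\mathcal F_{n,m})(\overline D_n)=\overline D_m.$$ -/

import Mathlib

noncomputable section

namespace YangianDuality

/-- `A((u⁻¹))`: the coefficient at `k : ℤ` is the coefficient of `u ^ (-k)`. -/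
abbrev Ser (A : Type*) [Zero A] : Type _ := HahnSeries ℤ A

/-- The coefficient of `u ^ (-p - d)` in the expansion of `(u + c) ^ (-p)` in powers of `u⁻¹`. -/
def shiftCoeff (c p d : ℤ) : ℤ :=
  if 0 ≤ d then Ring.choose (-p) d.toNat * c ^ d.toNat else 0

section Series

variable {A : Type*} [Ring A]

theorem shiftCoeff_support_subset (c : ℤ) (f : Ser A) (L N : ℤ) (hL : ∀ p, p < L → f.coeff p = 0) :
    Function.support (fun p : ℤ => shiftCoeff c p (N - p) • f.coeff p) ⊆ Finset.Icc L N := by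
  intro p hp
  rw [Function.mem_support] at hp
  rw [Finset.coe_Icc, Set.mem_Icc]
  by_contra h
  apply hp
  rw [not_and_or] at h
  rcases h with h | h
  · rw [hL p (by omega), smul_zero]
  · rw [shiftCoeff, if_neg (by omega), zero_smul]

/-- The shift `f(u) ↦ f(u + c)` on `A((u⁻¹))`, for an integer `c`. -/
def shift (c : ℤ) (f : Ser A) : Ser A :=
  HahnSeries.ofSuppBddBelow (fun N : ℤ => ∑ᶠ p : ℤ, shiftCoeff c p (N - p) • f.coeff p) (by
    refine ⟨f.order, fun N hN => ?_⟩
    by_contra h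
    apply hN
    have := shiftCoeff_support_subset c f f.order N
      (fun p hp => HahnSeries.coeff_eq_zero_of_lt_order hp)
    rw [Finset.Icc_eq_empty (by omega)] at this
    rw [Finset.coe_empty, Set.subset_empty_iff, Function.support_eq_empty_iff] at this
    exact finsum_eq_zero_of_forall_eq_zero fun p => congrFun this p)

theorem coeff_shift (c : ℤ) (f : Ser A) (L N : ℤ) (hL : ∀ p, p < L → f.coeff p = 0)
    (S : Finset ℤ) (hS : Finset.Icc L N ⊆ S) :
    (shift c f).coeff N = ∑ p ∈ S, shiftCoeff c p (N - p) • f.coeff p :=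
  finsum_eq_sum_of_support_subset _
    ((shiftCoeff_support_subset c f L N hL).trans (by exact_mod_cast hS))

theorem exists_bound (f g : Ser A) :
    ∃ L : ℤ, (∀ p, p < L → f.coeff p = 0) ∧ ∀ p, p < L → g.coeff p = 0 :=
  ⟨min f.order g.order, fun _ hp => HahnSeries.coeff_eq_zero_of_lt_order (by omega),
    fun _ hp => HahnSeries.coeff_eq_zero_of_lt_order (by omega)⟩

theorem shift_add (c : ℤ) (f g : Ser A) : shift c (f + g) = shift c f + shift c g := by
  obtain ⟨L, hf, hg⟩ := exists_bound f g
  ext N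
  rw [HahnSeries.coeff_add, coeff_shift c f L N hf _ subset_rfl,
    coeff_shift c g L N hg _ subset_rfl, coeff_shift c (f + g) L N _ _ subset_rfl,
    ← Finset.sum_add_distrib]
  · simp
  · intro p hp
    simp [hf p hp, hg p hp]

theorem shift_smul [Algebra ℂ A] (c : ℤ) (a : ℂ) (f : Ser A) :
    shift c (a • f) = a • shift c f := by
  obtain ⟨L, hf, -⟩ := exists_bound f f
  ext N
  rw [HahnSeries.coeff_smul, coeff_shift c f L N hf _ subset_rfl,
    coeff_shift c (a • f) L N _ _ subset_rfl, Finset.smul_sum]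
  · refine Finset.sum_congr rfl fun p _ => ?_
    rw [HahnSeries.coeff_smul, smul_comm]
  · intro p hp
    simp [hf p hp]

theorem coeff_mul_of_bound (f g : Ser A) (L : ℤ) (hf : ∀ p, p < L → f.coeff p = 0)
    (hg : ∀ p, p < L → g.coeff p = 0) (N : ℤ) (S : Finset ℤ) (hS : Finset.Icc L (N - L) ⊆ S) :
    (f * g).coeff N = ∑ p ∈ S, f.coeff p * g.coeff (N - p) := by
  rw [HahnSeries.coeff_mul]
  refine Finset.sum_bij_ne_zero (fun ij _ _ => ij.1) ?_ ?_ ?_ ?_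
  · intro a h1 h2
    rw [Finset.mem_antidiagonal] at h1
    obtain ⟨h3, h4, h5⟩ := h1
    apply hS
    rw [Finset.mem_Icc]
    constructor
    · by_contra h
      exact h3 (hf _ (by omega))
    · by_contra h
      exact h4 (hg _ (by omega))
  · intro a h1 h2 b h3 h4 h
    rw [Finset.mem_antidiagonal] at h1 h3
    ext
    · exact h
    · have := h1.2.2
      have := h3.2.2
      omega
  · intro p _ h
    refine ⟨(p, N - p), ?_, h, rfl⟩
    rw [Finset.mem_antidiagonal]
    exact ⟨left_ne_zero_of_mul h, right_ne_zero_of_mul h, by simp⟩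
  · intro a h1 _
    rw [Finset.mem_antidiagonal] at h1
    have : a.2 = N - a.1 := by
      have := h1.2.2
      omega
    rw [this]

theorem shiftCoeff_add (c p q d : ℤ) (S : Finset ℤ) (hS : Finset.Icc 0 d ⊆ S) :
    ∑ i ∈ S, shiftCoeff c p i * shiftCoeff c q (d - i) = shiftCoeff c (p + q) d := by
  rw [← Finset.sum_subset hS]
  · by_cases hd : 0 ≤ d
    · obtain ⟨k, rfl⟩ := Int.eq_ofNat_of_zero_le hd
      rw [shiftCoeff, if_pos hd, neg_add, Int.toNat_natCast,
        Ring.add_choose_eq k (Commute.all _ _), Finset.sum_mul]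
      refine Finset.sum_nbij' (fun i => (i.toNat, k - i.toNat)) (fun a => (a.1 : ℤ)) ?_ ?_ ?_ ?_ ?_
      · intro a ha
        rw [Finset.mem_Icc] at ha
        rw [Finset.HasAntidiagonal.mem_antidiagonal]
        omega
      · intro a ha
        rw [Finset.HasAntidiagonal.mem_antidiagonal] at ha
        rw [Finset.mem_Icc]
        omega
      · intro a ha
        rw [Finset.mem_Icc] at ha
        simp [ha.1]
      · intro a ha
        rw [Finset.HasAntidiagonal.mem_antidiagonal] at ha
        ext
        · simp
        · simp only [Int.toNat_natCast]
          omega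
      · intro a ha
        rw [Finset.mem_Icc] at ha
        obtain ⟨j, rfl⟩ := Int.eq_ofNat_of_zero_le ha.1
        have hj : j ≤ k := by omega
        have h1 : ((k : ℤ) - (j : ℤ)).toNat = k - j := by omega
        have h2 : c ^ k = c ^ j * c ^ (k - j) := by rw [← pow_add, Nat.add_sub_cancel' hj]
        rw [shiftCoeff, shiftCoeff, if_pos (by omega), if_pos (by omega), h1, Int.toNat_natCast, h2]
        ring
    · rw [Finset.Icc_eq_empty (by omega), Finset.sum_empty, shiftCoeff, if_neg hd]
  · intro i _ hi
    rw [Finset.mem_Icc, not_and_or] at hi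
    rcases hi with hi | hi
    · rw [shiftCoeff, if_neg hi, zero_mul]
    · rw [shiftCoeff, shiftCoeff, if_neg (by omega : ¬ 0 ≤ d - i), mul_zero]

theorem coeff_shift_of_lt (c : ℤ) (f : Ser A) (L : ℤ) (hL : ∀ p, p < L → f.coeff p = 0)
    (N : ℤ) (hN : N < L) : (shift c f).coeff N = 0 := by
  rw [coeff_shift c f L N hL _ subset_rfl, Finset.Icc_eq_empty (by omega), Finset.sum_empty]

theorem shift_mul (c : ℤ) (f g : Ser A) : shift c (f * g) = shift c f * shift c g := by
  obtain ⟨L, hf, hg⟩ := exists_bound f g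
  have hfg : ∀ p, p < 2 * L → (f * g).coeff p = 0 := by
    intro p hp
    rw [coeff_mul_of_bound f g L hf hg p _ subset_rfl, Finset.Icc_eq_empty (by omega),
      Finset.sum_empty]
  ext N
  set S := Finset.Icc L (N - L) with hS
  set S₁ := Finset.Icc (2 * L) N with hS₁
  have lhs : (shift c (f * g)).coeff N = ∑ p ∈ S, ∑ r ∈ S₁,
      shiftCoeff c r (N - r) • (f.coeff p * g.coeff (r - p)) := by
    rw [coeff_shift c (f * g) (2 * L) N hfg S₁ subset_rfl, Finset.sum_comm]
    refine Finset.sum_congr rfl fun r hr => ?_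
    rw [Finset.mem_Icc] at hr
    rw [coeff_mul_of_bound f g L hf hg r S (Finset.Icc_subset_Icc le_rfl (by omega)),
      Finset.smul_sum]
  have rhs : (shift c f * shift c g).coeff N = ∑ P ∈ S, ∑ p ∈ S, ∑ r ∈ S₁,
      (shiftCoeff c p (P - p) * shiftCoeff c (r - p) (N - P - (r - p))) •
        (f.coeff p * g.coeff (r - p)) := by
    rw [coeff_mul_of_bound _ _ L (coeff_shift_of_lt c f L hf) (coeff_shift_of_lt c g L hg) N S
      subset_rfl]
    refine Finset.sum_congr rfl fun P hP => ?_
    rw [Finset.mem_Icc] at hP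
    rw [coeff_shift c f L P hf S (Finset.Icc_subset_Icc le_rfl (by omega)), Finset.sum_mul]
    refine Finset.sum_congr rfl fun p hp => ?_
    rw [Finset.mem_Icc] at hp
    by_cases hpP : p ≤ P
    · have hsub : Finset.Icc L (N - P) ⊆ S₁.map (Equiv.subRight p).toEmbedding := by
        intro x hx
        rw [Finset.mem_Icc] at hx
        rw [Finset.mem_map]
        exact ⟨x + p, by rw [Finset.mem_Icc]; omega, by simp⟩
      rw [coeff_shift c g L (N - P) hg _ hsub, Finset.sum_map, Finset.mul_sum]
      refine Finset.sum_congr rfl fun r _ => ?_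
      simp only [Equiv.coe_toEmbedding, Equiv.subRight_apply, smul_mul_smul_comm]
    · have : shiftCoeff c p (P - p) = 0 := by rw [shiftCoeff, if_neg (by omega)]
      simp [this]
  rw [lhs, rhs, Finset.sum_comm (s := S) (t := S)]
  refine Finset.sum_congr rfl fun p hp => ?_
  rw [Finset.sum_comm]
  refine Finset.sum_congr rfl fun r hr => ?_
  rw [← Finset.sum_smul]
  rw [Finset.mem_Icc] at hp hr
  by_cases hrp : r - p < L
  · rw [hg _ hrp, mul_zero, smul_zero, smul_zero]
  · congr 1
    have hsub : Finset.Icc 0 (N - r) ⊆ S.map (Equiv.subRight p).toEmbedding := by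
      intro x hx
      rw [Finset.mem_Icc] at hx
      rw [Finset.mem_map]
      exact ⟨x + p, by rw [Finset.mem_Icc]; omega, by simp⟩
    have := shiftCoeff_add c p (r - p) (N - r) _ hsub
    rw [Finset.sum_map] at this
    rw [add_sub_cancel] at this
    rw [← this]
    refine Finset.sum_congr rfl fun P _ => ?_
    simp only [Equiv.coe_toEmbedding, Equiv.subRight_apply]
    congr 2
    ring

theorem shift_single (c p : ℤ) (a : A) (N : ℤ) :
    (shift c (HahnSeries.single p a)).coeff N = shiftCoeff c p (N - p) • a := by
  rw [coeff_shift c _ p N (fun q hq => HahnSeries.coeff_single_of_ne (by omega))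
    (insert p (Finset.Icc p N))
    (Finset.subset_insert _ _), Finset.sum_eq_single p]
  · simp
  · intro q _ hq
    simp [HahnSeries.coeff_single_of_ne hq]
  · intro h
    exact absurd (Finset.mem_insert_self _ _) h

theorem shift_one (c : ℤ) : shift c (1 : Ser A) = 1 := by
  ext N
  have h := shift_single c 0 (1 : A) N
  rw [← HahnSeries.single_zero_one, h, HahnSeries.coeff_single]
  rcases lt_trichotomy N 0 with hN | rfl | hN
  · rw [shiftCoeff, if_neg (by omega), zero_smul, if_neg (by omega)]
  · simp [shiftCoeff]
  · obtain ⟨k, rfl⟩ := Int.eq_ofNat_of_zero_le hN.le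
    obtain ⟨j, rfl⟩ := Nat.exists_eq_succ_of_ne_zero (n := k) (by omega)
    rw [if_neg (by omega), shiftCoeff, if_pos (by omega)]
    simp [Ring.choose_zero_succ]

/-- The variable `u`, as an element of `A((u⁻¹))`. -/
def uVar (A : Type*) [Ring A] : Ser A := HahnSeries.single (-1) 1

theorem uVar_mul_comm (f : Ser A) : uVar A * f = f * uVar A := by
  ext N
  obtain ⟨M, rfl⟩ : ∃ M, N = M + -1 := ⟨N + 1, by ring⟩
  rw [uVar, HahnSeries.coeff_mul_single_add, HahnSeries.coeff_single_mul_add, one_mul, mul_one]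

theorem shift_uVar (c : ℤ) : shift c (uVar A) = uVar A + (c : Ser A) := by
  ext N
  rw [uVar, shift_single, HahnSeries.coeff_add, HahnSeries.coeff_single]
  have hc : (c : Ser A) = HahnSeries.single 0 (c : A) := rfl
  rw [hc, HahnSeries.coeff_single]
  rcases lt_or_ge N (-1) with hN | hN
  · rw [shiftCoeff, if_neg (by omega), if_neg (by omega), if_neg (by omega)]
    simp
  · obtain ⟨k, hk⟩ := Int.eq_ofNat_of_zero_le (by omega : 0 ≤ N - -1)
    rw [shiftCoeff, if_pos (by omega), hk, Int.toNat_natCast]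
    obtain rfl : N = k - 1 := by omega
    match k with
    | 0 => simp
    | 1 => simp
    | j + 2 =>
      rw [if_neg (by push_cast; omega), if_neg (by push_cast; omega)]
      have : Ring.choose (- -1 : ℤ) (j + 2) = 0 := by
        have := Ring.choose_natCast (R := ℤ) 1 (j + 2)
        rw [Nat.choose_eq_zero_of_lt (by omega)] at this
        simpa using this
      rw [this]
      simp

/-- The substitution `f(u) ↦ f(-u)` on `A((u⁻¹))`. -/
def reflect (f : Ser A) : Ser A :=
  HahnSeries.ofSuppBddBelow (fun N : ℤ => (Int.negOnePow N : ℤ) • f.coeff N)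
    ⟨f.order, fun N hN => by
      by_contra h
      apply hN
      change (Int.negOnePow N : ℤ) • f.coeff N = 0
      rw [HahnSeries.coeff_eq_zero_of_lt_order (by omega), smul_zero]⟩

theorem reflect_zero : reflect (0 : Ser A) = 0 := by
  ext N
  change (Int.negOnePow N : ℤ) • (0 : Ser A).coeff N = _
  simp

theorem shift_zero (c : ℤ) : shift c (0 : Ser A) = 0 := by
  have h := shift_add c (0 : Ser A) 0
  rw [add_zero] at h
  exact left_eq_add.mp h

end Series

section DifferenceOperators

variable (A : Type*) [Ring A] [Algebra ℂ A]

/-- The shift operator `(τ f)(u) = f(u + 1)` on `A((u⁻¹))`. -/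
def tau : Module.End ℂ (Ser A) where
  toFun := shift 1
  map_add' := shift_add 1
  map_smul' := shift_smul 1

/-- The algebra `D(A)` of difference operators: the unital subalgebra of `End (A((u⁻¹)))`
generated by `τ` and by `A((u⁻¹))` acting by left multiplication. -/
def DiffOp : Subalgebra ℂ (Module.End ℂ (Ser A)) :=
  Algebra.adjoin ℂ (insert (tau A) (Set.range (Algebra.lmul ℂ (Ser A))))

variable {A}

theorem tau_mul_lmul (f : Ser A) :
    tau A * Algebra.lmul ℂ (Ser A) f = Algebra.lmul ℂ (Ser A) (shift 1 f) * tau A := by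
  ext1 g
  exact shift_mul 1 f g

theorem exists_tau_pow_mul_lmul (i : ℕ) (f : Ser A) : ∃ g : Ser A,
    tau A ^ i * Algebra.lmul ℂ (Ser A) f = Algebra.lmul ℂ (Ser A) g * tau A ^ i := by
  induction i generalizing f with
  | zero => exact ⟨f, by simp⟩
  | succ i ih =>
    obtain ⟨g, hg⟩ := ih (shift 1 f)
    exact ⟨g, by rw [pow_succ, mul_assoc, tau_mul_lmul, ← mul_assoc, hg, mul_assoc]⟩

theorem tau_pow_mul_uVar (i : ℕ) : tau A ^ i * Algebra.lmul ℂ (Ser A) (uVar A) =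
    Algebra.lmul ℂ (Ser A) (uVar A + (i : Ser A)) * tau A ^ i := by
  induction i with
  | zero => simp
  | succ i ih =>
    rw [pow_succ, mul_assoc, tau_mul_lmul, shift_uVar, map_add, add_mul, mul_add, ← mul_assoc,
      ih]
    simp only [Int.cast_one, map_one, one_mul, map_add, map_natCast, Nat.cast_succ]
    noncomm_ring

theorem tau_pow_one (i : ℕ) : (tau A ^ i) (1 : Ser A) = 1 := by
  induction i with
  | zero => rfl
  | succ i ih =>
    rw [pow_succ, Module.End.mul_apply]
    have : tau A (1 : Ser A) = 1 := shift_one 1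
    rw [this, ih]

variable (A)

/-- The linear map sending the sequence `(b i)` to the operator `∑ i, b i * τ ^ i`. -/
def ofCoeffs : (ℕ →₀ Ser A) →ₗ[ℂ] Module.End ℂ (Ser A) :=
  Finsupp.lsum ℂ fun i =>
    (LinearMap.mulRight ℂ (tau A ^ i)).comp (Algebra.lmul ℂ (Ser A)).toLinearMap

variable {A}

theorem ofCoeffs_single (i : ℕ) (f : Ser A) :
    ofCoeffs A (Finsupp.single i f) = Algebra.lmul ℂ (Ser A) f * tau A ^ i := by
  simp [ofCoeffs]

theorem ofCoeffs_apply (b : ℕ →₀ Ser A) :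
    ofCoeffs A b = ∑ i ∈ b.support, Algebra.lmul ℂ (Ser A) (b i) * tau A ^ i := by
  rw [ofCoeffs, Finsupp.lsum_apply]
  rfl

theorem ofCoeffs_injective : Function.Injective (ofCoeffs A) := by
  rw [← LinearMap.ker_eq_bot, LinearMap.ker_eq_bot']
  intro b hb
  let U := Algebra.lmul ℂ (Ser A) (uVar A)
  let ad : Module.End ℂ (Module.End ℂ (Ser A)) := LinearMap.mulRight ℂ U - LinearMap.mulLeft ℂ U
  let v : b.support → Module.End ℂ (Ser A) := fun i =>
    Algebra.lmul ℂ (Ser A) (b i) * tau A ^ (i : ℕ)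
  have hv : ∀ i : b.support, ad.HasEigenvector ((i : ℕ) : ℂ) (v i) := by
    intro i
    refine ⟨?_, ?_⟩
    · rw [Module.End.mem_eigenspace_iff]
      change v i * U - U * v i = ((i : ℕ) : ℂ) • v i
      have h1 : U * Algebra.lmul ℂ (Ser A) (b i) = Algebra.lmul ℂ (Ser A) (b i) * U := by
        rw [← map_mul, ← map_mul, uVar_mul_comm]
      rw [mul_assoc, tau_pow_mul_uVar, ← mul_assoc U, h1, map_add, map_natCast, add_mul, mul_add,
        mul_assoc, add_sub_cancel_left, Nat.cast_smul_eq_nsmul, nsmul_eq_mul, ← mul_assoc,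
        ← mul_assoc, Nat.cast_comm]
    · intro h0
      have h1 : v i 1 = 0 := by rw [h0]; rfl
      rw [Module.End.mul_apply, tau_pow_one] at h1
      change b i * 1 = 0 at h1
      rw [mul_one] at h1
      exact (Finsupp.mem_support_iff.mp i.2) h1
  have hli := Module.End.eigenvectors_linearIndependent' ad (fun i : b.support => ((i : ℕ) : ℂ))
    (fun i j h => Subtype.ext (Nat.cast_injective h)) v hv
  rw [Fintype.linearIndependent_iff] at hli
  have hsum : ∑ i : b.support, (1 : ℂ) • v i = 0 := by
    rw [ofCoeffs_apply, ← Finset.sum_coe_sort] at hb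
    simpa only [one_smul] using hb
  ext1 i
  by_contra hi
  exact one_ne_zero (hli (fun _ => 1) hsum ⟨i, Finsupp.mem_support_iff.mpr hi⟩)

theorem ofCoeffs_range : LinearMap.range (ofCoeffs A) = Subalgebra.toSubmodule (DiffOp A) := by
  have htau : tau A ∈ DiffOp A := Algebra.subset_adjoin (Set.mem_insert _ _)
  have hmul : ∀ f : Ser A, Algebra.lmul ℂ (Ser A) f ∈ DiffOp A := fun f =>
    Algebra.subset_adjoin (Set.mem_insert_of_mem _ ⟨f, rfl⟩)
  apply le_antisymm
  · rintro _ ⟨b, rfl⟩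
    rw [Subalgebra.mem_toSubmodule, ofCoeffs_apply]
    exact sum_mem fun i _ => mul_mem (hmul _) (pow_mem htau i)
  · intro T hT
    rw [Subalgebra.mem_toSubmodule] at hT
    have hmem : ∀ (f : Ser A) (i : ℕ),
        Algebra.lmul ℂ (Ser A) f * tau A ^ i ∈ LinearMap.range (ofCoeffs A) :=
      fun f i => ⟨_, ofCoeffs_single i f⟩
    induction hT using Algebra.adjoin_induction with
    | mem T hT =>
      rcases hT with rfl | ⟨f, rfl⟩
      · have h := hmem 1 1
        rwa [map_one, one_mul, pow_one] at h
      · have h := hmem f 0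
        rwa [pow_zero, mul_one] at h
    | algebraMap c =>
      rw [Algebra.algebraMap_eq_smul_one]
      have h := hmem 1 0
      rw [map_one, one_mul, pow_zero] at h
      exact Submodule.smul_mem _ _ h
    | add S T _ _ hS hT => exact Submodule.add_mem _ hS hT
    | mul S T _ _ hS hT =>
      obtain ⟨a, rfl⟩ := hS
      obtain ⟨b, rfl⟩ := hT
      rw [ofCoeffs_apply, ofCoeffs_apply, Finset.sum_mul]
      refine sum_mem fun i _ => ?_
      rw [Finset.mul_sum]
      refine sum_mem fun j _ => ?_
      obtain ⟨g, hg⟩ := exists_tau_pow_mul_lmul i (b j)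
      rw [mul_assoc, ← mul_assoc (tau A ^ i), hg, mul_assoc, ← pow_add, ← mul_assoc, ← map_mul]
      exact hmem _ _

variable (A)

/-- Every difference operator can be written as `∑ i, b i * τ ^ i` in a unique way. -/
def coeffEquiv : (ℕ →₀ Ser A) ≃ₗ[ℂ] DiffOp A :=
  (LinearEquiv.ofInjective (ofCoeffs A) ofCoeffs_injective).trans
    (LinearEquiv.ofEq _ _ ofCoeffs_range)

/-- The shift operator `τ` as an element of `D(A)`. -/
def tauOp : DiffOp A := ⟨tau A, Algebra.subset_adjoin (Set.mem_insert _ _)⟩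

variable {A}

/-- The inclusion `A((u⁻¹)) ⊆ D(A)`. -/
def coeffOp (f : Ser A) : DiffOp A :=
  ⟨Algebra.lmul ℂ (Ser A) f, Algebra.subset_adjoin (Set.mem_insert_of_mem _ ⟨f, rfl⟩)⟩

theorem coeffEquiv_single (i : ℕ) (f : Ser A) :
    coeffEquiv A (Finsupp.single i f) = coeffOp f * tauOp A ^ i :=
  Subtype.ext (ofCoeffs_single i f)
variable {B : Type*} [Ring B] [Algebra ℂ B]

/-- The extension of a homomorphism `h : A → B` to Laurent series, coefficient by coefficient. -/
def mapSer (h : A →ₐ[ℂ] B) : Ser A →ₗ[ℂ] Ser B where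
  toFun f := HahnSeries.map f h
  map_add' f g := by ext; simp
  map_smul' c f := by ext; simp

/-- The extension `∑ i, b i * τ ^ i ↦ ∑ i, h (b i) * τ ^ i` of a homomorphism `h : A → B` to
difference operators. -/
def mapOp (h : A →ₐ[ℂ] B) : DiffOp A →ₗ[ℂ] DiffOp B :=
  (coeffEquiv B).toLinearMap.comp
    ((Finsupp.mapRange.linearMap (mapSer h)).comp (coeffEquiv A).symm.toLinearMap)

/-- The map `∑ i, b i (u) * τ ^ i ↦ ∑ i, τ ^ i * b i (-u + l - 1)` on difference operators. -/
def deltaHat (l : ℤ) (T : DiffOp A) : DiffOp A :=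
  ((coeffEquiv A).symm T).sum fun i b => tauOp A ^ i * coeffOp (shift (1 - l) (reflect b))

theorem mapOp_coeffOp_mul (h : A →ₐ[ℂ] B) (f : Ser A) (i : ℕ) :
    mapOp h (coeffOp f * tauOp A ^ i) = coeffOp (mapSer h f) * tauOp B ^ i := by
  rw [← coeffEquiv_single, ← coeffEquiv_single]
  simp [mapOp]

theorem deltaHat_coeffOp_mul (l : ℤ) (f : Ser A) (i : ℕ) :
    deltaHat l (coeffOp f * tauOp A ^ i) =
      tauOp A ^ i * coeffOp (shift (1 - l) (reflect f)) := by
  have h0 : coeffOp (0 : Ser A) = 0 := Subtype.ext (map_zero (Algebra.lmul ℂ (Ser A)))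
  rw [← coeffEquiv_single, deltaHat, LinearEquiv.symm_apply_apply, Finsupp.sum_single_index]
  rw [reflect_zero, shift_zero, h0, mul_zero]

end DifferenceOperators

section YangianDefinition

/-- The defining relations of the Yangian of `𝔤𝔩_N` for a family `t i j r` (with `t i j 0 = δ_ij`),
that is, for the series `t_ij(u) = ∑ r, t i j r * u ^ (-r)`. They are the coefficients of
`(u - v) [t_ij(u), t_kl(v)] = t_kj(u) t_il(v) - t_kj(v) t_il(u)`, which is the matrix entry of
the RTT relation `R(u - v) T₁(u) T₂(v) = T₂(v) T₁(u) R(u - v)` with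
`R(u) = u - ∑ E_ij ⊗ E_ji`. -/
structure IsYangianFamily {N : ℕ} {B : Type*} [Ring B] (t : Fin N → Fin N → ℕ → B) : Prop where
  zero : ∀ i j, t i j 0 = if i = j then 1 else 0
  rel : ∀ i j k l r s,
    (t i j (r + 1) * t k l s - t k l s * t i j (r + 1)) -
      (t i j r * t k l (s + 1) - t k l (s + 1) * t i j r) =
    t k j r * t i l s - t k j s * t i l r

/-- The generators `t_ij^(r)` in the free algebra on the symbols `(i, j, r)`, where `(i, j, r)`
stands for `t_ij^(r + 1)`, and `t_ij^(0) = δ_ij`. -/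
def freeGen (N : ℕ) (i j : Fin N) : ℕ → FreeAlgebra ℂ (Fin N × Fin N × ℕ)
  | 0 => if i = j then 1 else 0
  | r + 1 => FreeAlgebra.ι ℂ (i, j, r)

/-- The relations of the Yangian on the free algebra. -/
inductive YangianRel (N : ℕ) :
    FreeAlgebra ℂ (Fin N × Fin N × ℕ) → FreeAlgebra ℂ (Fin N × Fin N × ℕ) → Prop
  | rtt (i j k l : Fin N) (r s : ℕ) : YangianRel N
      ((freeGen N i j (r + 1) * freeGen N k l s - freeGen N k l s * freeGen N i j (r + 1)) -
        (freeGen N i j r * freeGen N k l (s + 1) - freeGen N k l (s + 1) * freeGen N i j r))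
      (freeGen N k j r * freeGen N i l s - freeGen N k j s * freeGen N i l r)

/-- The Yangian `Y(𝔤𝔩_N)`. -/
abbrev Yangian (N : ℕ) : Type := RingQuot (YangianRel N)

/-- The quotient map onto the Yangian. -/
def toYangian (N : ℕ) : FreeAlgebra ℂ (Fin N × Fin N × ℕ) →ₐ[ℂ] Yangian N :=
  RingQuot.mkAlgHom ℂ (YangianRel N)

/-- The generators `t_ij^(r)` of the Yangian, with `t_ij^(0) = δ_ij`. -/
def gen (N : ℕ) (i j : Fin N) (r : ℕ) : Yangian N := toYangian N (freeGen N i j r)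

theorem isYangianFamily_gen (N : ℕ) : IsYangianFamily (gen N) where
  zero i j := by
    rw [gen, freeGen]
    split_ifs <;> simp
  rel i j k l r s := by
    have h := RingQuot.mkAlgHom_rel ℂ (YangianRel.rtt i j k l r s)
    change toYangian N _ = toYangian N _ at h
    simpa only [map_sub, map_mul] using! h

variable {N : ℕ} {B : Type*} [Ring B]

/-- The image of the free generators under the evaluation at a family. -/
theorem lift_freeGen [Algebra ℂ B] {t : Fin N → Fin N → ℕ → B} (ht : IsYangianFamily t)
    (i j : Fin N) (r : ℕ) :
    FreeAlgebra.lift ℂ (fun x : Fin N × Fin N × ℕ => t x.1 x.2.1 (x.2.2 + 1)) (freeGen N i j r) =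
      t i j r := by
  cases r with
  | zero =>
    rw [ht.zero, freeGen]
    split_ifs <;> simp
  | succ r => rw [freeGen, FreeAlgebra.lift_ι_apply]

/-- The homomorphism from the Yangian given by the images of the generators. -/
def Yangian.lift [Algebra ℂ B] (t : Fin N → Fin N → ℕ → B) (ht : IsYangianFamily t) :
    Yangian N →ₐ[ℂ] B :=
  RingQuot.liftAlgHom ℂ
    ⟨FreeAlgebra.lift ℂ (fun x : Fin N × Fin N × ℕ => t x.1 x.2.1 (x.2.2 + 1)), by
      rintro _ _ ⟨i, j, k, l, r, s⟩
      simp only [map_sub, map_mul, lift_freeGen ht]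
      exact ht.rel i j k l r s⟩

theorem Yangian.lift_gen [Algebra ℂ B] (t : Fin N → Fin N → ℕ → B) (ht : IsYangianFamily t)
    (i j : Fin N) (r : ℕ) : Yangian.lift t ht (gen N i j r) = t i j r := by
  rw [Yangian.lift, gen, toYangian, RingQuot.liftAlgHom_mkAlgHom_apply]
  exact lift_freeGen ht i j r

theorem Yangian.hom_ext [Algebra ℂ B] {f g : Yangian N →ₐ[ℂ] B}
    (h : ∀ i j r, f (gen N i j r) = g (gen N i j r)) : f = g := by
  apply RingQuot.ringQuot_ext'
  apply FreeAlgebra.hom_ext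
  funext x
  exact h x.1 x.2.1 (x.2.2 + 1)

/-- The second form of the relations, with the two factors in the opposite order. -/
theorem IsYangianFamily.rel_swap {t : Fin N → Fin N → ℕ → B} (ht : IsYangianFamily t)
    (i j k l : Fin N) (r s : ℕ) :
    t k j r * t i l s - t k j s * t i l r = t i l s * t k j r - t i l r * t k j s := by
  rw [← ht.rel i j k l r s, ← ht.rel k l i j s r]
  abel

/-- Restricting the family of generators along a map of the indices. -/
theorem IsYangianFamily.comp_injective {M : ℕ} {t : Fin N → Fin N → ℕ → B}
    (ht : IsYangianFamily t) (f : Fin M ↪ Fin N) :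
    IsYangianFamily fun i j r => t (f i) (f j) r where
  zero i j := by simp [ht.zero]
  rel i j k l r s := ht.rel _ _ _ _ r s

/-- The family of the coefficients of `t_{N+1-j, N+1-i}(-u)`. -/
theorem IsYangianFamily.rev {t : Fin N → Fin N → ℕ → B} (ht : IsYangianFamily t) :
    IsYangianFamily fun i j r => (-1 : ℤ) ^ r • t j.rev i.rev r where
  zero i j := by
    simp [ht.zero, eq_comm]
  rel i j k l r s := by
    have h := ht.rel j.rev i.rev l.rev k.rev r s
    have h2 := ht.rel_swap j.rev i.rev l.rev k.rev r s
    simp only [smul_mul_smul_comm, ← pow_add]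
    have e1 : (-1 : ℤ) ^ (r + 1 + s) = -(-1) ^ (r + s) := by ring
    have e2 : (-1 : ℤ) ^ (s + (r + 1)) = -(-1) ^ (r + s) := by ring
    have e3 : (-1 : ℤ) ^ (r + (s + 1)) = -(-1) ^ (r + s) := by ring
    have e4 : (-1 : ℤ) ^ (s + 1 + r) = -(-1) ^ (r + s) := by ring
    have e5 : (-1 : ℤ) ^ (s + r) = (-1) ^ (r + s) := by ring
    simp only [e1, e2, e3, e4, e5, neg_smul, ← smul_neg, ← smul_sub]
    congr 1
    linear_combination (norm := abel) -h - h2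

end YangianDefinition

section Inverse

open PowerSeries

variable {N : ℕ} {B : Type*} [Ring B]

/-- The series `T(u) = ∑ r, (t_ij^(r)) * u ^ (-r)` with matrix coefficients, as a power series
in `u⁻¹`. -/
def matSeries (t : Fin N → Fin N → ℕ → B) : PowerSeries (Matrix (Fin N) (Fin N) B) :=
  PowerSeries.mk fun r => Matrix.of fun i j => t i j r

/-- The coefficients `t'_ij^(r)` of the entries of the inverse matrix `T(u)⁻¹` (for a family with
`t i j 0 = δ_ij`). -/
def invFamily (t : Fin N → Fin N → ℕ → B) (i j : Fin N) (r : ℕ) : B :=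
  PowerSeries.coeff r (PowerSeries.invOfUnit (matSeries t) 1) i j

theorem matSeries_invFamily (t : Fin N → Fin N → ℕ → B) :
    matSeries (invFamily t) = PowerSeries.invOfUnit (matSeries t) 1 := by
  ext r i j
  simp [matSeries, invFamily]

theorem matSeries_mul_inv {t : Fin N → Fin N → ℕ → B} (ht : IsYangianFamily t) :
    matSeries t * matSeries (invFamily t) = 1 ∧ matSeries (invFamily t) * matSeries t = 1 := by
  have h : PowerSeries.constantCoeff (matSeries t) =
      ((1 : (Matrix (Fin N) (Fin N) B)ˣ) : Matrix (Fin N) (Fin N) B) := by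
    ext i j
    simp [matSeries, ht.zero, Matrix.one_apply]
  rw [matSeries_invFamily]
  exact ⟨PowerSeries.mul_invOfUnit _ _ h, PowerSeries.invOfUnit_mul _ _ h⟩

/-- The matrix of the entry series. -/
def entries (t : Fin N → Fin N → ℕ → B) : Matrix (Fin N) (Fin N) (PowerSeries B) :=
  Matrix.of fun i j => PowerSeries.mk (t i j)

theorem entries_mul (s t : Fin N → Fin N → ℕ → B) (h : matSeries s * matSeries t = 1) :
    entries s * entries t = 1 := by
  ext i j r
  have h1 := congrArg (fun f => (PowerSeries.coeff r f : Matrix (Fin N) (Fin N) B) i j) h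
  simp only [PowerSeries.coeff_mul, matSeries, PowerSeries.coeff_mk, Matrix.sum_apply,
    Matrix.mul_apply, Matrix.of_apply] at h1
  rw [Finset.sum_comm] at h1
  simp only [entries, Matrix.mul_apply, Matrix.of_apply, map_sum, PowerSeries.coeff_mul,
    PowerSeries.coeff_mk]
  rw [h1, PowerSeries.coeff_one, Matrix.one_apply]
  split_ifs <;> simp_all [PowerSeries.coeff_one, Matrix.one_apply]

theorem commutator_inv {R : Type*} [Ring R] (p : R) (hp : ∀ z, p * z = z * p) (Z : R)
    (T S : Matrix (Fin N) (Fin N) R) (hTS : T * S = 1) (hST : S * T = 1)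
    (v w v' w' : Fin N → R)
    (h : ∀ k l, p * (Z * T k l - T k l * Z) = v k * w l - v' k * w' l) (k l : Fin N) :
    p * (Z * S k l - S k l * Z) =
      S.mulVec v' k * Matrix.vecMul w' S l - S.mulVec v k * Matrix.vecMul w S l := by
  let D : R → Matrix (Fin N) (Fin N) R := fun z => Matrix.diagonal fun _ => z
  have hl : ∀ z (M : Matrix (Fin N) (Fin N) R) k l, (D z * M) k l = z * M k l :=
    fun z M k l => by simp [D]
  have hr : ∀ z (M : Matrix (Fin N) (Fin N) R) k l, (M * D z) k l = M k l * z :=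
    fun z M k l => by simp [D]
  have hD : ∀ M : Matrix (Fin N) (Fin N) R, D p * M = M * D p := fun M => by
    ext a b
    rw [hl, hr, hp]
  have h1 : D p * (D Z * T - T * D Z) = Matrix.vecMulVec v w - Matrix.vecMulVec v' w' := by
    ext a b
    rw [hl, Matrix.sub_apply, hl, hr, h, Matrix.sub_apply, Matrix.vecMulVec_apply,
      Matrix.vecMulVec_apply]
  have h2 : S * (D p * (D Z * T - T * D Z)) * S = D p * (S * D Z - D Z * S) := by
    rw [← mul_assoc S, ← hD, mul_assoc, mul_assoc, sub_mul, mul_sub, mul_assoc (D Z), hTS, mul_one,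
      ← mul_assoc S, ← mul_assoc S, hST, one_mul]
  rw [h1, mul_sub, sub_mul, Matrix.mul_vecMulVec, Matrix.mul_vecMulVec, Matrix.vecMulVec_mul,
    Matrix.vecMulVec_mul] at h2
  have h3 := congrFun (congrFun h2 k) l
  rw [hl, Matrix.sub_apply, Matrix.sub_apply, hl, hr, Matrix.vecMulVec_apply,
    Matrix.vecMulVec_apply] at h3
  rw [← neg_sub (S k l * Z), mul_neg, ← h3, neg_sub]

theorem inv_rel {R : Type*} [Ring R] (p q : R) (hp : ∀ z, p * z = z * p)
    (hq : ∀ z, q * z = z * q) (T S T' S' : Matrix (Fin N) (Fin N) R)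
    (hTS : T * S = 1) (hST : S * T = 1) (hTS' : T' * S' = 1) (hST' : S' * T' = 1)
    (h : ∀ i j k l, p * (T i j * T' k l - T' k l * T i j) =
      q * (T k j * T' i l - T' k j * T i l)) (i j k l : Fin N) :
    p * (S i j * S' k l - S' k l * S i j) = q * (S i l * S' k j - S' i l * S k j) := by
  have hv : ∀ (M : Matrix (Fin N) (Fin N) R) (v : Fin N → R) (a : Fin N),
      M.mulVec (fun b => q * v b) a = q * M.mulVec v a := by
    intro M v a
    simp only [Matrix.mulVec, dotProduct, Finset.mul_sum]
    refine Finset.sum_congr rfl fun b _ => ?_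
    rw [← mul_assoc, ← hq, mul_assoc]
  have hcol : ∀ (M M' : Matrix (Fin N) (Fin N) R) (b a : Fin N),
      M.mulVec (fun c => M' c b) a = (M * M') a b := fun M M' b a => by
    simp [Matrix.mulVec, dotProduct, Matrix.mul_apply]
  have hrow : ∀ (M M' : Matrix (Fin N) (Fin N) R) (b a : Fin N),
      Matrix.vecMul (fun c => M b c) M' a = (M * M') b a := fun M M' b a => by
    simp [Matrix.vecMul, dotProduct, Matrix.mul_apply]
  have step1 : ∀ i j k l, p * (T i j * S' k l - S' k l * T i j) =
      q * ((1 : Matrix (Fin N) (Fin N) R) k j * (T * S') i l -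
        (S' * T) k j * (1 : Matrix (Fin N) (Fin N) R) i l) := by
    intro i j k l
    rw [commutator_inv p hp (T i j) T' S' hTS' hST' (fun a => q * T a j) (fun b => T' i b)
      (fun a => q * T' a j) (fun b => T i b)]
    · rw [hv, hv, hcol, hcol, hrow, hrow, hTS', hST', mul_sub, mul_assoc, mul_assoc]
    · intro a b
      rw [h, mul_sub, mul_assoc, mul_assoc]
  have step2 := commutator_inv p hp (S' k l) T S hTS hST
    (fun a => q * (1 : Matrix (Fin N) (Fin N) R) a l) (fun b => (S' * T) k b)
    (fun a => q * (T * S') a l) (fun b => (1 : Matrix (Fin N) (Fin N) R) k b) ?_ i j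
  · rw [hv, hv, hcol, hcol, hrow, hrow, mul_one, one_mul, ← mul_assoc S, hST, one_mul,
      mul_assoc S', hTS, mul_one] at step2
    rw [← neg_sub (S' k l * _), mul_neg, step2, neg_sub, mul_sub, mul_assoc, mul_assoc]
  · intro a b
    rw [← neg_sub (T a b * _), mul_neg, step1, ← mul_neg, neg_sub, mul_sub]
    have c1 : (1 : Matrix (Fin N) (Fin N) R) a l * (S' * T) k b =
        (S' * T) k b * (1 : Matrix (Fin N) (Fin N) R) a l := by
      rw [Matrix.one_apply]; split_ifs <;> simp
    have c2 : (1 : Matrix (Fin N) (Fin N) R) k b * (T * S') a l =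
        (T * S') a l * (1 : Matrix (Fin N) (Fin N) R) k b := by
      rw [Matrix.one_apply]; split_ifs <;> simp
    rw [mul_assoc, mul_assoc, c1, c2]

/-- The two-variable form of a coefficientwise relation: the variable of the inner power series
is `x = u⁻¹`, that of the outer one is `y = v⁻¹`. -/
theorem two_var_iff (a b c d c' d' : ℕ → B) (ha : ∀ z, a 0 * z = z * a 0)
    (hb : ∀ z, b 0 * z = z * b 0) :
    ((X - C X : PowerSeries (PowerSeries B)) *
        (C (mk a) * PowerSeries.map C (mk b) - PowerSeries.map C (mk b) * C (mk a)) =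
      C X * X * (C (mk c) * PowerSeries.map C (mk d) - PowerSeries.map C (mk c') * C (mk d'))) ↔
    ∀ r s, (a (r + 1) * b s - b s * a (r + 1)) - (a r * b (s + 1) - b (s + 1) * a r) =
      c r * d s - c' s * d' r := by
  set K : PowerSeries (PowerSeries B) :=
    C (mk a) * PowerSeries.map C (mk b) - PowerSeries.map C (mk b) * C (mk a) with hK
  set G : PowerSeries (PowerSeries B) :=
    C (mk c) * PowerSeries.map C (mk d) - PowerSeries.map C (mk c') * C (mk d') with hG
  have cK : ∀ r s, coeff r (coeff s K) = a r * b s - b s * a r := by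
    intro r s
    simp [hK, coeff_C_mul, coeff_mul_C]
  have cG : ∀ r s, coeff r (coeff s G) = c r * d s - c' s * d' r := by
    intro r s
    simp [hG, coeff_C_mul, coeff_mul_C]
  have hl : ∀ r s, coeff (r + 1) (coeff (s + 1) ((X - C X) * K)) =
      coeff (r + 1) (coeff s K) - coeff r (coeff (s + 1) K) := by
    intro r s
    rw [sub_mul, map_sub, coeff_succ_X_mul, coeff_C_mul, map_sub, coeff_succ_X_mul]
  have hr : ∀ r s, coeff (r + 1) (coeff (s + 1) (C X * X * G)) = coeff r (coeff s G) := by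
    intro r s
    rw [mul_assoc, coeff_C_mul, coeff_succ_X_mul, coeff_succ_X_mul]
  constructor
  · intro h r s
    have h1 := congrArg (fun F => coeff (r + 1) (coeff (s + 1) F)) h
    simp only [hl, hr, cK, cG] at h1
    exact h1
  · intro h
    ext s r
    match s, r with
    | 0, 0 => simp
    | 0, r + 1 =>
      rw [sub_mul, map_sub, coeff_zero_X_mul, coeff_C_mul, zero_sub, map_neg, coeff_succ_X_mul, cK,
        ← hb, sub_self, neg_zero, mul_assoc, coeff_C_mul, coeff_zero_X_mul, mul_zero, map_zero]
    | s + 1, 0 =>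
      rw [sub_mul, map_sub, coeff_succ_X_mul, coeff_C_mul, map_sub, coeff_zero_X_mul, cK,
        ← ha, sub_self, sub_zero, mul_assoc, coeff_C_mul, coeff_zero_X_mul]
    | s + 1, r + 1 => rw [hl, hr, cK, cK, cG, h]

theorem IsYangianFamily.inv {t : Fin N → Fin N → ℕ → B} (ht : IsYangianFamily t) :
    IsYangianFamily fun i j r => (-1 : ℤ) ^ r • invFamily t i j r := by
  obtain ⟨h1, h2⟩ := matSeries_mul_inv ht
  have e1 := entries_mul _ _ h1
  have e2 := entries_mul _ _ h2
  have hzero : ∀ i j, invFamily t i j 0 = if i = j then 1 else 0 := by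
    intro i j
    simp [invFamily, Matrix.one_apply]
  have hrel : ∀ i j k l r s,
      (invFamily t i j (r + 1) * invFamily t k l s - invFamily t k l s * invFamily t i j (r + 1)) -
        (invFamily t i j r * invFamily t k l (s + 1) -
          invFamily t k l (s + 1) * invFamily t i j r) =
      invFamily t i l r * invFamily t k j s - invFamily t i l s * invFamily t k j r := by
    have hc : ∀ (f : Fin N → Fin N → ℕ → B), f = t ∨ f = invFamily t →
        ∀ i j z, f i j 0 * z = z * f i j 0 := by
      rintro f (rfl | rfl) i j z
      · rw [ht.zero]; split_ifs <;> simp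
      · rw [hzero]; split_ifs <;> simp
    intro i j k l
    rw [← two_var_iff _ _ _ _ _ _ (hc _ (Or.inr rfl) i j) (hc _ (Or.inr rfl) k l)]
    have mapC : ∀ (f : PowerSeries B →+* PowerSeries (PowerSeries B))
        (M M' : Matrix (Fin N) (Fin N) (PowerSeries B)), M * M' = 1 → M.map f * M'.map f = 1 := by
      intro f M M' h
      have h3 := congrArg f.mapMatrix h
      rwa [map_mul, map_one] at h3
    refine inv_rel (X - C X) (C X * X) ?_ ?_ ((entries t).map C) ((entries (invFamily t)).map C)
      ((entries t).map (PowerSeries.map C)) ((entries (invFamily t)).map (PowerSeries.map C))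
      (mapC _ _ _ e1) (mapC _ _ _ e2) (mapC _ _ _ e1) (mapC _ _ _ e2) ?_ i j k l
    · intro z
      have hz : C X * z = z * C X := by
        ext n : 1
        rw [coeff_C_mul, coeff_mul_C, X_mul]
      rw [sub_mul, mul_sub, X_mul, hz]
    · intro z
      have hz : C X * z = z * C X := by
        ext n : 1
        rw [coeff_C_mul, coeff_mul_C, X_mul]
      rw [mul_assoc, X_mul, ← mul_assoc, hz, mul_assoc]
    · intro i j k l
      exact (two_var_iff _ _ _ _ _ _ (hc _ (Or.inl rfl) i j) (hc _ (Or.inl rfl) k l)).mpr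
        (ht.rel i j k l)
  refine ⟨fun i j => by simp [hzero], fun i j k l r s => ?_⟩
  have h := hrel k l i j s r
  simp only [smul_mul_smul_comm, ← pow_add]
  have e1 : (-1 : ℤ) ^ (r + 1 + s) = -(-1) ^ (r + s) := by ring
  have e2 : (-1 : ℤ) ^ (s + (r + 1)) = -(-1) ^ (r + s) := by ring
  have e3 : (-1 : ℤ) ^ (r + (s + 1)) = -(-1) ^ (r + s) := by ring
  have e4 : (-1 : ℤ) ^ (s + 1 + r) = -(-1) ^ (r + s) := by ring
  have e5 : (-1 : ℤ) ^ (s + r) = (-1) ^ (r + s) := by ring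
  simp only [e1, e2, e3, e4, e5, neg_smul, ← smul_neg, ← smul_sub]
  congr 1
  linear_combination (norm := abel) -h

end Inverse

section Yangians

/-- The generating series `t_ij(u) = δ_ij + ∑ r ≥ 1, t_ij^(r) * u ^ (-r)`. -/
def genSer (N : ℕ) (i j : Fin N) : Ser (Yangian N) :=
  HahnSeries.ofPowerSeries ℤ (Yangian N) (PowerSeries.mk (gen N i j))

/-- The automorphism `ω_N : T(u) ↦ T(-u)⁻¹` of the Yangian. -/
def omega (N : ℕ) : Yangian N →ₐ[ℂ] Yangian N :=
  Yangian.lift _ (isYangianFamily_gen N).inv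

/-- The automorphism `δ_N : t_ij(u) ↦ t_{N+1-j, N+1-i}(-u)` of the Yangian. -/
def delta (N : ℕ) : Yangian N →ₐ[ℂ] Yangian N :=
  Yangian.lift _ (isYangianFamily_gen N).rev

/-- The homomorphism `t_ij(u) ↦ t_{f i, f j}(u)` for an injection `f` of the indices. -/
def embed {k N : ℕ} (f : Fin k ↪ Fin N) : Yangian k →ₐ[ℂ] Yangian N :=
  Yangian.lift _ ((isYangianFamily_gen N).comp_injective f)

/-- The injection `a ↦ N - k + a` onto the last `k` of `N` indices. -/
def lastEmb {k N : ℕ} (h : k ≤ N) : Fin k ↪ Fin N where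
  toFun a := ⟨N - k + a, by omega⟩
  inj' a b hab := by
    have h1 := congrArg Fin.val hab
    ext
    simpa using h1

/-- The homomorphism `Y(𝔤𝔩_k) → Y(𝔤𝔩_N)` onto the upper left block, `t_ij(u) ↦ t_ij(u)`. -/
def upperLeft {k N : ℕ} (h : k ≤ N) : Yangian k →ₐ[ℂ] Yangian N := embed (Fin.castLEEmb h)

/-- The homomorphism `Y(𝔤𝔩_k) → Y(𝔤𝔩_N)` onto the lower right block,
`t_ij(u) ↦ t_{N-k+i, N-k+j}(u)`. -/
def lowerRight {k N : ℕ} (h : k ≤ N) : Yangian k →ₐ[ℂ] Yangian N := embed (lastEmb h)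

/-- The Olshanski homomorphism `ψ_k = ω_N ∘ j_k ∘ ω_k : Y(𝔤𝔩_k) → Y(𝔤𝔩_N)`, where `j_k` is the
lower right block inclusion. -/
def psi {k N : ℕ} (h : k ≤ N) : Yangian k →ₐ[ℂ] Yangian N :=
  (omega N).comp ((lowerRight h).comp (omega k))

/-- The homomorphism `φ_k : Y(𝔤𝔩_k) → Y(𝔤𝔩_N)` determined by `φ_k ∘ δ_k = δ_N ∘ ψ_k`; since `δ_k`
is an involution, it is `δ_N ∘ ψ_k ∘ δ_k`. -/
def phi {k N : ℕ} (h : k ≤ N) : Yangian k →ₐ[ℂ] Yangian N :=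
  (delta N).comp ((psi h).comp (delta k))

theorem delta_delta (N : ℕ) (x : Yangian N) : delta N (delta N x) = x := by
  have h : (delta N).comp (delta N) = AlgHom.id ℂ (Yangian N) := by
    refine Yangian.hom_ext fun i j r => ?_
    rw [AlgHom.comp_apply, delta, Yangian.lift_gen, map_zsmul, Yangian.lift_gen, smul_smul,
      ← mul_pow, Fin.rev_rev, Fin.rev_rev]
    simp
  exact DFunLike.congr_fun h x

theorem phi_delta {k N : ℕ} (h : k ≤ N) (x : Yangian k) : phi h (delta k x) = delta N (psi h x) := by
  simp [phi, delta_delta]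

/-- The quantum determinant
`∑ σ, sign σ * t_{σ 1, 1}(u) * t_{σ 2, 2}(u - 1) * ⋯ * t_{σ N, N}(u - N + 1)`. -/
def qdet (N : ℕ) : Ser (Yangian N) :=
  ∑ σ : Equiv.Perm (Fin N), (Equiv.Perm.sign σ : ℤ) •
    (List.ofFn fun j : Fin N => shift (-(j : ℤ)) (genSer N (σ j) j)).prod

/-- The generating difference operator
`∑ σ, sign σ * D_{σ 1, 1} * ⋯ * D_{σ N, N}` with `D_ij = δ_ij τ - t_ij(u - j + 1)` of the Bethe
subalgebra of the Yangian (indices `i, j` counted from `1`). -/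
def betheOp (N : ℕ) : DiffOp (Yangian N) :=
  ∑ σ : Equiv.Perm (Fin N), (Equiv.Perm.sign σ : ℤ) •
    (List.ofFn fun j : Fin N => (if σ j = j then tauOp (Yangian N) else 0) -
      coeffOp (shift (-(j : ℤ)) (genSer N (σ j) j))).prod

/-- The Lie algebra `𝔤𝔩_N`: matrices with the commutator bracket. -/
instance glLieRing (N : ℕ) : LieRing (Matrix (Fin N) (Fin N) ℂ) := LieRing.ofAssociativeRing

/-- The universal enveloping algebra `U(𝔤𝔩_N)`. -/
abbrev Ugl (N : ℕ) : Type := UniversalEnvelopingAlgebra ℂ (Matrix (Fin N) (Fin N) ℂ)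

/-- The standard basis elements `e_ij` in `U(𝔤𝔩_N)`. -/
def eGen (N : ℕ) (i j : Fin N) : Ugl N :=
  UniversalEnvelopingAlgebra.ι ℂ (Matrix.single i j (1 : ℂ))

theorem eGen_comm (N : ℕ) (i j k l : Fin N) :
    eGen N i j * eGen N k l - eGen N k l * eGen N i j =
      (if k = j then eGen N i l else 0) - if i = l then eGen N k j else 0 := by
  let _ : LieRing (Ugl N) := LieRing.ofAssociativeRing
  have h := (UniversalEnvelopingAlgebra.ι ℂ).map_lie (Matrix.single i j (1 : ℂ))
    (Matrix.single k l (1 : ℂ))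
  rw [LieRing.of_associative_ring_bracket, LieRing.of_associative_ring_bracket] at h
  rw [eGen, eGen, ← h, map_sub]
  congr 1
  · split_ifs with hkj
    · subst hkj
      rw [Matrix.single_mul_single_same, mul_one]
      rfl
    · rw [Matrix.single_mul_single_of_ne _ _ _ _ (fun e => hkj e.symm), map_zero]
  · split_ifs with hil
    · subst hil
      rw [Matrix.single_mul_single_same, mul_one]
      rfl
    · rw [Matrix.single_mul_single_of_ne _ _ _ _ (fun e => hil e.symm), map_zero]

/-- The coefficients of `δ_ij + e_ij * u⁻¹`. -/
def evFamily (N : ℕ) (i j : Fin N) : ℕ → Ugl N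
  | 0 => if i = j then 1 else 0
  | 1 => eGen N i j
  | _ + 2 => 0

theorem isYangianFamily_ev (N : ℕ) : IsYangianFamily (evFamily N) where
  zero _ _ := rfl
  rel i j k l r s := by
    match r, s with
    | 0, 0 =>
      simp only [evFamily]
      split_ifs <;> simp
    | 0, 1 =>
      simp only [evFamily]
      rw [eGen_comm]
      split_ifs <;> simp
    | 1, 0 =>
      simp only [evFamily]
      rw [eGen_comm]
      split_ifs <;> simp
    | 1, 1 => simp [evFamily]
    | 0, s + 2 => simp [evFamily]
    | r + 2, 0 => simp [evFamily]
    | 1, s + 2 => simp [evFamily]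
    | r + 2, 1 => simp [evFamily]
    | r + 2, s + 2 => simp [evFamily]

/-- The evaluation homomorphism `Y(𝔤𝔩_N) → U(𝔤𝔩_N)`, `t_ij(u) ↦ δ_ij + e_ij * u⁻¹`. -/
def ev (N : ℕ) : Yangian N →ₐ[ℂ] Ugl N := Yangian.lift _ (isYangianFamily_ev N)

/-- The falling factorial `(u + c) (u + c - 1) ⋯ (u + c - k + 1)`. -/
def falling (A : Type*) [Ring A] [Algebra ℂ A] (c k : ℕ) : Ser A :=
  Polynomial.aeval (uVar A + (c : Ser A)) (descPochhammer ℂ k)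

/-- The difference operator `D̄_m`, equal to
`(u + n)^{\underline{n + m}} ev (i_n (qdet_n (u + n)) ψ_m (D_m))`
with coefficients in `U(𝔤𝔩_{n+m})`, where `i_n` is the upper left block inclusion. -/
def dbarLower (n m : ℕ) : DiffOp (Ugl (n + m)) :=
  coeffOp (falling (Ugl (n + m)) n (n + m)) *
    mapOp (ev (n + m))
      (coeffOp (mapSer (upperLeft (Nat.le_add_right n m)) (shift n (qdet n))) *
        mapOp (psi (Nat.le_add_left m n)) (betheOp m))

/-- The difference operator `D̄_n`, equal to
`(u + m)^{\underline{n + m}} ev (j_m (qdet_m (-u - 1)) φ_n (δ̂_n D_n))` with coefficients in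
`U(𝔤𝔩_{n+m})`, where `j_m` is the lower right block inclusion; here `qdet_m (-u - 1)` is the shift `u ↦ u + 1` of `qdet_m (-u)`. -/
def dbarUpper (n m : ℕ) : DiffOp (Ugl (n + m)) :=
  coeffOp (falling (Ugl (n + m)) m (n + m)) *
    mapOp (ev (n + m))
      (coeffOp (mapSer (lowerRight (Nat.le_add_left m n)) (shift 1 (reflect (qdet m)))) *
        mapOp (phi (Nat.le_add_right n m)) (deltaHat n (betheOp n)))

end Yangians

section PolynomialOperators

/-- The operator `(u - c) d` with `d = τ - 1` in `D(ℂ)`. -/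
def ucd (c : ℂ) : DiffOp ℂ :=
  coeffOp (uVar ℂ - algebraMap ℂ (Ser ℂ) c) * (tauOp ℂ - 1)

/-- The unital subalgebra `𝒫(c)` of `D(ℂ)` generated by `u` and `(u - c) d`. -/
def PolyOp (c : ℂ) : Subalgebra ℂ (DiffOp ℂ) :=
  Algebra.adjoin ℂ {coeffOp (uVar ℂ), ucd c}

/-- The element `u` of `𝒫(c)`. -/
def PolyOp.u (c : ℂ) : PolyOp c :=
  ⟨coeffOp (uVar ℂ), Algebra.subset_adjoin (Set.mem_insert _ _)⟩

/-- The element `(u - c) d` of `𝒫(c)`. -/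
def PolyOp.ud (c : ℂ) : PolyOp c :=
  ⟨ucd c, Algebra.subset_adjoin (Set.mem_insert_of_mem _ rfl)⟩

variable {A : Type*} [Ring A] [Algebra ℂ A]

/-- The identification `a ⊗ p ↦ a * p` of `A ⊗ 𝒫(c)` with a subspace of `D(A)`, where `p` is
regarded as a difference operator with coefficients in `ℂ ⊆ A`. -/
def tensorToOp (A : Type*) [Ring A] [Algebra ℂ A] (c : ℂ) :
    TensorProduct ℂ A (PolyOp c) →ₗ[ℂ] DiffOp A :=
  TensorProduct.lift (LinearMap.mk₂ ℂ
    (fun (a : A) (p : PolyOp c) =>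
      coeffOp (HahnSeries.C a) * mapOp (Algebra.ofId ℂ A) (p : DiffOp ℂ))
    (fun a b p => by
      rw [← add_mul]
      congr 1
      exact Subtype.ext (by simp [coeffOp]))
    (fun r a p => by
      rw [← smul_mul_assoc]
      congr 1
      have h : HahnSeries.C (r • a) = r • (HahnSeries.C a : Ser A) := by
        ext N
        rw [HahnSeries.coeff_smul, HahnSeries.C_apply, HahnSeries.C_apply,
          HahnSeries.coeff_single, HahnSeries.coeff_single, smul_ite, smul_zero]
      exact Subtype.ext (by rw [h]; exact map_smul (Algebra.lmul ℂ (Ser A)) r _))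
    (fun a p q => by rw [Subalgebra.coe_add, map_add, mul_add])
    (fun r a p => by rw [Subalgebra.coe_smul, map_smul, mul_smul_comm]))

end PolynomialOperators
end YangianDuality
end

open YangianDuality

/-! Both operators are, up to sign, one explicit column determinant. In that form the duality is an
anti-involution that carries one matrix to minus the other.

Write σ = τ⁻¹ and T = 1 + e u⁻¹. Collecting the shifts of the factors on the right gives qdet =
colDet(Tσ) τⁿ for the upper left block and D_m = (-1)^m colDet(Sσ - 1) τ^m. Here S is the image of
the generating matrix under ψ_m. It is the inverse of the lower right block of T⁻¹, hence the Schur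
complement of the upper left block in T (`psi_genMatrix_inverse`, `exists_schur_of_inverse`). The
matrix Tσ is a Manin matrix, and it remains one after subtracting the constant matrix D = diag(0, …,
0, 1, …, 1) with m ones. In Tσ - D the Schur complement is exactly Sσ - 1, so the Schur formula for
Manin matrices (`IsManin.colDet_eq_mul`, proved with Grassmann variables) fuses the two factors into
colDet(Tσ - D). With z = (u - m + 1)τ, the falling factorial is z^(n+m) σ^(n+m). Moving the powers
of z through the columns one at a time clears the denominators and leaves, with indices counted from
0, (-1)^m times the column determinant of e_ij + δ_ij (u + n - j - [n ≤ j] z)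
(`falling_mul_qColDet_mul_betheDet`, `val_dbarLower`).

For the other operator, coefficients are read in the opposite algebra. There the elements -e_ij,
with indices reversed, again satisfy the 𝔤𝔩 relations, and δ̂ becomes an anti-homomorphism. Since
the two factors of D̄_n have commuting coefficients (`ev_lowerRight_comm_phi`), the result is the
same determinant with n and m exchanged (`val_opOp_dbarUpper`).

The algebra 𝒫(c) is the algebra on a, z with z a = a z + z, through a ↦ u and z ↦ (u - c)τ. So both
determinants visibly lie in U(𝔤𝔩) ⊗ 𝒫(c). The required anti-isomorphism is z ↦ z, a ↦ z - a - 1. It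
reverses the order of the columns and turns the matrix for (m, n) into minus the matrix for (n, m)
(`unop_tensorAntiHom_dualDet`). Injectivity of U ⊗ 𝒫(c) → D(U) (`tensorToOp_injective`) makes the
statement independent of the chosen preimage. -/

noncomputable section
namespace YangianDuality

open TensorProduct

/-! ### Column determinants and Manin matrices through Grassmann variables -/

section ColumnDeterminant

/-- The column determinant of a matrix over a noncommutative ring. -/
def colDet {R : Type*} [Ring R] {K : ℕ} (M : Matrix (Fin K) (Fin K) R) : R :=
  ∑ p : Equiv.Perm (Fin K), (Equiv.Perm.sign p : ℤ) • (List.ofFn fun j => M (p j) j).prod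

/-- Manin matrices: the entries of a column commute, and the cross commutators agree. -/
def IsManin {R ι κ : Type*} [Ring R] (M : Matrix ι κ R) : Prop :=
  ∀ i j k l, M i j * M k l - M k l * M i j = M k j * M i l - M i l * M k j

variable {R : Type*} [Ring R] [Algebra ℂ R] {V : Type*} [AddCommGroup V] [Module ℂ V]

theorem prod_ofFn_tmul {K : ℕ} {A B : Type*} [Ring A] [Algebra ℂ A] [Ring B] [Algebra ℂ B]
    (a : Fin K → A) (b : Fin K → B) :
    (List.ofFn fun j => a j ⊗ₜ[ℂ] b j).prod = (List.ofFn a).prod ⊗ₜ[ℂ] (List.ofFn b).prod := by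
  induction K with
  | zero => simp [Algebra.TensorProduct.one_def]
  | succ K ih =>
    rw [List.ofFn_succ, List.ofFn_succ, List.ofFn_succ, List.prod_cons, List.prod_cons,
      List.prod_cons, ih, Algebra.TensorProduct.tmul_mul_tmul]

theorem prod_ofFn_sum {K : ℕ} {ι A : Type*} [Fintype ι] [Ring A] [Algebra ℂ A]
    (g : Fin K → ι → A) :
    (List.ofFn fun j => ∑ i, g j i).prod =
      ∑ f : Fin K → ι, (List.ofFn fun j => g j (f j)).prod := by
  classical
  have h := (MultilinearMap.mkPiAlgebraFin ℂ K A).map_sum g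
  simpa only [MultilinearMap.mkPiAlgebraFin_apply] using h

/-- The element `∑ i, v i ⊗ c i` of the exterior algebra with coefficients in `R`. -/
def grassmannCol {ι : Type*} [Fintype ι] (v : ι → V) (c : ι → R) : ExteriorAlgebra ℂ V ⊗[ℂ] R :=
  ∑ i, ExteriorAlgebra.ι ℂ (v i) ⊗ₜ[ℂ] c i

theorem prod_grassmannCol {ι : Type*} [Fintype ι] {K : ℕ} (v : ι → V) (c : Fin K → ι → R) :
    (List.ofFn fun j => grassmannCol v (c j)).prod =
      ∑ f : Fin K → ι, ExteriorAlgebra.ιMulti ℂ K (v ∘ f) ⊗ₜ[ℂ]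
        (List.ofFn fun j => c j (f j)).prod := by
  simp only [grassmannCol, prod_ofFn_sum, prod_ofFn_tmul, ExteriorAlgebra.ιMulti_apply,
    Function.comp_apply]

/-- When the product of columns is expanded, only injective row choices survive in the exterior
algebra. These are permutations, and each contributes its sign. The entries of M need not commute,
because the factors keep the order of the columns. -/
theorem prod_grassmannCol_eq_colDet {K : ℕ} (v : Fin K → V) (M : Matrix (Fin K) (Fin K) R) :
    (List.ofFn fun j => grassmannCol v (M.col j)).prod =
      ExteriorAlgebra.ιMulti ℂ K v ⊗ₜ[ℂ] colDet M := by
  classical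
  rw [prod_grassmannCol, colDet, TensorProduct.tmul_sum]
  symm
  refine Finset.sum_of_injOn (fun p : Equiv.Perm (Fin K) => (p : Fin K → Fin K)) ?_ ?_ ?_ ?_
  · intro p _ q _ h
    exact DFunLike.coe_injective h
  · intro p _
    exact Finset.mem_coe.mpr (Finset.mem_univ _)
  · intro f _ hf
    rw [AlternatingMap.map_eq_zero_of_not_injective, TensorProduct.zero_tmul]
    intro hinj
    apply hf
    have hf' : Function.Injective f := hinj.of_comp
    exact ⟨Equiv.ofBijective f (Finite.injective_iff_bijective.mp hf'), by simp, rfl⟩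
  · intro p _
    rw [AlternatingMap.map_perm, TensorProduct.tmul_smul, Units.smul_def, ← TensorProduct.smul_tmul']
    rfl

theorem eq_zero_of_eq_neg {E : Type*} [AddCommGroup E] [Module ℂ E] {x : E} (h : x = -x) :
    x = 0 := by
  have h2 : (2 : ℂ) • x = 0 := by
    rw [two_smul]
    nth_rewrite 2 [h]
    exact add_neg_cancel x
  exact (smul_eq_zero.mp h2).resolve_left two_ne_zero

/-- This is the reason for the Manin condition: it says that M i j * M k l + M i l * M k j is
symmetric in i and k, so its contraction with the antisymmetric products of the Grassmann variables
vanishes. -/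
theorem grassmannCol_anticomm {ι κ : Type*} [Fintype ι] (v : ι → V) {M : Matrix ι κ R}
    (hM : IsManin M) (j l : κ) :
    grassmannCol v (M.col j) * grassmannCol v (M.col l) =
      -(grassmannCol v (M.col l) * grassmannCol v (M.col j)) := by
  set a : ι → ExteriorAlgebra ℂ V := fun i => ExteriorAlgebra.ι ℂ (v i) with ha
  have hexp : ∀ j l, grassmannCol v (M.col j) * grassmannCol v (M.col l) =
      ∑ i, ∑ k, (a i * a k) ⊗ₜ[ℂ] (M i j * M k l) := by
    intro j l
    simp only [grassmannCol, Finset.sum_mul_sum, Algebra.TensorProduct.tmul_mul_tmul]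
    rfl
  have hanti : ∀ i k, a i * a k = -(a k * a i) := fun i k =>
    eq_neg_of_add_eq_zero_left (ExteriorAlgebra.ι_add_mul_swap _ _)
  -- Exchanging the names of i and k flips the sign of the Grassmann factor and leaves the
  -- coefficient unchanged. The sum therefore equals its own negative.
  have key : ∑ i, ∑ k, (a i * a k) ⊗ₜ[ℂ] (M i j * M k l + M i l * M k j) =
      -∑ i, ∑ k, (a i * a k) ⊗ₜ[ℂ] (M i j * M k l + M i l * M k j) := by
    conv_lhs => rw [Finset.sum_comm]
    rw [← Finset.sum_neg_distrib]
    refine Finset.sum_congr rfl fun i _ => ?_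
    rw [← Finset.sum_neg_distrib]
    refine Finset.sum_congr rfl fun k _ => ?_
    rw [hanti k i, TensorProduct.neg_tmul]
    congr 2
    linear_combination (norm := abel) -hM i j k l
  have hzero := eq_zero_of_eq_neg key
  rw [eq_neg_iff_add_eq_zero, hexp, hexp, ← hzero]
  simp only [TensorProduct.tmul_add, Finset.sum_add_distrib]

theorem grassmannCol_mul_self {ι κ : Type*} [Fintype ι] (v : ι → V) {M : Matrix ι κ R}
    (hM : IsManin M) (j : κ) :
    grassmannCol v (M.col j) * grassmannCol v (M.col j) = 0 :=
  eq_zero_of_eq_neg (grassmannCol_anticomm v hM j j)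

theorem mul_list_prod_mul_eq_zero {G : Type*} [Ring G] {t : G} (ht : t * t = 0) (l : List G)
    (hl : ∀ y ∈ l, y * t = -(t * y)) : t * (l.prod * t) = 0 := by
  induction l with
  | nil => simpa using ht
  | cons y l ih =>
    have h1 := ih fun z hz => hl z (List.mem_cons_of_mem _ hz)
    have h2 : t * y = -(y * t) := by rw [hl y List.mem_cons_self, neg_neg]
    rw [List.prod_cons, mul_assoc, ← mul_assoc, h2, neg_mul, mul_assoc, h1, mul_zero, neg_zero]

/-- The last factor can be carried back, up to sign, to its earlier occurrence in the product, where
its square appears. -/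
theorem list_prod_mul_eq_zero {G : Type*} [Ring G] {t : G} (ht : t * t = 0) (l : List G)
    (hl : ∀ y ∈ l, y * t = -(t * y)) (hmem : t ∈ l) : l.prod * t = 0 := by
  induction l with
  | nil => simp at hmem
  | cons y l ih =>
    have hl' := fun z hz => hl z (List.mem_cons_of_mem y hz)
    rw [List.prod_cons, mul_assoc]
    rcases List.mem_cons.mp hmem with rfl | h
    · exact mul_list_prod_mul_eq_zero ht l hl'
    · rw [ih hl' h, mul_zero]

/-- The determinant, extended by zero to the other degrees, is a functional on the exterior algebra
with value 1 on the volume element. Applying it to the first tensor factor recovers the coefficient.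
-/
theorem tmul_injective_of_basis {K : ℕ} {r s : R}
    (h : ExteriorAlgebra.ιMulti ℂ K (fun i => (Pi.single i 1 : Fin K → ℂ)) ⊗ₜ[ℂ] r =
      ExteriorAlgebra.ιMulti ℂ K (fun i => (Pi.single i 1 : Fin K → ℂ)) ⊗ₜ[ℂ] s) : r = s := by
  let φ : ExteriorAlgebra ℂ (Fin K → ℂ) →ₗ[ℂ] ℂ :=
    ExteriorAlgebra.liftAlternating (Pi.single K Matrix.detRowAlternating)
  have hφ : φ (ExteriorAlgebra.ιMulti ℂ K (fun i => (Pi.single i 1 : Fin K → ℂ))) = 1 := by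
    rw [ExteriorAlgebra.liftAlternating_apply_ιMulti, Pi.single_eq_same]
    have : (fun i => (Pi.single i 1 : Fin K → ℂ)) = (1 : Matrix (Fin K) (Fin K) ℂ) := by
      ext i j
      rw [Matrix.one_apply, Pi.single_apply]
      simp [eq_comm]
    exact (congrArg Matrix.det this).trans Matrix.det_one
  have h1 := congrArg (fun x => TensorProduct.lid ℂ R (LinearMap.rTensor R φ x)) h
  simpa [hφ] using h1

/-- A product of columns, multiplied by a fixed volume element, only depends on the entries
outside of the rows of the volume element. -/
theorem prod_grassmannCol_mul {n k : ℕ} (v : Fin (n + k) → V) (M : Fin n → Fin (n + k) → R)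
    (r : R) :
    (List.ofFn fun j => grassmannCol v (M j)).prod *
        ExteriorAlgebra.ιMulti ℂ k (fun b => v (Fin.natAdd n b)) ⊗ₜ[ℂ] r =
      ExteriorAlgebra.ιMulti ℂ (n + k) v ⊗ₜ[ℂ]
        (colDet (Matrix.of fun i j => M j (Fin.castAdd k i)) * r) := by
  classical
  have happ : ∀ w : Fin n → V, ExteriorAlgebra.ιMulti ℂ n w *
      ExteriorAlgebra.ιMulti ℂ k (fun b => v (Fin.natAdd n b)) =
      ExteriorAlgebra.ιMulti ℂ (n + k) (Fin.append w fun b => v (Fin.natAdd n b)) := by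
    intro w
    rw [ExteriorAlgebra.ιMulti_apply, ExteriorAlgebra.ιMulti_apply, ExteriorAlgebra.ιMulti_apply,
      ← List.prod_append, ← List.ofFn_fin_append]
    congr 2
    ext i
    refine Fin.addCases (fun a => ?_) (fun b => ?_) i <;> simp
  have hv : ExteriorAlgebra.ιMulti ℂ (n + k) v =
      ExteriorAlgebra.ιMulti ℂ n (fun a => v (Fin.castAdd k a)) *
        ExteriorAlgebra.ιMulti ℂ k (fun b => v (Fin.natAdd n b)) := by
    rw [happ]
    congr 1
    ext i
    refine Fin.addCases (fun a => ?_) (fun b => ?_) i <;> simp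
  rw [hv, ← Algebra.TensorProduct.tmul_mul_tmul, ← prod_grassmannCol_eq_colDet,
    prod_grassmannCol, prod_grassmannCol, Finset.sum_mul, Finset.sum_mul]
  symm
  refine Finset.sum_of_injOn (fun f j => Fin.castAdd k (f j)) ?_ ?_ ?_ ?_
  · intro f _ g _ h
    funext j
    exact Fin.castAdd_injective _ _ (congrFun h j)
  · intro f _
    exact Finset.mem_coe.mpr (Finset.mem_univ _)
  · intro f _ hf
    rw [Algebra.TensorProduct.tmul_mul_tmul, happ, AlternatingMap.map_eq_zero_of_not_injective,
      TensorProduct.zero_tmul]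
    intro hinj
    apply hf
    -- A row among the last k would repeat a vector of the fixed volume element, so injectivity
    -- confines f to the first n rows.
    have : ∀ j, ∃ a, Fin.castAdd k a = f j := by
      intro j
      induction hfj : f j using Fin.addCases with
      | left a => exact ⟨a, rfl⟩
      | right b =>
        have h1 := @hinj (Fin.castAdd k j) (Fin.natAdd n b) (by simp [hfj])
        have h2 := congrArg Fin.val h1
        simp only [Fin.val_castAdd, Fin.val_natAdd] at h2
        omega
    choose g hg using this
    exact ⟨g, by simp, funext hg⟩
  · intro f _
    rfl

/-- The Schur complement formula for the column determinant of a Manin matrix. -/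
theorem IsManin.colDet_eq_mul {n k : ℕ} {M : Matrix (Fin (n + k)) (Fin (n + k)) R}
    (hM : IsManin M) (X : Matrix (Fin n) (Fin k) R) (S : Matrix (Fin k) (Fin k) R)
    (hX : ∀ i b, ∑ a, M (Fin.castAdd k i) (Fin.castAdd k a) * X a b =
      M (Fin.castAdd k i) (Fin.natAdd n b))
    (hS : ∀ i b, S i b = M (Fin.natAdd n i) (Fin.natAdd n b) -
      ∑ a, M (Fin.natAdd n i) (Fin.castAdd k a) * X a b) :
    colDet M = colDet (M.submatrix (Fin.castAdd k) (Fin.castAdd k)) * colDet S := by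
  let v : Fin (n + k) → (Fin (n + k) → ℂ) := fun i => Pi.single i 1
  let θ : Fin (n + k) → ExteriorAlgebra ℂ (Fin (n + k) → ℂ) ⊗[ℂ] R :=
    fun j => grassmannCol v (M.col j)
  let η : Fin k → ExteriorAlgebra ℂ (Fin (n + k) → ℂ) ⊗[ℂ] R :=
    fun b => grassmannCol (fun i => v (Fin.natAdd n i)) (S.col b)
  set w := (List.ofFn fun a : Fin n => θ (Fin.castAdd k a)).prod with hw
  -- Column operations: subtracting right multiples of the first n columns kills the upper entries
  -- by `hX` and leaves the Schur complement below.
  have hη : ∀ b, η b = θ (Fin.natAdd n b) -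
      ∑ a, θ (Fin.castAdd k a) * (1 : ExteriorAlgebra ℂ (Fin (n + k) → ℂ)) ⊗ₜ[ℂ] X a b := by
    intro b
    simp only [η, θ, grassmannCol, Finset.sum_mul, Algebra.TensorProduct.tmul_mul_tmul, mul_one]
    rw [Finset.sum_comm, ← Finset.sum_sub_distrib, Fin.sum_univ_add]
    simp only [← TensorProduct.tmul_sum, ← TensorProduct.tmul_sub, Matrix.col_apply, hX, sub_self,
      Finset.sum_const_zero, zero_add, hS]
  have hanti : ∀ j l, θ j * θ l = -(θ l * θ j) := grassmannCol_anticomm v hM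
  -- The corrections are invisible after multiplication by w. The factor θ of each correction
  -- already occurs in w and anticommutes with everything in between. Arbitrary index maps g are
  -- allowed so that the induction can remove the last factor.
  have hprod : ∀ (c : ℕ) (g : Fin c → Fin k), w * (List.ofFn fun b => η (g b)).prod =
      w * (List.ofFn fun b => θ (Fin.natAdd n (g b))).prod := by
    intro c
    induction c with
    | zero => simp
    | succ c ih =>
      intro g
      rw [List.ofFn_succ', List.ofFn_succ', List.concat_eq_append, List.concat_eq_append,
        List.prod_append, List.prod_append, ← mul_assoc, ← mul_assoc, ih fun b => g b.castSucc,
        List.prod_singleton, List.prod_singleton, hη, mul_sub, Finset.mul_sum]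
      rw [Finset.sum_eq_zero, sub_zero]
      intro a _
      rw [← mul_assoc, hw, ← List.prod_append]
      rw [list_prod_mul_eq_zero (grassmannCol_mul_self v hM _), zero_mul]
      · intro y hy
        rw [List.mem_append, List.mem_ofFn, List.mem_ofFn] at hy
        rcases hy with ⟨b, rfl⟩ | ⟨b, rfl⟩ <;> exact hanti _ _
      · exact List.mem_append_left _ (List.mem_ofFn.mpr ⟨a, rfl⟩)
  apply tmul_injective_of_basis
  change ExteriorAlgebra.ιMulti ℂ (n + k) v ⊗ₜ[ℂ] _ = ExteriorAlgebra.ιMulti ℂ (n + k) v ⊗ₜ[ℂ] _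
  rw [← prod_grassmannCol_eq_colDet]
  have h1 := hprod k id
  have h2 : (List.ofFn fun b : Fin k => η (id b)).prod = _ :=
    prod_grassmannCol_eq_colDet (fun i => v (Fin.natAdd n i)) S
  rw [h2, hw, prod_grassmannCol_mul v] at h1
  rw [List.ofFn_add, List.prod_append]
  exact h1.symm

end ColumnDeterminant

/-! ### Shift, reflection, change of coefficients and opposite coefficients on Laurent series -/

section SeriesLemmas

variable {A B : Type*} [Ring A] [Ring B]

/-- This is the binomial theorem for (c + e)^k, combined with the rule that choosing i and then k -
i from -p is choosing k and then i among the k. -/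
theorem shiftCoeff_comp (c e p r : ℤ) (S : Finset ℤ) (hS : Finset.Icc p r ⊆ S) :
    ∑ q ∈ S, shiftCoeff c q (r - q) * shiftCoeff e p (q - p) = shiftCoeff (c + e) p (r - p) := by
  rw [← Finset.sum_subset hS]
  · by_cases hd : p ≤ r
    · obtain ⟨k, hk⟩ := Int.eq_ofNat_of_zero_le (sub_nonneg.mpr hd)
      have hr : r = p + k := by omega
      subst hr
      rw [shiftCoeff, if_pos (by omega), hk, Int.toNat_natCast, add_comm c e, add_pow,
        Finset.mul_sum]
      refine Finset.sum_nbij' (fun q => (q - p).toNat) (fun i => p + (i : ℤ)) ?_ ?_ ?_ ?_ ?_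
      · intro q hq
        rw [Finset.mem_Icc] at hq
        rw [Finset.mem_range]
        omega
      · intro i hi
        rw [Finset.mem_range] at hi
        rw [Finset.mem_Icc]
        omega
      · intro q hq
        rw [Finset.mem_Icc] at hq
        omega
      · intro i _
        omega
      · intro q hq
        rw [Finset.mem_Icc] at hq
        obtain ⟨i, hi⟩ := Int.eq_ofNat_of_zero_le (sub_nonneg.mpr hq.1)
        have hq' : q = p + i := by omega
        subst hq'
        have hik : i ≤ k := by omega
        have h1 : (p + (k : ℤ) - (p + i)).toNat = k - i := by omega
        have h2 : (p + (i : ℤ) - p).toNat = i := by omega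
        rw [shiftCoeff, shiftCoeff, if_pos (by omega), if_pos (by omega), h1, h2]
        have h3 := Ring.choose_smul_choose (-p) hik
        rw [nsmul_eq_mul, sub_eq_add_neg, ← neg_add] at h3
        linear_combination (-(e ^ i * c ^ (k - i))) * h3
    · rw [Finset.Icc_eq_empty hd, Finset.sum_empty, shiftCoeff, if_neg (by omega)]
  · intro q _ hq
    rw [Finset.mem_Icc, not_and_or] at hq
    rcases hq with hq | hq
    · rw [shiftCoeff, shiftCoeff, if_neg (by omega : ¬ 0 ≤ q - p), mul_zero]
    · rw [shiftCoeff, if_neg (by omega), zero_mul]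

theorem shift_shift (c e : ℤ) (f : Ser A) : shift c (shift e f) = shift (c + e) f := by
  obtain ⟨L, hf, -⟩ := exists_bound f f
  ext N
  rw [coeff_shift c _ L N (coeff_shift_of_lt e f L hf) _ subset_rfl,
    coeff_shift (c + e) f L N hf _ subset_rfl]
  have h : ∀ q ∈ Finset.Icc L N, shiftCoeff c q (N - q) • (shift e f).coeff q =
      ∑ p ∈ Finset.Icc L N,
        (shiftCoeff c q (N - q) * shiftCoeff e p (q - p)) • f.coeff p := by
    intro q hq
    rw [Finset.mem_Icc] at hq
    rw [coeff_shift e f L q hf (Finset.Icc L N) (Finset.Icc_subset_Icc le_rfl hq.2),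
      Finset.smul_sum]
    simp only [smul_smul]
  rw [Finset.sum_congr rfl h, Finset.sum_comm]
  refine Finset.sum_congr rfl fun p hp => ?_
  rw [Finset.mem_Icc] at hp
  rw [← Finset.sum_smul, shiftCoeff_comp c e p N _ (Finset.Icc_subset_Icc hp.1 le_rfl)]

theorem shift_zero_apply (f : Ser A) : shift 0 f = f := by
  obtain ⟨L, hf, -⟩ := exists_bound f f
  ext N
  rw [coeff_shift 0 f L N hf (insert N (Finset.Icc L N)) (Finset.subset_insert _ _),
    Finset.sum_eq_single N]
  · simp [shiftCoeff]
  · intro p _ hp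
    rw [shiftCoeff]
    split_ifs with h
    · rw [zero_pow (by omega), mul_zero, zero_smul]
    · rw [zero_smul]
  · intro h
    exact absurd (Finset.mem_insert_self _ _) h

theorem coeff_reflect (f : Ser A) (N : ℤ) :
    (reflect f).coeff N = (Int.negOnePow N : ℤ) • f.coeff N := rfl

theorem negOnePow_mul_negOnePow_sub (N p : ℤ) :
    ((Int.negOnePow p : ℤˣ) : ℤ) * ((Int.negOnePow (N - p) : ℤˣ) : ℤ) =
      ((Int.negOnePow N : ℤˣ) : ℤ) := by
  rw [← Units.val_mul, ← Int.negOnePow_add, add_sub_cancel]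

theorem reflect_mul (f g : Ser A) : reflect (f * g) = reflect f * reflect g := by
  obtain ⟨L, hf, hg⟩ := exists_bound f g
  ext N
  rw [coeff_reflect, coeff_mul_of_bound f g L hf hg N _ subset_rfl,
    coeff_mul_of_bound (reflect f) (reflect g) L
      (fun p hp => by rw [coeff_reflect, hf p hp, smul_zero])
      (fun p hp => by rw [coeff_reflect, hg p hp, smul_zero]) N _ subset_rfl, Finset.smul_sum]
  refine Finset.sum_congr rfl fun p _ => ?_
  rw [coeff_reflect, coeff_reflect, smul_mul_smul_comm, negOnePow_mul_negOnePow_sub]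

theorem reflect_add (f g : Ser A) : reflect (f + g) = reflect f + reflect g := by
  ext N
  simp only [coeff_reflect, HahnSeries.coeff_add, smul_add]

theorem reflect_single (p : ℤ) (a : A) :
    reflect (HahnSeries.single p a) = HahnSeries.single p ((Int.negOnePow p : ℤ) • a) := by
  ext N
  rw [coeff_reflect, HahnSeries.coeff_single, HahnSeries.coeff_single]
  split_ifs with h
  · rw [h]
  · rw [smul_zero]

theorem reflect_one : reflect (1 : Ser A) = 1 := by
  rw [← HahnSeries.single_zero_one, reflect_single]
  simp

theorem reflect_reflect (f : Ser A) : reflect (reflect f) = f := by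
  ext N
  rw [coeff_reflect, coeff_reflect, smul_smul, ← Units.val_mul, Int.units_mul_self, Units.val_one,
    one_smul]

theorem shiftCoeff_neg (c p d : ℤ) :
    shiftCoeff (-c) p d = ((Int.negOnePow d : ℤˣ) : ℤ) * shiftCoeff c p d := by
  rw [shiftCoeff, shiftCoeff]
  split_ifs with h
  · obtain ⟨k, rfl⟩ := Int.eq_ofNat_of_zero_le h
    have : ((Int.negOnePow (k : ℤ) : ℤˣ) : ℤ) = (-1) ^ k := by
      rw [Int.negOnePow_def, zpow_natCast, Units.val_pow_eq_pow_val, Units.val_neg, Units.val_one]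
    rw [this, Int.toNat_natCast, neg_pow]
    ring
  · rw [mul_zero]

theorem reflect_shift (c : ℤ) (f : Ser A) : reflect (shift c f) = shift (-c) (reflect f) := by
  obtain ⟨L, hf, -⟩ := exists_bound f f
  ext N
  rw [coeff_reflect, coeff_shift c f L N hf _ subset_rfl, coeff_shift (-c) (reflect f) L N
    (fun p hp => by rw [coeff_reflect, hf p hp, smul_zero]) _ subset_rfl, Finset.smul_sum]
  refine Finset.sum_congr rfl fun p _ => ?_
  rw [coeff_reflect, shiftCoeff_neg, smul_smul, smul_smul]
  congr 1
  rw [← negOnePow_mul_negOnePow_sub N p]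
  have := Int.units_mul_self (Int.negOnePow p)
  have h2 : ((Int.negOnePow p : ℤˣ) : ℤ) * ((Int.negOnePow p : ℤˣ) : ℤ) = 1 := by
    rw [← Units.val_mul, this, Units.val_one]
  ring

theorem coeff_mapSer [Algebra ℂ A] [Algebra ℂ B] (h : A →ₐ[ℂ] B) (f : Ser A) (N : ℤ) :
    (mapSer h f).coeff N = h (f.coeff N) := rfl

theorem mapSer_mul [Algebra ℂ A] [Algebra ℂ B] (h : A →ₐ[ℂ] B) (f g : Ser A) :
    mapSer h (f * g) = mapSer h f * mapSer h g := by
  obtain ⟨L, hf, hg⟩ := exists_bound f g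
  ext N
  rw [coeff_mapSer, coeff_mul_of_bound f g L hf hg N _ subset_rfl,
    coeff_mul_of_bound (mapSer h f) (mapSer h g) L
      (fun p hp => by rw [coeff_mapSer, hf p hp, map_zero])
      (fun p hp => by rw [coeff_mapSer, hg p hp, map_zero]) N _ subset_rfl, map_sum]
  simp only [coeff_mapSer, map_mul]

theorem mapSer_single [Algebra ℂ A] [Algebra ℂ B] (h : A →ₐ[ℂ] B) (p : ℤ) (a : A) :
    mapSer h (HahnSeries.single p a) = HahnSeries.single p (h a) := by
  ext N
  rw [coeff_mapSer, HahnSeries.coeff_single, HahnSeries.coeff_single]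
  split_ifs with hN
  · rfl
  · exact map_zero h

theorem mapSer_one [Algebra ℂ A] [Algebra ℂ B] (h : A →ₐ[ℂ] B) : mapSer h (1 : Ser A) = 1 := by
  rw [← HahnSeries.single_zero_one, mapSer_single, map_one, HahnSeries.single_zero_one]

theorem mapSer_shift [Algebra ℂ A] [Algebra ℂ B] (h : A →ₐ[ℂ] B) (c : ℤ) (f : Ser A) :
    mapSer h (shift c f) = shift c (mapSer h f) := by
  obtain ⟨L, hf, -⟩ := exists_bound f f
  ext N
  rw [coeff_mapSer, coeff_shift c f L N hf _ subset_rfl, coeff_shift c (mapSer h f) L N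
    (fun p hp => by rw [coeff_mapSer, hf p hp, map_zero]) _ subset_rfl, map_sum]
  simp only [coeff_mapSer, map_zsmul]

theorem mapSer_reflect [Algebra ℂ A] [Algebra ℂ B] (h : A →ₐ[ℂ] B) (f : Ser A) :
    mapSer h (reflect f) = reflect (mapSer h f) := by
  ext N
  simp only [coeff_mapSer, coeff_reflect, map_zsmul]

theorem mapSer_comp {C : Type*} [Ring C] [Algebra ℂ A] [Algebra ℂ B] [Algebra ℂ C]
    (g : B →ₐ[ℂ] C) (h : A →ₐ[ℂ] B) (f : Ser A) :
    mapSer (g.comp h) f = mapSer g (mapSer h f) := rfl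

/-- Reading the coefficients of a series in the opposite algebra. -/
def opSer [Algebra ℂ A] : Ser A ≃ₗ[ℂ] Ser Aᵐᵒᵖ where
  toFun f := HahnSeries.map f (MulOpposite.opAddEquiv : A ≃+ Aᵐᵒᵖ)
  invFun f := HahnSeries.map f (MulOpposite.opAddEquiv : A ≃+ Aᵐᵒᵖ).symm
  map_add' f g := by ext; simp
  map_smul' c f := by ext; simp
  left_inv f := by ext; simp
  right_inv f := by ext; simp

variable [Algebra ℂ A]

theorem coeff_opSer (f : Ser A) (N : ℤ) :
    (opSer f).coeff N = MulOpposite.op (f.coeff N) := rfl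

theorem opSer_mul (f g : Ser A) : opSer (f * g) = opSer g * opSer f := by
  obtain ⟨L, hf, hg⟩ := exists_bound f g
  ext N
  rw [coeff_opSer, coeff_mul_of_bound f g L hf hg N (Finset.Icc L (N - L)) subset_rfl,
    coeff_mul_of_bound (opSer g) (opSer f) L
      (fun p hp => by rw [coeff_opSer, hg p hp, MulOpposite.op_zero])
      (fun p hp => by rw [coeff_opSer, hf p hp, MulOpposite.op_zero]) N _ subset_rfl,
    Finset.op_sum]
  refine Finset.sum_nbij' (fun p => N - p) (fun p => N - p) ?_ ?_ ?_ ?_ ?_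
  · intro p hp
    rw [Finset.mem_Icc] at hp ⊢
    omega
  · intro p hp
    rw [Finset.mem_Icc] at hp ⊢
    omega
  · intro p _
    omega
  · intro p _
    omega
  · intro p _
    rw [coeff_opSer, coeff_opSer, MulOpposite.op_mul, sub_sub_cancel]

theorem opSer_single (p : ℤ) (a : A) :
    opSer (HahnSeries.single p a) = HahnSeries.single p (MulOpposite.op a) := by
  ext N
  rw [coeff_opSer, HahnSeries.coeff_single, HahnSeries.coeff_single]
  split_ifs <;> rfl

theorem opSer_one : opSer (1 : Ser A) = 1 := by
  rw [← HahnSeries.single_zero_one, opSer_single, MulOpposite.op_one, HahnSeries.single_zero_one]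

theorem opSer_shift (c : ℤ) (f : Ser A) : opSer (shift c f) = shift c (opSer f) := by
  obtain ⟨L, hf, -⟩ := exists_bound f f
  ext N
  rw [coeff_opSer, coeff_shift c f L N hf _ subset_rfl, coeff_shift c (opSer f) L N
    (fun p hp => by rw [coeff_opSer, hf p hp, MulOpposite.op_zero]) _ subset_rfl,
    Finset.op_sum]
  simp only [coeff_opSer, MulOpposite.op_smul]

end SeriesLemmas

/-! ### Inverses of u + c -/

section InverseVariable

variable {A : Type*} [Ring A]

theorem shift_C (c : ℤ) (a : A) : shift c (HahnSeries.C a : Ser A) = HahnSeries.C a := by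
  ext N
  rw [HahnSeries.C_apply, shift_single, HahnSeries.coeff_single]
  rcases lt_trichotomy N 0 with hN | rfl | hN
  · rw [shiftCoeff, if_neg (by omega), zero_smul, if_neg (by omega)]
  · simp [shiftCoeff]
  · obtain ⟨k, rfl⟩ := Int.eq_ofNat_of_zero_le hN.le
    obtain ⟨j, rfl⟩ := Nat.exists_eq_succ_of_ne_zero (n := k) (by omega)
    rw [if_neg (by omega), shiftCoeff, if_pos (by omega)]
    simp [Ring.choose_zero_succ]

/-- The inverse `(u + c)⁻¹`. -/
def invU (A : Type*) [Ring A] (c : ℤ) : Ser A := shift c (HahnSeries.single 1 1)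

theorem uVar_add_mul_invU (c : ℤ) : (uVar A + (c : Ser A)) * invU A c = 1 := by
  rw [← shift_uVar, invU, ← shift_mul, uVar, HahnSeries.single_mul_single]
  simp [shift_one]

end InverseVariable

/-! ### Manin matrices from 𝔤𝔩 relations, and telescoping of ordered products -/

section AbstractDeterminants

variable {R : Type*} [Ring R]

/-- The commutation relations of the matrix units of `𝔤𝔩_N`. -/
def IsGlFamily {ι A : Type*} [DecidableEq ι] [Ring A] (e : ι → ι → A) : Prop :=
  ∀ i j k l, e i j * e k l - e k l * e i j =
    (if k = j then e i l else 0) - if i = l then e k j else 0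

theorem IsManin.sub_central {ι κ : Type*} {M D : Matrix ι κ R} (hM : IsManin M)
    (hD : ∀ i j r, D i j * r = r * D i j) : IsManin (M - D) := by
  have h : ∀ i j k l, (M - D) i j * (M - D) k l - (M - D) k l * (M - D) i j =
      M i j * M k l - M k l * M i j := by
    intro i j k l
    simp only [Matrix.sub_apply, sub_mul, mul_sub]
    rw [hD i j (M k l), hD i j (D k l), hD k l (M i j)]
    abel
  intro i j k l
  rw [h, h, hM]

/-- Here w plays the role of u⁻¹τ⁻¹. Moving it past an entry of x + E subtracts 1 on the diagonal.
The resulting extra terms complete the 𝔤𝔩 commutator to an expression invariant under exchanging i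
and k, which is the Manin condition. -/
theorem IsGlFamily.isManin {ι : Type*} [DecidableEq ι] {E : ι → ι → R} (hE : IsGlFamily E)
    (x w : R) (hwx : w * x = (x - 1) * w) (hwE : ∀ i j, w * E i j = E i j * w)
    (hxE : ∀ i j, x * E i j = E i j * x) :
    IsManin (Matrix.of fun i j => ((if i = j then x else 0) + E i j) * w) := by
  set L : ι → ι → R := fun i j => (if i = j then x else 0) + E i j with hL
  let δ : ι → ι → R := fun i j => if i = j then 1 else 0
  have hwL : ∀ i j, w * L i j = (L i j - δ i j) * w := by
    intro i j
    simp only [hL, δ, mul_add, sub_mul, add_mul, hwE]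
    split_ifs
    · rw [hwx]
      noncomm_ring
    · simp
  have hLL : ∀ i j k l, L i j * L k l - L k l * L i j = E i j * E k l - E k l * E i j := by
    intro i j k l
    simp only [hL, mul_add, add_mul]
    split_ifs <;> simp only [hxE, zero_mul, mul_zero] <;> abel
  have hδ : ∀ i j k l, L k l * δ i j - L i j * δ k l =
      (if i = j then E k l else 0) - if k = l then E i j else 0 := by
    intro i j k l
    simp only [hL, δ]
    split_ifs <;> simp
  -- The bracket on the right is visibly unchanged when i and k are exchanged: its two differences
  -- swap places.
  have key : ∀ i j k l, L i j * w * (L k l * w) - L k l * w * (L i j * w) =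
      (((if k = j then E i l else 0) - if i = l then E k j else 0) +
        ((if i = j then E k l else 0) - if k = l then E i j else 0)) * (w * w) := by
    intro i j k l
    rw [← hE, ← hLL, ← hδ, mul_assoc, mul_assoc, ← mul_assoc w, ← mul_assoc w, hwL, hwL]
    noncomm_ring
  intro i j k l
  change L i j * w * (L k l * w) - L k l * w * (L i j * w) =
    L k j * w * (L i l * w) - L i l * w * (L k j * w)
  rw [key, key]
  congr 1
  abel

/-- Telescoping: a 0 passes through the factors in turn and becomes a 1, a 2, and so on. This moves
position-dependent shifts, signs and powers of z out of an ordered product while keeping its order.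
-/
theorem mul_prod_ofFn_of_intertwine {K : ℕ} (a : ℕ → R) (f h : Fin K → R)
    (H : ∀ j : Fin K, a j * f j = h j * a (j + 1)) :
    a 0 * (List.ofFn f).prod = (List.ofFn h).prod * a K := by
  induction K with
  | zero => simp
  | succ K ih =>
    rw [List.ofFn_succ', List.ofFn_succ', List.concat_eq_append, List.concat_eq_append,
      List.prod_append, List.prod_append, List.prod_singleton, List.prod_singleton, ← mul_assoc,
      ih (fun j => f j.castSucc) (fun j => h j.castSucc) fun j => H j.castSucc, mul_assoc,
      mul_assoc]
    congr 1
    exact H (Fin.last K)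

/-- The matrix `e_ij + δ_ij (x - j - [n ≤ j] z)`. -/
def dualMatrix {N : ℕ} (n : ℕ) (e : Fin N → Fin N → R) (x z : R) : Matrix (Fin N) (Fin N) R :=
  Matrix.of fun i j => e i j +
    if i = j then x - ((j : ℕ) : R) - (if n ≤ (j : ℕ) then z else 0) else 0

end AbstractDeterminants

/-! ### Quantum determinants and Bethe operators as column determinants with shifts -/

section ShiftOperators

variable (A : Type*) [Ring A] [Algebra ℂ A]

/-- The inverse shift operator `f(u) ↦ f(u - 1)`. -/
def sig : Module.End ℂ (Ser A) where
  toFun := shift (-1)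
  map_add' := shift_add (-1)
  map_smul' := shift_smul (-1)

variable {A}

/-- Left multiplication by a series. -/
abbrev lop {A : Type*} [Ring A] [Algebra ℂ A] : Ser A →ₐ[ℂ] Module.End ℂ (Ser A) :=
  Algebra.lmul ℂ (Ser A)

theorem sig_mul_lop (f : Ser A) : sig A * lop f = lop (shift (-1) f) * sig A := by
  ext1 g
  exact shift_mul (-1) f g

theorem tau_mul_sig : tau A * sig A = 1 := by
  ext1 g
  exact (shift_shift 1 (-1) g).trans (shift_zero_apply g)

theorem sig_mul_tau : sig A * tau A = 1 := by
  ext1 g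
  exact (shift_shift (-1) 1 g).trans (shift_zero_apply g)

theorem tau_pow_mul_sig_pow (k : ℕ) : tau A ^ k * sig A ^ k = 1 := by
  have hc : Commute (tau A) (sig A) := tau_mul_sig.trans sig_mul_tau.symm
  rw [← hc.mul_pow, tau_mul_sig, one_pow]

theorem sig_pow_mul_tau_pow (k : ℕ) : sig A ^ k * tau A ^ k = 1 := by
  have hc : Commute (sig A) (tau A) := sig_mul_tau.trans tau_mul_sig.symm
  rw [← hc.mul_pow, sig_mul_tau, one_pow]

theorem tau_pow_mul_lop (k : ℕ) (f : Ser A) :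
    tau A ^ k * lop f = lop (shift k f) * tau A ^ k := by
  induction k with
  | zero => simp [shift_zero_apply]
  | succ k ih =>
    rw [pow_succ', mul_assoc, ih, ← mul_assoc, tau_mul_lmul, shift_shift, mul_assoc, ← pow_succ',
      Nat.cast_succ, add_comm]

theorem sig_pow_mul_lop (k : ℕ) (f : Ser A) :
    sig A ^ k * lop f = lop (shift (-k) f) * sig A ^ k := by
  induction k with
  | zero => simp [shift_zero_apply]
  | succ k ih =>
    rw [pow_succ', mul_assoc, ih, ← mul_assoc, sig_mul_lop, shift_shift, mul_assoc, ← pow_succ',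
      Nat.cast_succ, neg_add, add_comm]

/-- The quantum determinant `∑ σ, sign σ * t_{σ 1, 1}(u) * ⋯ * t_{σ K, K}(u - K + 1)` of a matrix
of series. -/
def qColDet {K : ℕ} (T : Matrix (Fin K) (Fin K) (Ser A)) : Ser A :=
  ∑ p : Equiv.Perm (Fin K), (Equiv.Perm.sign p : ℤ) •
    (List.ofFn fun j : Fin K => shift (-(j : ℤ)) (T (p j) j)).prod

/-- The generating difference operator attached to a matrix of series. -/
def betheDet {K : ℕ} (T : Matrix (Fin K) (Fin K) (Ser A)) : Module.End ℂ (Ser A) :=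
  ∑ p : Equiv.Perm (Fin K), (Equiv.Perm.sign p : ℤ) •
    (List.ofFn fun j : Fin K => (if p j = j then tau A else 0) -
      lop (shift (-(j : ℤ)) (T (p j) j))).prod

/-- The shift by -j in column j is what is produced by the j copies of τ⁻¹ standing to its left.
Once they are absorbed into the entries, every column has the same form. -/
theorem lop_qColDet {K : ℕ} (T : Matrix (Fin K) (Fin K) (Ser A)) :
    lop (qColDet T) = colDet (Matrix.of fun i j => lop (T i j) * sig A) * tau A ^ K := by
  rw [qColDet, colDet, map_sum, Finset.sum_mul]
  refine Finset.sum_congr rfl fun p _ => ?_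
  rw [map_zsmul, smul_mul_assoc, map_list_prod, List.map_ofFn]
  congr 1
  have h := mul_prod_ofFn_of_intertwine (fun j => tau A ^ j)
    (fun j : Fin K => lop (shift (-(j : ℤ)) (T (p j) j)))
    (fun j : Fin K => lop (T (p j) j) * sig A) ?_
  · rw [pow_zero, one_mul] at h
    exact h
  · intro j
    rw [tau_pow_mul_lop, shift_shift, add_neg_cancel, shift_zero_apply, pow_succ', mul_assoc,
      ← mul_assoc (sig A), sig_mul_tau, one_mul]

/-- The same absorption as for the quantum determinant, with `(-1) ^ j * τ ^ j` as the intertwining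
element. Each column of τ - T contributes one sign when it is rewritten as -(Tτ⁻¹ - 1)τ. -/
theorem betheDet_eq {K : ℕ} (T : Matrix (Fin K) (Fin K) (Ser A)) :
    betheDet T = (-1 : ℤ) ^ K •
      (colDet ((Matrix.of fun i j => lop (T i j) * sig A) - 1) * tau A ^ K) := by
  rw [betheDet, colDet, Finset.sum_mul, Finset.smul_sum]
  refine Finset.sum_congr rfl fun p _ => ?_
  rw [smul_mul_assoc, smul_comm]
  congr 1
  have h := mul_prod_ofFn_of_intertwine (fun j => (-1 : ℤ) ^ j • tau A ^ j)
    (fun j : Fin K => (if p j = j then tau A else 0) - lop (shift (-(j : ℤ)) (T (p j) j)))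
    (fun j : Fin K => ((Matrix.of fun i j => lop (T i j) * sig A) - 1) (p j) j) ?_
  · rw [pow_zero, pow_zero, one_smul, one_mul, mul_smul_comm] at h
    exact h
  · intro j
    have h1 : tau A ^ (j : ℕ) * lop (shift (-(j : ℤ)) (T (p j) j)) =
        lop (T (p j) j) * sig A * tau A ^ ((j : ℕ) + 1) := by
      rw [tau_pow_mul_lop, shift_shift, add_neg_cancel, shift_zero_apply, pow_succ', mul_assoc,
        ← mul_assoc (sig A), sig_mul_tau, one_mul]
    rw [smul_mul_assoc, mul_sub, h1, pow_succ (-1 : ℤ), mul_neg_one, mul_smul_comm, neg_smul,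
      ← smul_neg]
    congr 1
    rw [Matrix.sub_apply, Matrix.of_apply, Matrix.one_apply, sub_mul, neg_sub]
    congr 1
    split_ifs
    · rw [one_mul, pow_succ]
    · simp

theorem tau_mul_lop_C (a : A) :
    tau A * lop (HahnSeries.C a) = lop (HahnSeries.C a) * tau A := by
  rw [tau_mul_lmul, shift_C]

theorem sig_mul_lop_C (a : A) :
    sig A * lop (HahnSeries.C a) = lop (HahnSeries.C a) * sig A := by
  rw [sig_mul_lop, shift_C]

/-- The product `(u + c) ⋯ (u + c + k - 1)` in terms of `((u + c) τ) ^ k`. -/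
theorem lop_mul_tau_pow (c : ℤ) (k : ℕ) :
    (lop (uVar A + (c : Ser A)) * tau A) ^ k =
      lop (Polynomial.aeval (uVar A + (c + k - 1 : ℤ)) (descPochhammer ℂ k)) * tau A ^ k := by
  induction k with
  | zero => rw [pow_zero, pow_zero, descPochhammer_zero, map_one, map_one, mul_one]
  | succ k ih =>
    rw [pow_succ, ih, mul_assoc, ← mul_assoc (tau A ^ k), tau_pow_mul_lop, shift_add, shift_uVar]
    have hc : shift (k : ℤ) (c : Ser A) = (c : Ser A) := shift_C (k : ℤ) (c : A)
    rw [hc, descPochhammer_succ_left, map_mul, Polynomial.aeval_X, Polynomial.aeval_comp, map_sub,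
      Polynomial.aeval_X, map_one]
    have h1 : uVar A + ((c + ((k + 1 : ℕ) : ℤ) - 1 : ℤ) : Ser A) - 1 =
        uVar A + ((c + k - 1 : ℤ) : Ser A) := by
      push_cast
      abel
    have h2 : uVar A + ((k : ℤ) : Ser A) + (c : Ser A) =
        uVar A + ((c + ((k + 1 : ℕ) : ℤ) - 1 : ℤ) : Ser A) := by
      push_cast
      abel
    rw [h1, h2]
    set v := uVar A + ((c + ((k + 1 : ℕ) : ℤ) - 1 : ℤ) : Ser A) with hv
    have h3 : uVar A + ((c + k - 1 : ℤ) : Ser A) = v - 1 := h1.symm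
    have hcomm : Polynomial.aeval (v - 1) (descPochhammer ℂ k) * v =
        v * Polynomial.aeval (v - 1) (descPochhammer ℂ k) := by
      have : Polynomial.aeval (v - 1) (descPochhammer ℂ k) =
          Polynomial.aeval v ((descPochhammer ℂ k).comp (Polynomial.X - 1)) := by
        rw [Polynomial.aeval_comp, map_sub, Polynomial.aeval_X, map_one]
      rw [this]
      have hX : v = Polynomial.aeval v (Polynomial.X : Polynomial ℂ) := by
        rw [Polynomial.aeval_X]
      nth_rewrite 2 [hX]
      nth_rewrite 3 [hX]
      rw [← map_mul, ← map_mul, mul_comm]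
    rw [h3, mul_assoc, ← pow_succ, ← mul_assoc, ← map_mul, hcomm]

end ShiftOperators

/-! ### The evaluation matrix, its Schur complement and the dual matrix -/

section EvaluationMatrix

theorem IsGlFamily.map {ι A B : Type*} [DecidableEq ι] [Ring A] [Ring B] {e : ι → ι → A}
    (he : IsGlFamily e) (f : A →+* B) : IsGlFamily fun i j => f (e i j) := by
  intro i j k l
  have h := congrArg f (he i j k l)
  rw [map_sub, map_sub, map_mul, map_mul] at h
  simp only [h]
  split_ifs <;> simp

variable {A : Type*} [Ring A]

/-- The matrix `1 + e u⁻¹`. -/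
def evMatrix {ι : Type*} [DecidableEq ι] (e : ι → ι → A) : Matrix ι ι (Ser A) :=
  Matrix.of fun i j => (if i = j then 1 else 0) + HahnSeries.single 1 (e i j)

theorem shift_evMatrix {ι : Type*} [DecidableEq ι] (e : ι → ι → A) (c : ℤ) (i j : ι) :
    shift c (evMatrix e i j) =
      ((if i = j then uVar A + (c : Ser A) else 0) + HahnSeries.C (e i j)) * invU A c := by
  have h1 : (HahnSeries.single 1 (e i j) : Ser A) =
      HahnSeries.C (e i j) * HahnSeries.single 1 1 := by
    rw [HahnSeries.C_apply, HahnSeries.single_mul_single, zero_add, mul_one]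
  rw [evMatrix, Matrix.of_apply, shift_add, h1, shift_mul, shift_C, add_mul, invU]
  congr 1
  split_ifs
  · rw [shift_one]
    exact (uVar_add_mul_invU c).symm
  · rw [shift_zero, zero_mul]

variable [Algebra ℂ A]

theorem lop_uVar_mul_lop (f : Ser A) : lop (uVar A) * lop f = lop f * lop (uVar A) := by
  rw [← map_mul, uVar_mul_comm, map_mul]

/-- Factor 1 + e u⁻¹ as (u + e)u⁻¹ and apply `IsGlFamily.isManin` with x = u and w = u⁻¹τ⁻¹. -/
theorem isManin_evMatrix {ι : Type*} [DecidableEq ι] {e : ι → ι → A} (he : IsGlFamily e) :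
    IsManin (Matrix.of fun i j => lop (evMatrix e i j) * sig A) := by
  have hE : IsGlFamily fun i j => lop (HahnSeries.C (e i j) : Ser A) :=
    he.map ((lop (A := A)).toRingHom.comp HahnSeries.C)
  have hinv : invU A 0 * uVar A = uVar A * invU A 0 := (uVar_mul_comm _).symm
  have h := hE.isManin (lop (uVar A)) (lop (invU A 0) * sig A) ?_ ?_ ?_
  · convert h using 1
    ext1 i j
    rw [Matrix.of_apply, Matrix.of_apply, ← mul_assoc]
    congr 1
    have h2 := shift_evMatrix e 0 i j
    rw [shift_zero_apply, Int.cast_zero, add_zero] at h2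
    rw [h2, map_mul, map_add]
    congr 2
    split_ifs <;> simp
  · rw [mul_assoc, sig_mul_lop, shift_uVar, ← mul_assoc, ← map_mul, Int.cast_neg, Int.cast_one,
      ← map_one (lop (A := A)), ← map_sub, ← mul_assoc, ← map_mul, mul_add, sub_mul, hinv,
      mul_neg_one, one_mul, sub_eq_add_neg]
  · intro i j
    have hc : invU A 0 * HahnSeries.C (e i j) = HahnSeries.C (e i j) * invU A 0 := by
      rw [invU, shift_zero_apply, HahnSeries.C_apply, HahnSeries.single_mul_single,
        HahnSeries.single_mul_single, one_mul, mul_one, add_comm]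
    rw [mul_assoc, sig_mul_lop_C, ← mul_assoc, ← mul_assoc, ← map_mul, ← map_mul, hc]
  · intro i j
    exact lop_uVar_mul_lop _

/-- The Schur complement of the upper left block is the inverse of the lower right block of the
inverse matrix. -/
theorem exists_schur_of_inverse {R : Type*} [Ring R] {n m : ℕ}
    {T W : Matrix (Fin (n + m)) (Fin (n + m)) R} {S : Matrix (Fin m) (Fin m) R}
    (hTW : T * W = 1)
    (hS : W.submatrix (Fin.natAdd n) (Fin.natAdd n) * S = 1) :
    ∃ X : Matrix (Fin n) (Fin m) R,
      (∀ i b, ∑ a, T (Fin.castAdd m i) (Fin.castAdd m a) * X a b =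
        T (Fin.castAdd m i) (Fin.natAdd n b)) ∧
      ∀ i b, S i b = T (Fin.natAdd n i) (Fin.natAdd n b) -
        ∑ a, T (Fin.natAdd n i) (Fin.castAdd m a) * X a b := by
  -- The last m columns of T⁻¹, normalised on the right by S so that their lower block is the
  -- identity. Multiplying by T gives zero in the upper rows and S in the lower ones. Thus X is
  -- minus the upper block of Y, and the upper left block of T need not be inverted.
  let Y : Matrix (Fin (n + m)) (Fin m) R := W.submatrix id (Fin.natAdd n) * S
  have hY : T * Y = (1 : Matrix (Fin (n + m)) (Fin (n + m)) R).submatrix id (Fin.natAdd n) * S := by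
    rw [← hTW, ← Matrix.mul_assoc]
    rfl
  have hY2 : ∀ a b, Y (Fin.natAdd n a) b = (1 : Matrix (Fin m) (Fin m) R) a b := by
    intro a b
    rw [← hS]
    rfl
  have key : ∀ i b, ∑ a, T i (Fin.castAdd m a) * Y (Fin.castAdd m a) b + T i (Fin.natAdd n b) =
      ∑ c, (1 : Matrix (Fin (n + m)) (Fin (n + m)) R) i (Fin.natAdd n c) * S c b := by
    intro i b
    have h := congrFun (congrFun hY i) b
    rw [Matrix.mul_apply, Fin.sum_univ_add, Matrix.mul_apply] at h
    simp only [hY2, Matrix.one_apply, mul_ite, mul_one, mul_zero, Finset.sum_ite_eq',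
      Finset.mem_univ, if_true] at h
    rw [h]
    simp [Matrix.one_apply]
  refine ⟨fun a b => -Y (Fin.castAdd m a) b, fun i b => ?_, fun i b => ?_⟩
  · have h := key (Fin.castAdd m i) b
    simp only [mul_neg, Finset.sum_neg_distrib]
    have h0 : ∑ c, (1 : Matrix (Fin (n + m)) (Fin (n + m)) R) (Fin.castAdd m i)
        (Fin.natAdd n c) * S c b = 0 := by
      refine Finset.sum_eq_zero fun c _ => ?_
      rw [Matrix.one_apply_ne, zero_mul]
      intro hc
      have := congrArg Fin.val hc
      simp only [Fin.val_castAdd, Fin.val_natAdd] at this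
      omega
    rw [h0] at h
    exact neg_eq_of_add_eq_zero_right h
  · have h := key (Fin.natAdd n i) b
    simp only [mul_neg, Finset.sum_neg_distrib, sub_neg_eq_add]
    have h0 : ∑ c, (1 : Matrix (Fin (n + m)) (Fin (n + m)) R) (Fin.natAdd n i)
        (Fin.natAdd n c) * S c b = S i b := by
      rw [Finset.sum_eq_single i]
      · rw [Matrix.one_apply_eq, one_mul]
      · intro c _ hc
        rw [Matrix.one_apply_ne, zero_mul]
        intro hic
        exact hc (Fin.natAdd_injective _ _ hic).symm
      · simp
    rw [h0] at h
    rw [← h, add_comm]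

/-- One factor of `z ^ N` is spent on each column: z w = 1 removes the denominator w, while the
constant 1 in the later diagonal entries keeps its z. The powers of z that remain to the left of the
column raise x, which accounts for the decreasing term -j in `dualMatrix`. -/
theorem smul_colDet_intertwine {N : ℕ} {R : Type*} [Ring R] (n : ℕ) {E : Fin N → Fin N → R}
    {x z w s t : R} (M : Matrix (Fin N) (Fin N) R)
    (hzx : z * x = (x + 1) * z) (hzE : ∀ i j, z * E i j = E i j * z) (hzw : z * w = 1)
    (hst : s * t = 1)
    (hM : ∀ i j, s * M i j = (((if i = j then x - (N : R) else 0) + E i j) * w -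
      if i = j ∧ n ≤ (j : ℕ) then 1 else 0) * s) :
    z ^ N * s * colDet M * t = colDet (dualMatrix n E x z) := by
  rw [colDet, colDet, Finset.mul_sum, Finset.sum_mul]
  refine Finset.sum_congr rfl fun p _ => ?_
  rw [mul_smul_comm, smul_mul_assoc]
  congr 1
  have hzk : ∀ k : ℕ, z ^ k * x = (x + (k : R)) * z ^ k := by
    intro k
    induction k with
    | zero => simp
    | succ k ih =>
      rw [pow_succ', mul_assoc, ih, ← mul_assoc, mul_add, hzx, ← (Nat.cast_commute k z).eq]
      push_cast
      noncomm_ring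
  have hzkE : ∀ (k : ℕ) i j, z ^ k * E i j = E i j * z ^ k := fun k i j =>
    ((show Commute z (E i j) from hzE i j).pow_left k).eq
  have h := mul_prod_ofFn_of_intertwine (fun j => z ^ (N - j) * s)
    (fun j : Fin N => M (p j) j) (fun j => dualMatrix n E x z (p j) j) ?_
  · rw [Nat.sub_zero, Nat.sub_self, pow_zero, one_mul] at h
    rw [h, mul_assoc, hst, mul_one]
  · intro j
    -- Before column j there are N - j = k + 1 copies of z. Passing them across x - N gives x - N +
    -- k + 1 = x - j, and w then cancels one of them.
    obtain ⟨k, hk⟩ : ∃ k, N - (j : ℕ) = k + 1 := ⟨N - j - 1, by omega⟩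
    have hk' : N - ((j : ℕ) + 1) = k := by omega
    have hN : (N : R) = (j : ℕ) + k + 1 := by
      have : N = (j : ℕ) + k + 1 := by omega
      exact_mod_cast congrArg (Nat.cast : ℕ → R) this
    rw [hk, hk', mul_assoc, hM, dualMatrix, Matrix.of_apply, ← mul_assoc, ← mul_assoc]
    congr 1
    have hzkw : z ^ (k + 1) * w = z ^ k := by rw [pow_succ, mul_assoc, hzw, mul_one]
    rw [mul_sub, ← mul_assoc, mul_add, hzkE, add_mul, mul_assoc (E _ _), hzkw, add_mul]
    by_cases hp : p j = j
    · rw [if_pos hp, if_pos hp, mul_sub, hzk, ← (Nat.cast_commute N (z ^ (k + 1))).eq, ← sub_mul,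
        mul_assoc, hzkw]
      have : x + ((k + 1 : ℕ) : R) - (N : R) = x - (j : ℕ) := by
        rw [hN]
        push_cast
        abel
      rw [this]
      by_cases hj : n ≤ (j : ℕ)
      · rw [if_pos ⟨hp, hj⟩, if_pos hj, mul_one, pow_succ']
        noncomm_ring
      · rw [if_neg (fun h => hj h.2), if_neg hj]
        noncomm_ring
    · rw [if_neg hp, if_neg hp, if_neg (fun h => hp h.1)]
      simp

/-- The generating difference operator of the Schur complement of `1 + e u⁻¹`, multiplied by the
complementary quantum determinant, is the column determinant of the dual matrix. -/
theorem falling_mul_qColDet_mul_betheDet {n m : ℕ} {e : Fin (n + m) → Fin (n + m) → A}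
    (he : IsGlFamily e) {W : Matrix (Fin (n + m)) (Fin (n + m)) (Ser A)}
    {S : Matrix (Fin m) (Fin m) (Ser A)} (hW : evMatrix e * W = 1)
    (hS : W.submatrix (Fin.natAdd n) (Fin.natAdd n) * S = 1) :
    lop (falling A n (n + m)) *
        (lop (shift n (qColDet ((evMatrix e).submatrix (Fin.castAdd m) (Fin.castAdd m)))) *
          betheDet S) =
      (-1 : ℤ) ^ m • colDet (dualMatrix n (fun i j => lop (HahnSeries.C (e i j)))
        (lop (uVar A) + (n : Module.End ℂ (Ser A)))
        (lop (uVar A + ((1 - m : ℤ) : Ser A)) * tau A)) := by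
  obtain ⟨X, hX, hSX⟩ := exists_schur_of_inverse hW hS
  set T := evMatrix e with hT
  -- Only the last m diagonal entries are lowered by 1. The first n columns then give the quantum
  -- determinant, and the Schur complement becomes Sτ⁻¹ - 1, as in `betheDet_eq`.
  set D : Matrix (Fin (n + m)) (Fin (n + m)) (Module.End ℂ (Ser A)) :=
    Matrix.of fun i j => if i = j ∧ n ≤ (j : ℕ) then 1 else 0 with hD
  set M : Matrix (Fin (n + m)) (Fin (n + m)) (Module.End ℂ (Ser A)) :=
    (Matrix.of fun i j => lop (T i j) * sig A) - D with hMdef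
  have hManin : IsManin M := by
    refine (isManin_evMatrix he).sub_central fun i j r => ?_
    simp only [hD, Matrix.of_apply]
    split_ifs <;> simp
  have hDl : ∀ i a, D i (Fin.castAdd m a) = 0 := by
    intro i a
    simp only [hD, Matrix.of_apply]
    rw [if_neg]
    rintro ⟨-, h⟩
    rw [Fin.val_castAdd] at h
    omega
  have hDur : ∀ i b, D (Fin.castAdd m i) (Fin.natAdd n b) = 0 := by
    intro i a
    simp only [hD, Matrix.of_apply]
    rw [if_neg]
    rintro ⟨h, -⟩
    have := congrArg Fin.val h
    simp only [Fin.val_castAdd, Fin.val_natAdd] at this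
    omega
  have hDlr : ∀ i b, D (Fin.natAdd n i) (Fin.natAdd n b) =
      (1 : Matrix (Fin m) (Fin m) (Module.End ℂ (Ser A))) i b := by
    intro i b
    simp only [hD, Matrix.of_apply, Matrix.one_apply]
    congr 1
    simp
  have hts : ∀ f g : Ser A, lop f * sig A * (tau A * lop g * sig A) = lop (f * g) * sig A := by
    intro f g
    rw [map_mul, mul_assoc, mul_assoc (tau A), ← mul_assoc (sig A), sig_mul_tau, one_mul,
      mul_assoc]
  have hdet := hManin.colDet_eq_mul (Matrix.of fun a b => tau A * lop (X a b) * sig A)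
    ((Matrix.of fun i j => lop (S i j) * sig A) - 1) ?_ ?_
  rotate_left
  · intro i b
    simp only [hMdef, Matrix.sub_apply, Matrix.of_apply, hDl, hDur, sub_zero, hts]
    rw [← Finset.sum_mul, ← map_sum, hX]
  · intro i b
    simp only [hMdef, Matrix.sub_apply, Matrix.of_apply, hDl, hDlr, sub_zero, hts]
    rw [← Finset.sum_mul, ← map_sum, hSX, map_sub, sub_mul]
    abel
  have hM11 : M.submatrix (Fin.castAdd m) (Fin.castAdd m) =
      Matrix.of fun i j => lop (T.submatrix (Fin.castAdd m) (Fin.castAdd m) i j) * sig A := by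
    ext1 i j
    simp only [hMdef, Matrix.submatrix_apply, Matrix.sub_apply, hDl, sub_zero, Matrix.of_apply]
  rw [hM11] at hdet
  set q := qColDet (T.submatrix (Fin.castAdd m) (Fin.castAdd m)) with hq
  set z := lop (uVar A + ((1 - m : ℤ) : Ser A)) * tau A with hz
  have hqn : lop (shift n q) = tau A ^ n *
      colDet (Matrix.of fun i j =>
        lop (T.submatrix (Fin.castAdd m) (Fin.castAdd m) i j) * sig A) := by
    have h1 := tau_pow_mul_lop n q
    rw [lop_qColDet] at h1
    have h2 := congrArg (· * sig A ^ n) h1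
    simp only [mul_assoc, tau_pow_mul_sig_pow, mul_one] at h2
    exact h2.symm
  -- The factors produced by z ^ (n + m) run from u + 1 - m up to u + n, which are exactly those of
  -- the falling factorial.
  have hzN : z ^ (n + m) = lop (falling A n (n + m)) * tau A ^ (n + m) := by
    rw [hz, lop_mul_tau_pow, falling]
    have : ((1 - (m : ℤ) + ((n + m : ℕ) : ℤ) - 1 : ℤ) : Ser A) = (n : Ser A) := by
      push_cast
      abel
    rw [this]
  have hzs : lop (falling A n (n + m)) * tau A ^ n = z ^ (n + m) * sig A ^ m := by
    rw [hzN, pow_add, mul_assoc, mul_assoc, tau_pow_mul_sig_pow, mul_one]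
  have hlhs : lop (falling A n (n + m)) * (lop (shift n q) * betheDet S) =
      (-1 : ℤ) ^ m • (z ^ (n + m) * sig A ^ m * colDet M * tau A ^ m) := by
    rw [hqn, betheDet_eq, hdet, ← hzs, mul_smul_comm, mul_smul_comm]
    simp only [mul_assoc]
  rw [hlhs]
  congr 1
  -- Conjugation by σ^m turns 1 + e u⁻¹ into (u - m + e)(u - m)⁻¹, and u - m is x - N for x = u + n
  -- and N = n + m. Together with the shift already in z, this gives z w = 1 for w = (u - m)⁻¹σ.
  refine smul_colDet_intertwine (w := lop (invU A (-m)) * sig A) n M ?_ ?_ ?_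
    (sig_pow_mul_tau_pow m) ?_
  · have hc : Commute (lop (uVar A) + ((1 - m : ℤ) : Module.End ℂ (Ser A)))
        (lop (uVar A) + 1 + (n : Module.End ℂ (Ser A))) :=
      (((Commute.refl _).add_right (Commute.one_right _)).add_right
        (Nat.cast_commute n _).symm).add_left (Int.cast_commute _ _)
    rw [hz, mul_assoc, mul_add, ← Nat.cast_comm, tau_mul_lmul, shift_uVar, Int.cast_one,
      ← add_mul, ← mul_assoc, ← mul_assoc, map_add, map_add, map_intCast, map_one, hc.eq]
    congr 2
    abel
  · intro i j
    have hc : (((1 - m : ℤ) : ℤ) : Ser A) * HahnSeries.C (e i j) =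
        HahnSeries.C (e i j) * ((1 - m : ℤ) : Ser A) := (Int.cast_commute _ _).eq
    rw [hz, mul_assoc, tau_mul_lop_C, ← mul_assoc, ← mul_assoc, ← map_mul, ← map_mul, add_mul,
      uVar_mul_comm, hc, mul_add]
  · rw [hz, mul_assoc, ← mul_assoc (tau A), tau_mul_lmul, invU, shift_shift, mul_assoc,
      tau_mul_sig, mul_one, ← map_mul]
    have := uVar_add_mul_invU (A := A) (1 - m : ℤ)
    rw [invU] at this
    rw [← sub_eq_add_neg, this, map_one]
  · intro i j
    rw [hMdef, Matrix.sub_apply, Matrix.of_apply, hD, Matrix.of_apply, mul_sub, sub_mul]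
    congr 1
    · rw [← mul_assoc, sig_pow_mul_lop, hT, shift_evMatrix, map_mul, map_add, mul_assoc,
        mul_assoc, mul_assoc, mul_assoc, ← pow_succ, ← pow_succ']
      congr 2
      split_ifs
      · push_cast
        rw [map_add, map_neg, map_natCast]
        abel
      · rw [map_zero]
    · split_ifs <;> simp

end EvaluationMatrix

/-! ### Homomorphisms and anti-homomorphisms acting on determinants and difference operators -/

section Homomorphisms

theorem colDet_map {R R' : Type*} [Ring R] [Ring R'] (f : R →+* R') {K : ℕ}
    (M : Matrix (Fin K) (Fin K) R) : f (colDet M) = colDet (M.map f) := by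
  rw [colDet, colDet, map_sum]
  refine Finset.sum_congr rfl fun p _ => ?_
  rw [map_zsmul, map_list_prod, List.map_ofFn]
  rfl

/-- An anti-homomorphism takes a column determinant to the column determinant of the matrix with
reversed rows and columns. -/
theorem unop_map_colDet {R R' : Type*} [Ring R] [Ring R'] (f : R →+* R'ᵐᵒᵖ) {K : ℕ}
    (M : Matrix (Fin K) (Fin K) R) : (f (colDet M)).unop =
      colDet (Matrix.of fun i j => (f (M i.rev j.rev)).unop) := by
  rw [colDet_map, colDet, colDet, Finset.unop_sum]
  -- Reversing the order of the factors is compensated by reversing the column index. Conjugating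
  -- the permutation by the reversal does the same to the rows without changing the sign.
  refine Fintype.sum_equiv (Fin.revPerm.permCongr) _ _ fun p => ?_
  rw [Equiv.Perm.sign_permCongr, MulOpposite.unop_smul, MulOpposite.unop_list_prod, List.map_ofFn]
  congr 2
  apply List.ext_getElem
  · simp
  · intro i h1 h2
    simp only [List.getElem_reverse, List.getElem_ofFn, Function.comp_apply, List.length_ofFn,
      Matrix.map_apply, Matrix.of_apply, Equiv.permCongr_apply, Fin.revPerm_symm,
      Fin.revPerm_apply, Fin.rev_rev]
    have : (⟨K - 1 - i, by simp at h2; omega⟩ : Fin K) = Fin.rev ⟨i, by simpa using h2⟩ := by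
      ext
      simp [Fin.val_rev]
      omega
    rw [this]

theorem qColDet_eq_colDet {A : Type*} [Ring A] {K : ℕ} (T : Matrix (Fin K) (Fin K) (Ser A)) :
    qColDet T = colDet (Matrix.of fun i j : Fin K => shift (-(j : ℤ)) (T i j)) := rfl

variable {A B : Type*} [Ring A] [Algebra ℂ A] [Ring B] [Algebra ℂ B]

theorem betheDet_eq_colDet {K : ℕ} (T : Matrix (Fin K) (Fin K) (Ser A)) :
    betheDet T = colDet (Matrix.of fun i j : Fin K => (if i = j then tau A else 0) -
      lop (shift (-(j : ℤ)) (T i j))) := rfl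

/-- The extension of a homomorphism to series, as a homomorphism. -/
def mapSerHom (h : A →ₐ[ℂ] B) : Ser A →ₐ[ℂ] Ser B :=
  AlgHom.ofLinearMap (mapSer h) (mapSer_one h) (mapSer_mul h)

/-- Reading the coefficients in the opposite algebra, as an anti-homomorphism. -/
def opSerHom : Ser A →+* (Ser Aᵐᵒᵖ)ᵐᵒᵖ where
  toFun f := MulOpposite.op (opSer f)
  map_zero' := by rw [map_zero, MulOpposite.op_zero]
  map_one' := by rw [opSer_one, MulOpposite.op_one]
  map_add' f g := by rw [map_add, MulOpposite.op_add]
  map_mul' f g := by rw [opSer_mul, MulOpposite.op_mul]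

theorem mapSer_qColDet (h : A →ₐ[ℂ] B) {K : ℕ} (T : Matrix (Fin K) (Fin K) (Ser A)) :
    mapSer h (qColDet T) = qColDet (T.map (mapSer h)) := by
  rw [qColDet_eq_colDet, qColDet_eq_colDet]
  refine (colDet_map (mapSerHom h).toRingHom _).trans ?_
  congr 1
  ext1 i j
  exact mapSer_shift h _ _

theorem mapSer_algebraMap_comm (f : Ser ℂ) (g : Ser A) :
    mapSer (Algebra.ofId ℂ A) f * g = g * mapSer (Algebra.ofId ℂ A) f := by
  obtain ⟨L, hf, -⟩ := exists_bound f f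
  obtain ⟨L', hg, -⟩ := exists_bound g g
  have hf' : ∀ p, p < min L L' → (mapSer (Algebra.ofId ℂ A) f).coeff p = 0 := fun p hp => by
    rw [coeff_mapSer, hf p (by omega), map_zero]
  have hg' : ∀ p, p < min L L' → g.coeff p = 0 := fun p hp => hg p (by omega)
  ext N
  rw [coeff_mul_of_bound _ _ _ hf' hg' N (Finset.Icc (min L L') (N - min L L')) subset_rfl,
    coeff_mul_of_bound _ _ _ hg' hf' N (Finset.Icc (min L L') (N - min L L')) subset_rfl]
  refine Finset.sum_nbij' (fun p => N - p) (fun p => N - p) ?_ ?_ ?_ ?_ ?_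
  · intro p hp
    rw [Finset.mem_Icc] at hp ⊢
    omega
  · intro p hp
    rw [Finset.mem_Icc] at hp ⊢
    omega
  · intro p _
    omega
  · intro p _
    omega
  · intro p _
    rw [sub_sub_cancel, coeff_mapSer]
    exact Algebra.commutes _ _

theorem mapSer_aeval (h : A →ₐ[ℂ] B) (f : Ser A) (p : Polynomial ℂ) :
    mapSer h (Polynomial.aeval f p) = Polynomial.aeval (mapSer h f) p :=
  (Polynomial.aeval_algHom_apply (mapSerHom h) f p).symm

theorem mapSer_uVar (h : A →ₐ[ℂ] B) : mapSer h (uVar A) = uVar B := by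
  rw [uVar, mapSer_single, map_one, uVar]

theorem mapSer_natCast (h : A →ₐ[ℂ] B) (c : ℕ) : mapSer h (c : Ser A) = (c : Ser B) :=
  map_natCast (mapSerHom h) c

theorem falling_eq_mapSer (c k : ℕ) :
    falling A c k = mapSer (Algebra.ofId ℂ A) (falling ℂ c k) := by
  rw [falling, falling, mapSer_aeval, map_add, mapSer_uVar, mapSer_natCast]

theorem opSer_mapSer_ofId (f : Ser ℂ) :
    opSer (mapSer (Algebra.ofId ℂ A) f) = mapSer (Algebra.ofId ℂ Aᵐᵒᵖ) f := rfl

theorem coeffOp_add (f g : Ser A) : coeffOp (f + g) = coeffOp f + coeffOp g :=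
  Subtype.ext (map_add (lop (A := A)) f g)

theorem coeffOp_mul (f g : Ser A) : coeffOp (f * g) = coeffOp f * coeffOp g :=
  Subtype.ext (map_mul (lop (A := A)) f g)

theorem coeffOp_zero : coeffOp (0 : Ser A) = 0 := Subtype.ext (map_zero (lop (A := A)))

theorem coeffOp_one : coeffOp (1 : Ser A) = 1 := Subtype.ext (map_one (lop (A := A)))

theorem tauOp_pow_mul_coeffOp (k : ℕ) (f : Ser A) :
    tauOp A ^ k * coeffOp f = coeffOp (shift k f) * tauOp A ^ k :=
  Subtype.ext (tau_pow_mul_lop k f)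

/-- Induction on difference operators. -/
theorem diffOp_induction {P : DiffOp A → Prop}
    (monomial : ∀ f i, P (coeffOp f * tauOp A ^ i)) (add : ∀ S T, P S → P T → P (S + T))
    (T : DiffOp A) : P T := by
  obtain ⟨b, rfl⟩ := (coeffEquiv A).surjective T
  induction b using Finsupp.induction_linear with
  | zero =>
    have h := monomial 0 0
    rw [coeffOp_zero, zero_mul] at h
    rwa [map_zero]
  | add a b ha hb =>
    rw [map_add]
    exact add _ _ ha hb
  | single i f =>
    rw [coeffEquiv_single]
    exact monomial f i

theorem monomial_mul_monomial (f g : Ser A) (i j : ℕ) :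
    coeffOp f * tauOp A ^ i * (coeffOp g * tauOp A ^ j) =
      coeffOp (f * shift i g) * tauOp A ^ (i + j) := by
  rw [mul_assoc, ← mul_assoc (tauOp A ^ i), tauOp_pow_mul_coeffOp, coeffOp_mul, pow_add]
  simp only [mul_assoc]

theorem mapOp_mul (h : A →ₐ[ℂ] B) (S T : DiffOp A) :
    mapOp h (S * T) = mapOp h S * mapOp h T := by
  induction S using diffOp_induction with
  | add S S' hS hS' => rw [add_mul, map_add, map_add, add_mul, hS, hS']
  | monomial f i =>
    induction T using diffOp_induction with
    | add T T' hT hT' => rw [mul_add, map_add, map_add, mul_add, hT, hT']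
    | monomial g j =>
      rw [monomial_mul_monomial, mapOp_coeffOp_mul, mapOp_coeffOp_mul, mapOp_coeffOp_mul,
        monomial_mul_monomial, mapSer_mul, mapSer_shift]

theorem mapOp_coeffOp (h : A →ₐ[ℂ] B) (f : Ser A) :
    mapOp h (coeffOp f) = coeffOp (mapSer h f) := by
  have := mapOp_coeffOp_mul h f 0
  rwa [pow_zero, mul_one, pow_zero, mul_one] at this

theorem mapOp_one (h : A →ₐ[ℂ] B) : mapOp h 1 = 1 := by
  rw [← coeffOp_one, mapOp_coeffOp, mapSer_one, coeffOp_one]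

theorem mapOp_tauOp (h : A →ₐ[ℂ] B) : mapOp h (tauOp A) = tauOp B := by
  have := mapOp_coeffOp_mul h 1 1
  rwa [pow_one, pow_one, mapSer_one, coeffOp_one, one_mul, coeffOp_one, one_mul] at this

/-- The extension of a homomorphism to difference operators, as a homomorphism. -/
def mapOpHom (h : A →ₐ[ℂ] B) : DiffOp A →ₐ[ℂ] DiffOp B :=
  AlgHom.ofLinearMap (mapOp h) (mapOp_one h) (mapOp_mul h)

theorem mapOp_comp {C : Type*} [Ring C] [Algebra ℂ C] (g : B →ₐ[ℂ] C) (h : A →ₐ[ℂ] B)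
    (T : DiffOp A) : mapOp (g.comp h) T = mapOp g (mapOp h T) := by
  induction T using diffOp_induction with
  | add S T hS hT => rw [map_add, map_add, map_add, hS, hT]
  | monomial f i =>
    rw [mapOp_coeffOp_mul, mapOp_coeffOp_mul, mapOp_coeffOp_mul, mapSer_comp]

/-- Reading the coefficients of a difference operator in the opposite algebra. -/
def opOp : DiffOp A ≃ₗ[ℂ] DiffOp Aᵐᵒᵖ :=
  (coeffEquiv A).symm ≪≫ₗ (Finsupp.mapRange.linearEquiv opSer ≪≫ₗ coeffEquiv Aᵐᵒᵖ)

theorem opOp_coeffOp_mul (f : Ser A) (i : ℕ) :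
    opOp (coeffOp f * tauOp A ^ i) = coeffOp (opSer f) * tauOp Aᵐᵒᵖ ^ i := by
  rw [← coeffEquiv_single, ← coeffEquiv_single]
  simp [opOp]

theorem deltaHat_add (l : ℤ) (S T : DiffOp A) :
    deltaHat l (S + T) = deltaHat l S + deltaHat l T := by
  rw [deltaHat, map_add, Finsupp.sum_add_index']
  · rfl
  · intro i
    rw [reflect_zero, shift_zero, coeffOp_zero, mul_zero]
  · intro i f g
    rw [reflect_add, shift_add, coeffOp_add, mul_add]

/-- The anti-homomorphism of series underlying `δ̂`. -/
def deltaSer (h : A →ₐ[ℂ] B) (l : ℤ) (f : Ser A) : Ser Bᵐᵒᵖ :=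
  opSer (mapSer h (shift (1 - l) (reflect f)))

theorem opOp_mapOp_deltaHat_monomial (h : A →ₐ[ℂ] B) (l : ℤ) (f : Ser A) (i : ℕ) :
    opOp (mapOp h (deltaHat l (coeffOp f * tauOp A ^ i))) =
      tauOp Bᵐᵒᵖ ^ i * coeffOp (deltaSer h l f) := by
  rw [deltaHat_coeffOp_mul, tauOp_pow_mul_coeffOp, mapOp_coeffOp_mul, opOp_coeffOp_mul,
    tauOp_pow_mul_coeffOp, deltaSer, mapSer_shift, opSer_shift]

theorem opOp_mapOp_deltaHat_add (h : A →ₐ[ℂ] B) (l : ℤ) (S T : DiffOp A) :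
    opOp (mapOp h (deltaHat l (S + T))) =
      opOp (mapOp h (deltaHat l S)) + opOp (mapOp h (deltaHat l T)) := by
  rw [deltaHat_add, map_add, map_add]

/-- `opOp` keeps τ in its place and is not multiplicative, but its composite with δ̂ reverses
products. The reflection turns the shift by i in f g(u + i) τ^(i+j) into a shift by -i, which is
exactly what is needed to move τ^i to the left of the image of g. -/
theorem opOp_mapOp_deltaHat_mul (h : A →ₐ[ℂ] B) (l : ℤ) (S T : DiffOp A) :
    opOp (mapOp h (deltaHat l (S * T))) =
      opOp (mapOp h (deltaHat l T)) * opOp (mapOp h (deltaHat l S)) := by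
  induction S using diffOp_induction with
  | add S S' hS hS' =>
    rw [add_mul, opOp_mapOp_deltaHat_add, opOp_mapOp_deltaHat_add, mul_add, hS, hS']
  | monomial f i =>
    induction T using diffOp_induction with
    | add T T' hT hT' =>
      rw [mul_add, opOp_mapOp_deltaHat_add, opOp_mapOp_deltaHat_add, add_mul, hT, hT']
    | monomial g j =>
      have h2 : deltaSer h l (f * shift i g) = shift (-i) (deltaSer h l g) * deltaSer h l f := by
        simp only [deltaSer, reflect_mul, shift_mul, mapSer_mul, opSer_mul, reflect_shift,
          mapSer_shift, opSer_shift, shift_shift]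
        rw [add_comm]
      have h3 : coeffOp (deltaSer h l g) * tauOp Bᵐᵒᵖ ^ i =
          tauOp Bᵐᵒᵖ ^ i * coeffOp (shift (-i) (deltaSer h l g)) := by
        rw [tauOp_pow_mul_coeffOp, shift_shift, add_neg_cancel, shift_zero_apply]
      rw [monomial_mul_monomial, add_comm i, opOp_mapOp_deltaHat_monomial, opOp_mapOp_deltaHat_monomial,
        opOp_mapOp_deltaHat_monomial, h2, mul_assoc, ← mul_assoc (coeffOp _), h3, coeffOp_mul,
        pow_add]
      simp only [mul_assoc]

/-- The composition of `δ̂` with a homomorphism, as an anti-homomorphism to difference operators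
over the opposite algebra. -/
def deltaOpHom (h : A →ₐ[ℂ] B) (l : ℤ) : DiffOp A →+* (DiffOp Bᵐᵒᵖ)ᵐᵒᵖ where
  toFun T := MulOpposite.op (opOp (mapOp h (deltaHat l T)))
  map_zero' := by
    have := opOp_mapOp_deltaHat_add h l 0 0
    rw [add_zero] at this
    rw [left_eq_add.mp this, MulOpposite.op_zero]
  map_one' := by
    have := opOp_mapOp_deltaHat_monomial h l 1 0
    rw [coeffOp_one, pow_zero, pow_zero, one_mul, one_mul] at this
    rw [this, deltaSer, reflect_one, shift_one, mapSer_one, opSer_one, coeffOp_one,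
      MulOpposite.op_one]
  map_add' S T := by rw [opOp_mapOp_deltaHat_add, MulOpposite.op_add]
  map_mul' S T := by rw [opOp_mapOp_deltaHat_mul, MulOpposite.op_mul]

/-- The opposite product reverses the order of coefficients. So multiplication by a series on the
left survives `opOp` only when that series commutes with the coefficients of the operator. -/
theorem opOp_coeffOp_mul_mapOp {C : Type*} [Ring C] [Algebra ℂ C] (h : A →ₐ[ℂ] B)
    (g : C →ₐ[ℂ] B) (hcomm : ∀ a c, g c * h a = h a * g c) (f : Ser C) (T : DiffOp A) :
    opOp (coeffOp (mapSer g f) * mapOp h T) =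
      coeffOp (opSer (mapSer g f)) * opOp (mapOp h T) := by
  have hser : ∀ b : Ser A, mapSer g f * mapSer h b = mapSer h b * mapSer g f := by
    intro b
    obtain ⟨L, hf, hb⟩ := exists_bound (mapSer g f) (mapSer h b)
    ext N
    rw [coeff_mul_of_bound _ _ L hf hb N (Finset.Icc L (N - L)) subset_rfl,
      coeff_mul_of_bound _ _ L hb hf N (Finset.Icc L (N - L)) subset_rfl]
    refine Finset.sum_nbij' (fun p => N - p) (fun p => N - p) ?_ ?_ ?_ ?_ ?_
    · intro p hp
      rw [Finset.mem_Icc] at hp ⊢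
      omega
    · intro p hp
      rw [Finset.mem_Icc] at hp ⊢
      omega
    · intro p _
      omega
    · intro p _
      omega
    · intro p _
      rw [sub_sub_cancel, coeff_mapSer, coeff_mapSer, hcomm]
  induction T using diffOp_induction with
  | add S T hS hT => rw [map_add, mul_add, map_add, map_add, mul_add, hS, hT]
  | monomial b i =>
    rw [mapOp_coeffOp_mul, ← mul_assoc, ← coeffOp_mul, opOp_coeffOp_mul, opOp_coeffOp_mul, hser,
      opSer_mul, coeffOp_mul, mul_assoc]

/-- The generating difference operator of a matrix of series, in the algebra of difference
operators. -/
def betheMatrix {K : ℕ} (T : Matrix (Fin K) (Fin K) (Ser A)) :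
    Matrix (Fin K) (Fin K) (DiffOp A) :=
  Matrix.of fun i j => (if i = j then tauOp A else 0) - coeffOp (shift (-(j : ℤ)) (T i j))

theorem val_colDet_betheMatrix {K : ℕ} (T : Matrix (Fin K) (Fin K) (Ser A)) :
    ((colDet (betheMatrix T) : DiffOp A) : Module.End ℂ (Ser A)) = betheDet T := by
  rw [betheDet_eq_colDet]
  refine (colDet_map (R := DiffOp A) (R' := Module.End ℂ (Ser A)) (DiffOp A).val.toRingHom _).trans ?_
  congr 1
  ext1 i j
  simp only [betheMatrix, Matrix.map_apply, Matrix.of_apply]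
  split_ifs <;> rfl

theorem mapOp_colDet_betheMatrix (h : A →ₐ[ℂ] B) {K : ℕ} (T : Matrix (Fin K) (Fin K) (Ser A)) :
    mapOp h (colDet (betheMatrix T)) = colDet (betheMatrix (T.map (mapSer h))) := by
  refine (colDet_map (R := DiffOp A) (R' := DiffOp B) (mapOpHom h).toRingHom _).trans ?_
  congr 1
  ext1 i j
  refine (map_sub (mapOp h) (if i = j then tauOp A else 0)
    (coeffOp (shift (-(j : ℤ)) (T i j)))).trans ?_
  rw [mapOp_coeffOp, mapSer_shift, apply_ite (mapOp h), mapOp_tauOp, map_zero]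
  rfl

/-- The choice l = K in δ̂ is what restores the form of a Bethe operator. After reversal, column j
has the shift (1 - K) + (K - 1 - j) = -j. -/
theorem deltaOpHom_colDet_betheMatrix (h : A →ₐ[ℂ] B) {K : ℕ}
    (T : Matrix (Fin K) (Fin K) (Ser A)) :
    opOp (mapOp h (deltaHat K (colDet (betheMatrix T)))) =
      colDet (betheMatrix (Matrix.of fun i j => opSer (reflect (mapSer h (T i.rev j.rev))))) := by
  refine (unop_map_colDet (R := DiffOp A) (R' := DiffOp Bᵐᵒᵖ) (deltaOpHom h K) _).trans ?_
  congr 1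
  ext1 i j
  refine (congrArg MulOpposite.unop (map_sub (deltaOpHom h K)
    (if i.rev = j.rev then tauOp A else 0)
    (coeffOp (shift (-(j.rev : ℤ)) (T i.rev j.rev))))).trans ?_
  refine congrArg₂ (· - ·) ?_ ?_
  · split_ifs with h1 h2 h2
    · have := opOp_mapOp_deltaHat_monomial h K 1 1
      rw [coeffOp_one, pow_one, pow_one, one_mul, deltaSer, reflect_one, shift_one, mapSer_one,
        opSer_one, coeffOp_one, mul_one] at this
      exact this
    · exact absurd (Fin.rev_injective h1) h2
    · exact absurd (congrArg Fin.rev h2) h1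
    · rw [map_zero, MulOpposite.unop_zero]
  · have := opOp_mapOp_deltaHat_monomial h K (shift (-((j.rev : Fin K) : ℤ)) (T i.rev j.rev)) 0
    rw [pow_zero, pow_zero, one_mul, mul_one] at this
    refine this.trans ?_
    rw [deltaSer, reflect_shift, shift_shift, mapSer_shift, opSer_shift, mapSer_reflect]
    congr 2
    rw [Fin.val_rev]
    omega

/-- The analogue for the quantum determinant explains the argument -u - 1. Reversal gives column j
the shift 1 + (K - 1 - j) = K - j, that is, the usual -j after a global shift by K. -/
theorem opSer_qColDet {K : ℕ} (T : Matrix (Fin K) (Fin K) (Ser A)) :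
    opSer (shift 1 (reflect (qColDet T))) =
      shift K (qColDet (Matrix.of fun i j => opSer (reflect (T i.rev j.rev)))) := by
  let reflectHom : Ser A →+* Ser A :=
    { toFun := reflect
      map_zero' := reflect_zero
      map_one' := reflect_one
      map_add' := reflect_add
      map_mul' := reflect_mul }
  let shiftHom : ∀ (C : Type _) [Ring C], ℤ → (Ser C →+* Ser C) := fun C _ c =>
    { toFun := shift c
      map_zero' := shift_zero c
      map_one' := shift_one c
      map_add' := shift_add c
      map_mul' := shift_mul c }
  have h1 := unop_map_colDet ((opSerHom.comp (shiftHom A 1)).comp reflectHom)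
    (Matrix.of fun i j : Fin K => shift (-(j : ℤ)) (T i j))
  have h2 := colDet_map (shiftHom Aᵐᵒᵖ K) (Matrix.of fun i j : Fin K => shift (-(j : ℤ))
    ((Matrix.of fun i j : Fin K => opSer (reflect (T i.rev j.rev))) i j))
  rw [qColDet_eq_colDet, qColDet_eq_colDet]
  refine h1.trans (Eq.trans ?_ h2.symm)
  congr 1
  ext1 i j
  change opSer (shift 1 (reflect (shift _ _))) =
    shift (K : ℤ) (shift (-(j : ℤ)) (opSer (reflect (T i.rev j.rev))))
  rw [reflect_shift, shift_shift, shift_shift, opSer_shift]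
  congr 1
  rw [Fin.val_rev]
  omega

end Homomorphisms

/-! ### Images of the generating matrix and the determinant form of D̄_m -/

section YangianImages

open PowerSeries in
theorem coeff_ofPowerSeries {B : Type*} [Ring B] (f : PowerSeries B) (N : ℤ) :
    (HahnSeries.ofPowerSeries ℤ B f).coeff N = if 0 ≤ N then coeff N.toNat f else 0 := by
  split_ifs with h
  · obtain ⟨k, rfl⟩ := Int.eq_ofNat_of_zero_le h
    exact HahnSeries.ofPowerSeries_apply_coeff f k
  · rw [HahnSeries.ofPowerSeries_apply]
    refine HahnSeries.embDomain_of_notMem_range ?_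
    rintro ⟨k, hk⟩
    apply h
    rw [← hk]
    exact Int.natCast_nonneg k

theorem reflect_ofPowerSeries {B : Type*} [Ring B] (a : ℕ → B) :
    HahnSeries.ofPowerSeries ℤ B (PowerSeries.mk fun r => (-1 : ℤ) ^ r • a r) =
      reflect (HahnSeries.ofPowerSeries ℤ B (PowerSeries.mk a)) := by
  ext N
  rw [coeff_reflect, coeff_ofPowerSeries, coeff_ofPowerSeries]
  split_ifs with h
  · obtain ⟨k, rfl⟩ := Int.eq_ofNat_of_zero_le h
    rw [Int.toNat_natCast, PowerSeries.coeff_mk, PowerSeries.coeff_mk, Int.negOnePow_def,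
      zpow_natCast, Units.val_pow_eq_pow_val, Units.val_neg, Units.val_one]
  · rw [smul_zero]

theorem mapSer_ofPowerSeries {B C : Type*} [Ring B] [Algebra ℂ B] [Ring C] [Algebra ℂ C]
    (h : B →ₐ[ℂ] C) (a : ℕ → B) :
    mapSer h (HahnSeries.ofPowerSeries ℤ B (PowerSeries.mk a)) =
      HahnSeries.ofPowerSeries ℤ C (PowerSeries.mk fun r => h (a r)) := by
  ext N
  rw [coeff_mapSer, coeff_ofPowerSeries, coeff_ofPowerSeries]
  split_ifs
  · rw [PowerSeries.coeff_mk, PowerSeries.coeff_mk]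
  · rw [map_zero]

/-- The generating matrix `T(u)` of the Yangian. -/
def genMatrix (N : ℕ) : Matrix (Fin N) (Fin N) (Ser (Yangian N)) := Matrix.of (genSer N)

/-- The inverse matrix `T(u)⁻¹`. -/
def genInverse (N : ℕ) : Matrix (Fin N) (Fin N) (Ser (Yangian N)) :=
  Matrix.of fun i j => HahnSeries.ofPowerSeries ℤ _ (PowerSeries.mk (invFamily (gen N) i j))

theorem genMatrix_mul_genInverse (N : ℕ) :
    genMatrix N * genInverse N = 1 ∧ genInverse N * genMatrix N = 1 := by
  obtain ⟨h1, h2⟩ := matSeries_mul_inv (isYangianFamily_gen N)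
  have e1 := congrArg (HahnSeries.ofPowerSeries ℤ (Yangian N)).mapMatrix (entries_mul _ _ h1)
  have e2 := congrArg (HahnSeries.ofPowerSeries ℤ (Yangian N)).mapMatrix (entries_mul _ _ h2)
  rw [map_mul, map_one] at e1 e2
  exact ⟨e1, e2⟩

theorem mapSer_omega (N : ℕ) (i j : Fin N) :
    mapSer (omega N) (genMatrix N i j) = reflect (genInverse N i j) := by
  rw [genMatrix, Matrix.of_apply, genSer]
  refine (mapSer_ofPowerSeries _ _).trans ?_
  rw [genInverse, Matrix.of_apply, ← reflect_ofPowerSeries]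
  simp only [omega, Yangian.lift_gen]

theorem mapSer_delta (N : ℕ) (i j : Fin N) :
    mapSer (delta N) (genMatrix N i j) = reflect (genMatrix N j.rev i.rev) := by
  rw [genMatrix, Matrix.of_apply, genSer]
  refine (mapSer_ofPowerSeries _ _).trans ?_
  rw [Matrix.of_apply, genSer, ← reflect_ofPowerSeries]
  simp only [delta, Yangian.lift_gen]

theorem mapSer_embed {k N : ℕ} (f : Fin k ↪ Fin N) (i j : Fin k) :
    mapSer (embed f) (genMatrix k i j) = genMatrix N (f i) (f j) := by
  rw [genMatrix, Matrix.of_apply, genSer]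
  refine (mapSer_ofPowerSeries _ _).trans ?_
  rw [genMatrix, Matrix.of_apply, genSer]
  simp only [embed, Yangian.lift_gen]

theorem mapSer_ev (N : ℕ) (i j : Fin N) :
    mapSer (ev N) (genMatrix N i j) = evMatrix (eGen N) i j := by
  rw [genMatrix, Matrix.of_apply, genSer]
  refine (mapSer_ofPowerSeries _ _).trans ?_
  simp only [ev, Yangian.lift_gen]
  ext M
  rw [coeff_ofPowerSeries, evMatrix, Matrix.of_apply, HahnSeries.coeff_add, HahnSeries.coeff_single]
  have h1 : (if i = j then (1 : Ser (Ugl N)) else 0).coeff M =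
      if M = 0 then (if i = j then 1 else 0) else 0 := by
    split_ifs with h1 h2 h2
    · rw [h2, HahnSeries.coeff_one, if_pos rfl]
    · rw [HahnSeries.coeff_one, if_neg h2]
    · rfl
    · rfl
  rw [h1]
  by_cases h2 : 0 ≤ M
  · obtain ⟨k, rfl⟩ := Int.eq_ofNat_of_zero_le h2
    rw [if_pos h2, Int.toNat_natCast, PowerSeries.coeff_mk]
    match k with
    | 0 => simp [evFamily]
    | 1 => simp [evFamily]
    | k + 2 =>
      rw [if_neg (by omega), if_neg (by omega), add_zero]
      rfl
  · rw [if_neg h2, if_neg (by omega), if_neg (by omega), add_zero]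

theorem mapSer_matrix_mul {A B : Type*} [Ring A] [Algebra ℂ A] [Ring B] [Algebra ℂ B] {N : ℕ}
    (h : A →ₐ[ℂ] B) {X Y : Matrix (Fin N) (Fin N) (Ser A)} (hXY : X * Y = 1) :
    X.map (mapSer h) * Y.map (mapSer h) = 1 := by
  have e := congrArg (mapSerHom h).toRingHom.mapMatrix hXY
  rw [map_mul, map_one] at e
  exact e

theorem reflect_matrix_mul {A : Type*} [Ring A] {N : ℕ}
    {X Y : Matrix (Fin N) (Fin N) (Ser A)} (hXY : X * Y = 1) :
    X.map reflect * Y.map reflect = 1 := by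
  let reflectHom : Ser A →+* Ser A :=
    { toFun := reflect
      map_zero' := reflect_zero
      map_one' := reflect_one
      map_add' := reflect_add
      map_mul' := reflect_mul }
  have e := congrArg reflectHom.mapMatrix hXY
  rw [map_mul, map_one] at e
  exact e

variable {A : Type*} [Ring A] [Algebra ℂ A]

/-- The image of the generating matrix under the Olshanski homomorphism is the inverse of a block
of the inverse of the generating matrix. -/
theorem psi_genMatrix_inverse {k N : ℕ} (hk : k ≤ N) (g : Yangian N →ₐ[ℂ] A) :
    (genMatrix k).map (mapSer (g.comp (psi hk))) *
        ((genInverse N).map (mapSer g)).submatrix (lastEmb hk) (lastEmb hk) = 1 ∧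
      ((genInverse N).map (mapSer g)).submatrix (lastEmb hk) (lastEmb hk) *
        (genMatrix k).map (mapSer (g.comp (psi hk))) = 1 := by
  let f : Yangian k →ₐ[ℂ] A := g.comp ((omega N).comp (lowerRight hk))
  -- The first ω contributes an inverse and a reflection. The second ω contributes the same to the
  -- block (`h2`), so the two reflections compensate each other and only a block of the inverse
  -- matrix remains.
  have h1 : (genMatrix k).map (mapSer (g.comp (psi hk))) =
      ((genInverse k).map (mapSer f)).map reflect := by
    ext1 i j
    change mapSer f (mapSer (omega k) (genMatrix k i j)) = _
    rw [mapSer_omega, mapSer_reflect]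
    rfl
  have h2 : ((genInverse N).map (mapSer g)).submatrix (lastEmb hk) (lastEmb hk) =
      ((genMatrix k).map (mapSer f)).map reflect := by
    ext1 i j
    change _ = reflect (mapSer g (mapSer (omega N) (mapSer (lowerRight hk) (genMatrix k i j))))
    rw [lowerRight, mapSer_embed, mapSer_omega, mapSer_reflect, reflect_reflect]
    rfl
  rw [h1, h2]
  exact ⟨reflect_matrix_mul (mapSer_matrix_mul f (genMatrix_mul_genInverse k).2),
    reflect_matrix_mul (mapSer_matrix_mul f (genMatrix_mul_genInverse k).1)⟩

theorem betheOp_eq (N : ℕ) : betheOp N = colDet (betheMatrix (genMatrix N)) := rfl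

theorem qdet_eq (N : ℕ) : qdet N = qColDet (genMatrix N) := rfl

theorem isGlFamily_eGen (N : ℕ) : IsGlFamily (eGen N) := eGen_comm N

theorem val_dbarLower (n m : ℕ) :
    (dbarLower n m : Module.End ℂ (Ser (Ugl (n + m)))) =
      (-1 : ℤ) ^ m • colDet (dualMatrix n (fun i j => lop (HahnSeries.C (eGen (n + m) i j)))
        (lop (uVar _) + (n : Module.End ℂ (Ser (Ugl (n + m)))))
        (lop (uVar _ + ((1 - m : ℤ) : Ser (Ugl (n + m)))) * tau _)) := by
  have hinv := mapSer_matrix_mul (ev (n + m)) (genMatrix_mul_genInverse (n + m)).1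
  have hT : (genMatrix (n + m)).map (mapSer (ev (n + m))) = evMatrix (eGen (n + m)) := by
    ext1 i j
    exact mapSer_ev _ i j
  rw [hT] at hinv
  have hS := (psi_genMatrix_inverse (Nat.le_add_left m n) (ev (n + m))).2
  have hemb : (lastEmb (Nat.le_add_left m n) : Fin m → Fin (n + m)) = Fin.natAdd n := by
    funext a
    ext
    change n + m - m + (a : ℕ) = n + a
    omega
  rw [hemb] at hS
  rw [← falling_mul_qColDet_mul_betheDet (isGlFamily_eGen (n + m)) hinv hS, dbarLower, mapOp_mul,
    mapOp_coeffOp, ← mapOp_comp, betheOp_eq, mapOp_colDet_betheMatrix, mapSer_shift, mapSer_shift,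
    qdet_eq, mapSer_qColDet, mapSer_qColDet, Subalgebra.coe_mul, Subalgebra.coe_mul,
    val_colDet_betheMatrix]
  have hq : ((genMatrix n).map (mapSer (upperLeft (Nat.le_add_right n m)))).map
      (mapSer (ev (n + m))) =
        (evMatrix (eGen (n + m))).submatrix (Fin.castAdd m) (Fin.castAdd m) := by
    ext1 i j
    rw [Matrix.map_apply, Matrix.map_apply, upperLeft, mapSer_embed, mapSer_ev]
    rfl
  rw [hq]
  rfl

end YangianImages

/-! ### Commuting factors and the determinant form of D̄_n over the opposite algebra -/

section UpperOperator

variable {A : Type*} [Ring A] [Algebra ℂ A]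

theorem mul_comm_of_gen {N : ℕ} (f : Yangian N →ₐ[ℂ] A) (x : A)
    (h : ∀ i j r, x * f (gen N i j r) = f (gen N i j r) * x) (y : Yangian N) :
    x * f y = f y * x := by
  obtain ⟨y, rfl⟩ := RingQuot.mkAlgHom_surjective ℂ (YangianRel N) y
  induction y using FreeAlgebra.induction with
  | grade0 c => rw [AlgHom.commutes, AlgHom.commutes, Algebra.commutes]
  | grade1 a => exact h a.1 a.2.1 (a.2.2 + 1)
  | mul a b ha hb => rw [map_mul, map_mul, ← mul_assoc, ha, mul_assoc, hb, mul_assoc]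
  | add a b ha hb => rw [map_add, map_add, mul_add, add_mul, ha, hb]

/-- If the commutator with `c` acts on an invertible matrix `T` as the commutator with a constant
matrix supported outside of a block, then `c` commutes with the inverse of the block of `T⁻¹`. -/
theorem comm_inverse_block {R : Type*} [Ring R] {N k : ℕ} (f : Fin k ↪ Fin N) (c : R)
    {T W ε : Matrix (Fin N) (Fin N) R} {S : Matrix (Fin k) (Fin k) R} (hTW : T * W = 1)
    (hWT : W * T = 1) (hc : Matrix.diagonal (fun _ => c) * T - T * Matrix.diagonal (fun _ => c) =
      T * ε - ε * T)
    (hl : ∀ a i, ε (f a) i = 0) (hr : ∀ i a, ε i (f a) = 0)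
    (hSW : S * W.submatrix f f = 1) (hWS : W.submatrix f f * S = 1) (a b : Fin k) :
    c * S a b = S a b * c := by
  set D : Matrix (Fin N) (Fin N) R := Matrix.diagonal fun _ => c with hD
  -- The hypothesis on the commutator says that c + ε commutes with T. It therefore commutes with W,
  -- and on the chosen block of W the correction ε is not seen.
  have h1 : (D + ε) * T = T * (D + ε) := by
    rw [add_mul, mul_add, add_comm (T * D)]
    exact sub_eq_sub_iff_add_eq_add.mp hc
  have h2 : W * (D + ε) = (D + ε) * W := by
    calc W * (D + ε) = W * ((D + ε) * T) * W := by
          rw [mul_assoc, mul_assoc, hTW, mul_one]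
      _ = (D + ε) * W := by rw [h1, ← mul_assoc, hWT, one_mul]
  have h3 : ∀ a b, W.submatrix f f a b * c = c * W.submatrix f f a b := by
    intro a b
    have h := congrFun (congrFun h2 (f a)) (f b)
    rw [mul_add, add_mul, Matrix.add_apply, Matrix.add_apply, hD, Matrix.mul_diagonal,
      Matrix.diagonal_mul, Matrix.mul_apply, Matrix.mul_apply,
      Finset.sum_eq_zero fun i _ => by rw [hr, mul_zero],
      Finset.sum_eq_zero fun i _ => by rw [hl, zero_mul], add_zero, add_zero] at h
    exact h
  set D' : Matrix (Fin k) (Fin k) R := Matrix.diagonal fun _ => c with hD'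
  have h4 : W.submatrix f f * D' = D' * W.submatrix f f := by
    ext1 a b
    rw [hD', Matrix.mul_diagonal, Matrix.diagonal_mul, h3]
  have h5 : D' * S = S * D' := by
    calc D' * S = S * (W.submatrix f f * D') * S := by
          rw [← mul_assoc, hSW, one_mul]
      _ = S * D' := by rw [h4, mul_assoc, mul_assoc, hWS, mul_one]
  have h := congrFun (congrFun h5 a) b
  rwa [hD', Matrix.mul_diagonal, Matrix.diagonal_mul] at h

theorem mapSer_ev_delta (N : ℕ) (i j : Fin N) :
    mapSer ((ev N).comp (delta N)) (genMatrix N i j) =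
      reflect (evMatrix (eGen N) j.rev i.rev) := by
  rw [mapSer_comp, mapSer_delta, mapSer_reflect, mapSer_ev]

/-- Only the u⁻¹ term of 1 - e u⁻¹ has a commutator. On the right the full entries may be written
because their constant terms cancel. -/
theorem C_mul_comm_evMatrix {A : Type*} [Ring A] {N : ℕ} {e : Fin N → Fin N → A} (he : IsGlFamily e)
    (k l i j : Fin N) :
    HahnSeries.C (e k l) * reflect (evMatrix e i j) -
      reflect (evMatrix e i j) * HahnSeries.C (e k l) =
      (if i = l then reflect (evMatrix e k j) else 0) -
        if k = j then reflect (evMatrix e i l) else 0 := by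
  have hr : ∀ i j, reflect (evMatrix e i j) =
      (if i = j then 1 else 0) - HahnSeries.single 1 (e i j) := by
    intro i j
    rw [evMatrix, Matrix.of_apply, reflect_add, reflect_single, sub_eq_add_neg]
    congr 1
    · split_ifs
      · exact reflect_one
      · exact reflect_zero
    · ext M
      rw [HahnSeries.coeff_neg, HahnSeries.coeff_single, HahnSeries.coeff_single]
      split_ifs <;> simp
  have h1 : HahnSeries.C (e k l) * reflect (evMatrix e i j) -
      reflect (evMatrix e i j) * HahnSeries.C (e k l) =
      -HahnSeries.single 1 (e k l * e i j - e i j * e k l) := by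
    rw [hr, mul_sub, sub_mul, HahnSeries.C_apply, HahnSeries.single_mul_single,
      HahnSeries.single_mul_single, zero_add, add_zero, HahnSeries.single_sub]
    split_ifs
    · rw [mul_one, one_mul]
      abel
    · rw [mul_zero, zero_mul]
      abel
  rw [h1, he k l i j, hr, hr, HahnSeries.single_sub]
  by_cases h2 : i = l <;> by_cases h3 : k = j <;> simp [h2, h3]

/-- The map φ_n sends the generators to combinations of entries of the inverse of a block of an
inverse matrix. A generator e_kl of the lower right block acts on the twisted matrix T as the
commutator with a matrix unit. After the index reversal built into δ, this unit sits outside the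
block in question, so `comm_inverse_block` applies. -/
theorem ev_lowerRight_comm_phi {n m : ℕ} (x : Yangian n) (y : Yangian m) :
    ev (n + m) (lowerRight (Nat.le_add_left m n) y) *
        ev (n + m) (phi (Nat.le_add_right n m) x) =
      ev (n + m) (phi (Nat.le_add_right n m) x) *
        ev (n + m) (lowerRight (Nat.le_add_left m n) y) := by
  set g : Yangian (n + m) →ₐ[ℂ] Ugl (n + m) := (ev (n + m)).comp (delta (n + m)) with hg
  suffices h : ∀ a b : Fin m, ∀ x : Yangian n,
      eGen (n + m) (lastEmb (Nat.le_add_left m n) a) (lastEmb (Nat.le_add_left m n) b) *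
        g (psi (Nat.le_add_right n m) x) = g (psi (Nat.le_add_right n m) x) *
      eGen (n + m) (lastEmb (Nat.le_add_left m n) a) (lastEmb (Nat.le_add_left m n) b) by
    refine (mul_comm_of_gen ((ev (n + m)).comp (lowerRight (Nat.le_add_left m n)))
      (ev (n + m) (phi (Nat.le_add_right n m) x)) (fun a b r => ?_) y).symm
    rw [AlgHom.comp_apply, lowerRight, embed, Yangian.lift_gen, ev, Yangian.lift_gen]
    match r with
    | 0 =>
      rw [evFamily]
      split_ifs <;> simp
    | 1 => exact (h a b (delta n x)).symm
    | r + 2 => rw [evFamily, mul_zero, zero_mul]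
  intro a b x
  refine mul_comm_of_gen (g.comp (psi (Nat.le_add_right n m))) _ (fun i j r => ?_) x
  obtain ⟨hSW, hWS⟩ := psi_genMatrix_inverse (Nat.le_add_right n m) g
  have hTW := mapSer_matrix_mul g (genMatrix_mul_genInverse (n + m)).1
  have hWT := mapSer_matrix_mul g (genMatrix_mul_genInverse (n + m)).2
  set k := lastEmb (Nat.le_add_left m n) a with hk
  set l := lastEmb (Nat.le_add_left m n) b with hl
  have hkv : n ≤ (k : ℕ) := by
    change n ≤ n + m - m + (a : ℕ)
    omega
  have hlv : n ≤ (l : ℕ) := by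
    change n ≤ n + m - m + (b : ℕ)
    omega
  have hrev : ∀ (c : Fin n) (d : Fin (n + m)), n ≤ (d : ℕ) →
      d.rev ≠ lastEmb (Nat.le_add_right n m) c := by
    intro c d hd h
    have h1 := congrArg Fin.val h
    rw [Fin.val_rev] at h1
    change _ = n + m - n + (c : ℕ) at h1
    omega
  -- The reversed indices of k and l are among the first m, while `lastEmb` selects the last n.
  -- Hence the matrix unit has no entries in the rows or columns of the block.
  have hcomm := comm_inverse_block (lastEmb (Nat.le_add_right n m))
    (HahnSeries.C (eGen (n + m) k l)) (ε := Matrix.single k.rev l.rev 1) hTW hWT ?_ ?_ ?_ hSW hWS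
    i j
  · have h := congrArg (fun f => HahnSeries.coeff f (r : ℤ)) hcomm
    simp only [HahnSeries.C_apply, HahnSeries.coeff_single_zero_mul,
      HahnSeries.coeff_mul_single_zero] at h
    have hr : (mapSer (g.comp (psi (Nat.le_add_right n m))) (genMatrix n i j)).coeff (r : ℤ) =
        g.comp (psi (Nat.le_add_right n m)) (gen n i j r) := by
      rw [coeff_mapSer, genMatrix, Matrix.of_apply, genSer, HahnSeries.ofPowerSeries_apply_coeff,
        PowerSeries.coeff_mk]
    rw [Matrix.map_apply, hr] at h
    exact h
  · ext1 i j
    rw [Matrix.sub_apply, Matrix.sub_apply, Matrix.diagonal_mul, Matrix.mul_diagonal,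
      Matrix.map_apply, hg, mapSer_ev_delta, C_mul_comm_evMatrix (isGlFamily_eGen _)]
    congr 1
    · by_cases h : j = l.rev
      · subst h
        rw [Matrix.mul_single_apply_same, mul_one, if_pos (Fin.rev_rev l), Matrix.map_apply,
          mapSer_ev_delta, Fin.rev_rev]
      · rw [Matrix.mul_single_apply_of_ne _ _ _ _ _ h, if_neg]
        intro h'
        exact h (by rw [← h', Fin.rev_rev])
    · by_cases h : i = k.rev
      · subst h
        rw [Matrix.single_mul_apply_same, one_mul, if_pos (Fin.rev_rev k).symm, Matrix.map_apply,
          mapSer_ev_delta, Fin.rev_rev]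
      · rw [Matrix.single_mul_apply_of_ne _ _ _ _ _ h, if_neg]
        intro h'
        exact h (by rw [h', Fin.rev_rev])
  · intro c i
    exact Matrix.single_apply_of_row_ne (hrev c k hkv) _ _ _
  · intro i c
    exact Matrix.single_apply_of_col_ne _ _ (hrev c l hlv) _

/-- The generators of `𝔤𝔩_{n+m}` in the opposite algebra, with a sign and in the reversed order. -/
def oppositeGen (n m : ℕ) (i j : Fin (m + n)) : (Ugl (n + m))ᵐᵒᵖ :=
  -MulOpposite.op (eGen (n + m) (Fin.cast (add_comm m n) i).rev (Fin.cast (add_comm m n) j).rev)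

/-- Passing to the opposite algebra changes the sign of commutators, and the sign of the generators
absorbs this. Reversing the indices only renames them. -/
theorem isGlFamily_oppositeGen (n m : ℕ) : IsGlFamily (oppositeGen n m) := by
  intro i j k l
  have h := congrArg MulOpposite.op (isGlFamily_eGen (n + m) (Fin.cast (add_comm m n) i).rev
    (Fin.cast (add_comm m n) j).rev (Fin.cast (add_comm m n) k).rev (Fin.cast (add_comm m n) l).rev)
  simp only [Fin.rev_inj, Fin.cast_inj, MulOpposite.op_sub, MulOpposite.op_mul] at h
  simp only [oppositeGen, neg_mul_neg]
  rw [← neg_sub, h]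
  split_ifs <;> simp
  abel

theorem evMatrix_oppositeGen (n m : ℕ) (i j : Fin (m + n)) :
    evMatrix (oppositeGen n m) i j = opSer (reflect (evMatrix (eGen (n + m))
      (Fin.cast (add_comm m n) i).rev (Fin.cast (add_comm m n) j).rev)) := by
  rw [evMatrix, evMatrix, Matrix.of_apply, Matrix.of_apply, reflect_add, reflect_single, map_add,
    opSer_single]
  simp only [Fin.rev_inj, Fin.cast_inj]
  congr 1
  · split_ifs
    · rw [reflect_one, opSer_one]
    · rw [reflect_zero, map_zero]
  · simp [oppositeGen]

theorem opSer_matrix_mul {N : ℕ} {X Y : Matrix (Fin N) (Fin N) (Ser A)} (h : X * Y = 1) :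
    (Matrix.of fun i j => opSer (Y j i)) * (Matrix.of fun i j => opSer (X j i)) =
      (1 : Matrix (Fin N) (Fin N) (Ser Aᵐᵒᵖ)) := by
  ext1 i j
  have h1 := congrArg opSer (congrFun (congrFun h j) i)
  rw [Matrix.mul_apply, map_sum] at h1
  rw [Matrix.mul_apply]
  simp only [Matrix.of_apply, ← opSer_mul, h1]
  rw [Matrix.one_apply, Matrix.one_apply]
  by_cases hij : i = j
  · rw [if_pos hij, if_pos hij.symm, opSer_one]
  · rw [if_neg hij, if_neg fun h => hij h.symm, map_zero]

/-- This is the determinant formula for D̄_m with n and m exchanged, applied to the opposite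
generators. The transpose in δ matches the transpose that turns a matrix inverse into one over the
opposite algebra. -/
theorem val_opOp_dbarUpper (n m : ℕ) :
    (opOp (dbarUpper n m) : Module.End ℂ (Ser (Ugl (n + m))ᵐᵒᵖ)) =
      (-1 : ℤ) ^ n • colDet (dualMatrix m (fun i j => lop (HahnSeries.C (oppositeGen n m i j)))
        (lop (uVar _) + (m : Module.End ℂ (Ser (Ugl (n + m))ᵐᵒᵖ)))
        (lop (uVar _ + ((1 - n : ℤ) : Ser (Ugl (n + m))ᵐᵒᵖ)) * tau _)) := by
  set g : Yangian (n + m) →ₐ[ℂ] Ugl (n + m) := (ev (n + m)).comp (delta (n + m)) with hg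
  set c := Fin.cast (add_comm m n) with hc
  let Wg := (genInverse (n + m)).map (mapSer g)
  let Sg := (genMatrix n).map (mapSer (g.comp (psi (Nat.le_add_right n m))))
  let W : Matrix (Fin (m + n)) (Fin (m + n)) (Ser (Ugl (n + m))ᵐᵒᵖ) :=
    (Matrix.of fun i j => opSer (Wg j i)).submatrix c c
  let S : Matrix (Fin n) (Fin n) (Ser (Ugl (n + m))ᵐᵒᵖ) := Matrix.of fun i j => opSer (Sg j i)
  -- Over the opposite algebra it is the transposed inverse that inverts the transposed matrix. The
  -- transposed image of T under ev ∘ δ is the evaluation matrix of the opposite generators.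
  have hW : evMatrix (oppositeGen n m) * W = 1 := by
    have h := opSer_matrix_mul (mapSer_matrix_mul g (genMatrix_mul_genInverse (n + m)).2)
    have h2 := congrArg (fun M => M.submatrix (finCongr (add_comm m n)) (finCongr (add_comm m n))) h
    simp only [Matrix.submatrix_one_equiv] at h2
    rw [← Matrix.submatrix_mul_equiv _ _ _ (finCongr (add_comm m n))] at h2
    rw [← h2]
    congr 1
    ext1 i j
    rw [evMatrix_oppositeGen]
    change _ = opSer (mapSer g (genMatrix (n + m) (c j) (c i)))
    rw [hg, mapSer_ev_delta]
  have hS : W.submatrix (Fin.natAdd m) (Fin.natAdd m) * S = 1 := by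
    have h := opSer_matrix_mul (psi_genMatrix_inverse (Nat.le_add_right n m) g).1
    refine Eq.trans ?_ h
    congr 1
    ext1 i j
    have hcv : ∀ i : Fin n, c (Fin.natAdd m i) = lastEmb (Nat.le_add_right n m) i := by
      intro i
      ext
      change m + (i : ℕ) = n + m - n + i
      omega
    change opSer (Wg (c (Fin.natAdd m j)) (c (Fin.natAdd m i))) = opSer (Wg _ _)
    rw [hcv, hcv]
  rw [← falling_mul_qColDet_mul_betheDet (isGlFamily_oppositeGen n m) hW hS]
  have hD : opOp (mapOp ((ev (n + m)).comp (phi (Nat.le_add_right n m)))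
      (deltaHat n (betheOp n))) = colDet (betheMatrix S) := by
    rw [betheOp_eq, deltaOpHom_colDet_betheMatrix]
    congr 2
    ext1 i j
    change opSer (reflect (mapSer (g.comp (psi (Nat.le_add_right n m)))
      (mapSer (delta n) (genMatrix n i.rev j.rev)))) = opSer _
    rw [mapSer_delta, mapSer_reflect, reflect_reflect, Fin.rev_rev, Fin.rev_rev]
    rfl
  have hq : opSer (mapSer ((ev (n + m)).comp (lowerRight (Nat.le_add_left m n)))
      (shift 1 (reflect (qdet m)))) =
      shift m (qColDet ((evMatrix (oppositeGen n m)).submatrix (Fin.castAdd n)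
        (Fin.castAdd n))) := by
    rw [mapSer_shift, mapSer_reflect, qdet_eq, mapSer_qColDet, opSer_qColDet]
    congr 2
    ext1 i j
    have hcv : ∀ i : Fin m, lastEmb (Nat.le_add_left m n) i.rev = (c (Fin.castAdd n i)).rev := by
      intro i
      ext
      rw [Fin.val_rev]
      change n + m - m + (i.rev : ℕ) = n + m - ((i : ℕ) + 1)
      rw [Fin.val_rev]
      omega
    rw [Matrix.of_apply, Matrix.map_apply, mapSer_comp, lowerRight, mapSer_embed, mapSer_ev,
      Matrix.submatrix_apply, evMatrix_oppositeGen, hcv, hcv]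
  have hfall : opSer (falling (Ugl (n + m)) m (n + m)) = falling _ m (m + n) := by
    rw [falling_eq_mapSer, opSer_mapSer_ofId, ← falling_eq_mapSer, add_comm]
  have hcomm : ∀ (a : Yangian n) (b : Yangian m),
      (ev (n + m)).comp (lowerRight (Nat.le_add_left m n)) b *
        (ev (n + m)).comp (phi (Nat.le_add_right n m)) a =
      (ev (n + m)).comp (phi (Nat.le_add_right n m)) a *
        (ev (n + m)).comp (lowerRight (Nat.le_add_left m n)) b :=
    fun a b => ev_lowerRight_comm_phi a b
  have hprod := opOp_coeffOp_mul_mapOp _ _ hcomm (shift 1 (reflect (qdet m)))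
    (deltaHat n (betheOp n))
  have hupper : opOp (dbarUpper n m) = coeffOp (falling _ m (m + n)) *
      (coeffOp (shift m (qColDet ((evMatrix (oppositeGen n m)).submatrix (Fin.castAdd n)
        (Fin.castAdd n)))) * colDet (betheMatrix S)) := by
    rw [dbarUpper, mapOp_mul, mapOp_coeffOp, ← mapOp_comp, ← mapSer_comp, ← hD, ← hq, ← hprod,
      ← hfall, falling_eq_mapSer]
    -- The falling factorial has scalar coefficients, so it commutes with everything and passes
    -- through `opOp`. The other product uses `hcomm`.
    have hid := opOp_coeffOp_mul_mapOp (AlgHom.id ℂ (Ugl (n + m)))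
      (Algebra.ofId ℂ (Ugl (n + m))) (fun a r => Algebra.commutes r a) (falling ℂ m (n + m))
    have hmapid : ∀ T : DiffOp (Ugl (n + m)), mapOp (AlgHom.id ℂ (Ugl (n + m))) T = T := by
      intro T
      induction T using diffOp_induction with
      | add S T hS hT => rw [map_add, hS, hT]
      | monomial f i =>
        rw [mapOp_coeffOp_mul]
        rfl
    simp only [hmapid] at hid
    exact hid _
  rw [hupper, Subalgebra.coe_mul, Subalgebra.coe_mul, val_colDet_betheMatrix]
  rfl

end UpperOperator

/-! ### The algebra z a = a z + z and its anti-involution -/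

section PolynomialOperatorAlgebra

/-- The relation `z a = a z + z`. -/
inductive ShiftRel : FreeAlgebra ℂ Bool → FreeAlgebra ℂ Bool → Prop
  | rel : ShiftRel (FreeAlgebra.ι ℂ true * FreeAlgebra.ι ℂ false)
      (FreeAlgebra.ι ℂ false * FreeAlgebra.ι ℂ true + FreeAlgebra.ι ℂ true)

/-- The algebra with generators `a`, `z` and the relation `z a = a z + z`. -/
abbrev ShiftAlg : Type := RingQuot ShiftRel

namespace ShiftAlg

/-- The generator `a`. -/
def a : ShiftAlg := RingQuot.mkAlgHom ℂ ShiftRel (FreeAlgebra.ι ℂ false)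

/-- The generator `z`. -/
def z : ShiftAlg := RingQuot.mkAlgHom ℂ ShiftRel (FreeAlgebra.ι ℂ true)

theorem z_mul_a : z * a = a * z + z := by
  have h := RingQuot.mkAlgHom_rel ℂ ShiftRel.rel
  rwa [map_mul, map_add, map_mul] at h

variable {B : Type*} [Semiring B] [Algebra ℂ B]

/-- The universal property. -/
def lift (x y : B) (h : y * x = x * y + y) : ShiftAlg →ₐ[ℂ] B :=
  RingQuot.liftAlgHom ℂ ⟨FreeAlgebra.lift ℂ fun b : Bool => if b then y else x, by
    rintro _ _ ⟨⟩
    simpa using h⟩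

theorem lift_a (x y : B) (h : y * x = x * y + y) : lift x y h a = x := by
  rw [lift, a, RingQuot.liftAlgHom_mkAlgHom_apply]
  simp

theorem lift_z (x y : B) (h : y * x = x * y + y) : lift x y h z = y := by
  rw [lift, z, RingQuot.liftAlgHom_mkAlgHom_apply]
  simp

theorem hom_ext {f g : ShiftAlg →ₐ[ℂ] B} (ha : f a = g a) (hz : f z = g z) : f = g := by
  apply RingQuot.ringQuot_ext'
  apply FreeAlgebra.hom_ext
  funext b
  cases b
  · exact ha
  · exact hz

/-- The span of the ordered monomials contains 1 and is stable under left multiplication by a and by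
z. For z, the relation moves it to the right past the powers of a one at a time. -/
theorem span_monomials :
    Submodule.span ℂ (Set.range fun p : ℕ × ℕ => a ^ p.1 * z ^ p.2) = ⊤ := by
  set N := Submodule.span ℂ (Set.range fun p : ℕ × ℕ => a ^ p.1 * z ^ p.2) with hN
  have hmem : ∀ i j, a ^ i * z ^ j ∈ N := fun i j => Submodule.subset_span ⟨(i, j), rfl⟩
  have ha : ∀ y ∈ N, a * y ∈ N := by
    intro y hy
    induction hy using Submodule.span_induction with
    | mem y hy =>
      obtain ⟨p, rfl⟩ := hy
      simp only
      rw [← mul_assoc, ← pow_succ']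
      exact hmem _ _
    | zero => rw [mul_zero]; exact zero_mem _
    | add x y _ _ hx hy => rw [mul_add]; exact add_mem hx hy
    | smul c x _ hx => rw [mul_smul_comm]; exact N.smul_mem _ hx
  have hz1 : ∀ i j, z * (a ^ i * z ^ j) ∈ N := by
    intro i
    induction i with
    | zero =>
      intro j
      rw [pow_zero, one_mul, ← pow_succ', ← one_mul (z ^ (j + 1)), ← pow_zero a]
      exact hmem _ _
    | succ i ih =>
      intro j
      rw [pow_succ', mul_assoc, ← mul_assoc, z_mul_a, add_mul, mul_assoc]
      exact add_mem (ha _ (ih j)) (ih j)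
  have hz : ∀ y ∈ N, z * y ∈ N := by
    intro y hy
    induction hy using Submodule.span_induction with
    | mem y hy =>
      obtain ⟨p, rfl⟩ := hy
      exact hz1 _ _
    | zero => rw [mul_zero]; exact zero_mem _
    | add x y _ _ hx hy => rw [mul_add]; exact add_mem hx hy
    | smul c x _ hx => rw [mul_smul_comm]; exact N.smul_mem _ hx
  have key : ∀ w : FreeAlgebra ℂ Bool, ∀ y ∈ N, RingQuot.mkAlgHom ℂ ShiftRel w * y ∈ N := by
    intro w
    induction w using FreeAlgebra.induction with
    | grade0 c =>
      intro y hy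
      rw [AlgHom.commutes, ← Algebra.smul_def]
      exact N.smul_mem _ hy
    | grade1 b =>
      cases b
      · exact ha
      · exact hz
    | mul v w hv hw =>
      intro y hy
      rw [map_mul, mul_assoc]
      exact hv _ (hw _ hy)
    | add v w hv hw =>
      intro y hy
      rw [map_add, add_mul]
      exact add_mem (hv _ hy) (hw _ hy)
  rw [eq_top_iff]
  rintro x -
  obtain ⟨w, rfl⟩ := RingQuot.mkAlgHom_surjective ℂ ShiftRel x
  have h1 := hmem 0 0
  rw [pow_zero, pow_zero, one_mul] at h1
  have := key w 1 h1
  rwa [mul_one] at this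

/-- The anti-involution `z ↦ z`, `a ↦ z - a - 1`. -/
def antiHom : ShiftAlg →ₐ[ℂ] ShiftAlgᵐᵒᵖ :=
  lift (MulOpposite.op (z - a - 1)) (MulOpposite.op z) (by
    rw [← MulOpposite.op_mul, ← MulOpposite.op_mul, ← MulOpposite.op_add]
    congr 1
    rw [mul_sub, mul_sub, z_mul_a, sub_mul, sub_mul]
    noncomm_ring)

theorem unop_antiHom_antiHom (w : ShiftAlg) : (antiHom (antiHom w).unop).unop = w := by
  have h : (AlgHom.opComm antiHom).comp antiHom = AlgHom.id ℂ ShiftAlg := by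
    apply hom_ext
    · change (antiHom (antiHom a).unop).unop = a
      have h1 : antiHom a = MulOpposite.op (z - a - 1) := lift_a _ _ _
      have h2 : antiHom z = MulOpposite.op z := lift_z _ _ _
      rw [h1, MulOpposite.unop_op, map_sub, map_sub, map_one, h1, h2]
      change z - (z - a - 1) - 1 = a
      abel
    · change (antiHom (antiHom z).unop).unop = z
      have h2 : antiHom z = MulOpposite.op z := lift_z _ _ _
      rw [h2, MulOpposite.unop_op, h2, MulOpposite.unop_op]
  exact DFunLike.congr_fun h w

theorem antiHom_bijective : Function.Bijective antiHom := by
  constructor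
  · intro v w h
    rw [← unop_antiHom_antiHom v, h, unop_antiHom_antiHom]
  · intro w
    refine ⟨(antiHom w.unop).unop, ?_⟩
    have := unop_antiHom_antiHom w.unop
    exact MulOpposite.unop_injective this

/-- The anti-involution `z ↦ z`, `a ↦ z - a - 1`, as an equivalence. -/
def antiEquiv : ShiftAlg ≃ₐ[ℂ] ShiftAlgᵐᵒᵖ := AlgEquiv.ofBijective antiHom antiHom_bijective

end ShiftAlg

end PolynomialOperatorAlgebra

/-! ### Realisation by difference operators and its faithfulness -/

section PolynomialOperatorHomomorphism

open ShiftAlg TensorProduct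

theorem algebraMap_series_eq (c : ℂ) : algebraMap ℂ (Ser ℂ) c = HahnSeries.C c :=
  HahnSeries.ofPowerSeries_C _

variable {A B : Type*} [Ring A] [Algebra ℂ A] [Ring B] [Algebra ℂ B]

theorem algebraMap_diffOp_eq (c : ℂ) :
    algebraMap ℂ (DiffOp A) c = coeffOp (HahnSeries.C (algebraMap ℂ A c)) := by
  apply Subtype.ext
  ext1 f
  change c • f = HahnSeries.C (algebraMap ℂ A c) * f
  rw [HahnSeries.C_mul_eq_smul]
  ext N
  rw [HahnSeries.coeff_smul, HahnSeries.coeff_smul, smul_eq_mul, Algebra.smul_def]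

/-- The coefficients of difference operators as a homomorphism. -/
def coeffOpHom : Ser A →+* DiffOp A where
  toFun := coeffOp
  map_zero' := coeffOp_zero
  map_one' := coeffOp_one
  map_add' := coeffOp_add
  map_mul' := coeffOp_mul

/-- Left multiplication by elements of `A` as a homomorphism to difference operators. -/
def constOp : A →ₐ[ℂ] DiffOp A where
  toRingHom := coeffOpHom.comp HahnSeries.C
  commutes' c := (algebraMap_diffOp_eq c).symm

theorem constOp_apply (a : A) : constOp a = coeffOp (HahnSeries.C a) := rfl

theorem tauOp_mul_coeffOp (f : Ser A) : tauOp A * coeffOp f = coeffOp (shift 1 f) * tauOp A := by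
  have h := tauOp_pow_mul_coeffOp 1 f
  rwa [pow_one] at h

/-- The series `u - c`. -/
def uSub (A : Type*) [Ring A] [Algebra ℂ A] (c : ℂ) : Ser A :=
  uVar A - HahnSeries.C (algebraMap ℂ A c)

/-- The homomorphism `a ↦ u`, `z ↦ (u - c) τ`. -/
def polyHom (A : Type*) [Ring A] [Algebra ℂ A] (c : ℂ) : ShiftAlg →ₐ[ℂ] DiffOp A :=
  ShiftAlg.lift (coeffOp (uVar A)) (coeffOp (uSub A c) * tauOp A) (by
    rw [mul_assoc, tauOp_mul_coeffOp, shift_uVar, Int.cast_one, coeffOp_add, coeffOp_one, add_mul,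
      mul_add, one_mul, ← mul_assoc, ← mul_assoc, ← coeffOp_mul, ← coeffOp_mul, uVar_mul_comm])

theorem polyHom_a (c : ℂ) : polyHom A c a = coeffOp (uVar A) := lift_a _ _ _

theorem polyHom_z (c : ℂ) : polyHom A c z = coeffOp (uSub A c) * tauOp A := lift_z _ _ _

theorem mapSer_uSub (h : A →ₐ[ℂ] B) (c : ℂ) : mapSer h (uSub A c) = uSub B c := by
  rw [uSub, map_sub, mapSer_uVar, HahnSeries.C_apply, mapSer_single, AlgHom.commutes]
  rfl

theorem mapOp_polyHom (h : A →ₐ[ℂ] B) (c : ℂ) (w : ShiftAlg) :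
    mapOp h (polyHom A c w) = polyHom B c w := by
  have : (mapOpHom h).comp (polyHom A c) = polyHom B c := by
    apply hom_ext
    · change mapOp h (polyHom A c a) = polyHom B c a
      rw [polyHom_a, polyHom_a, mapOp_coeffOp, mapSer_uVar]
    · change mapOp h (polyHom A c z) = polyHom B c z
      rw [polyHom_z, polyHom_z, mapOp_mul, mapOp_coeffOp, mapOp_tauOp, mapSer_uSub]
  exact DFunLike.congr_fun this w

/-- The operators in the image of `polyHom` have scalar coefficients. These are central, so on such
products the reversal of coefficients affects only r. -/
theorem opOp_constOp_mul_polyHom (r : A) (c : ℂ) (w : ShiftAlg) :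
    opOp (constOp r * polyHom A c w) = constOp (MulOpposite.op r) * polyHom Aᵐᵒᵖ c w := by
  rw [← mapOp_polyHom (Algebra.ofId ℂ A), ← mapOp_polyHom (Algebra.ofId ℂ Aᵐᵒᵖ)]
  induction polyHom ℂ c w using diffOp_induction with
  | add S T hS hT => rw [map_add, mul_add, map_add, hS, hT, map_add, mul_add]
  | monomial f i =>
    rw [mapOp_coeffOp_mul, mapOp_coeffOp_mul, constOp_apply, constOp_apply, ← mul_assoc,
      ← mul_assoc, ← coeffOp_mul, ← coeffOp_mul, opOp_coeffOp_mul, ← mapSer_algebraMap_comm,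
      opSer_mul, opSer_mapSer_ofId]
    congr 3
    exact opSer_single _ _

theorem commute_constOp_polyHom (r : A) (c : ℂ) (w : ShiftAlg) :
    Commute (constOp r) (polyHom A c w) := by
  rw [← mapOp_polyHom (Algebra.ofId ℂ A)]
  induction polyHom ℂ c w using diffOp_induction with
  | add S T hS hT =>
    rw [map_add]
    exact hS.add_right hT
  | monomial f i =>
    rw [mapOp_coeffOp_mul, constOp_apply]
    refine Commute.mul_right ?_ ?_
    · change _ * _ = _ * _
      rw [← coeffOp_mul, ← coeffOp_mul, mapSer_algebraMap_comm]
    · change _ * _ = _ * _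
      rw [tauOp_pow_mul_coeffOp, shift_C]

/-- The homomorphism `r ⊗ w ↦ r w` with `a ↦ u`, `z ↦ (u - c) τ`. -/
def tensorHom (A : Type*) [Ring A] [Algebra ℂ A] (c : ℂ) :
    TensorProduct ℂ A ShiftAlg →ₐ[ℂ] DiffOp A :=
  Algebra.TensorProduct.lift constOp (polyHom A c) fun r w => commute_constOp_polyHom r c w

theorem tensorHom_tmul (c : ℂ) (r : A) (w : ShiftAlg) :
    tensorHom A c (r ⊗ₜ w) = constOp r * polyHom A c w := rfl

/-- Comparing coefficients gives a recursion that determines each coefficient from the preceding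
one, and the coefficients vanish far enough to the left. No assumption on zero divisors of R is
needed. -/
theorem eq_zero_of_mul_uVar_add {R : Type*} [Ring R] {f : Ser R} {s : R}
    (h : f * (uVar R + HahnSeries.C s) = 0) : f = 0 := by
  obtain ⟨L, hf, -⟩ := exists_bound f f
  have hrec : ∀ k, f.coeff (k + 1) = -(f.coeff k * s) := by
    intro k
    have h1 := congrArg (fun g : Ser R => g.coeff k) h
    simp only [mul_add, HahnSeries.coeff_add, HahnSeries.coeff_zero] at h1
    have h2 : (f * uVar R).coeff k = f.coeff (k + 1) := by
      have h3 := HahnSeries.coeff_mul_single_add (Γ := ℤ) (r := (1 : R)) (x := f) (a := k + 1)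
        (b := -1)
      rwa [add_neg_cancel_right, mul_one] at h3
    have h4 : (f * HahnSeries.C s).coeff k = f.coeff k * s := by
      have h3 := HahnSeries.coeff_mul_single_add (Γ := ℤ) (r := s) (x := f) (a := k) (b := 0)
      rwa [add_zero] at h3
    rw [h2, h4] at h1
    exact eq_neg_of_add_eq_zero_left h1
  have hnat : ∀ k : ℕ, f.coeff (L - 1 + k) = 0 := by
    intro k
    induction k with
    | zero => exact hf _ (by simp)
    | succ k ih =>
      rw [Nat.cast_succ, ← add_assoc, hrec, ih, zero_mul, neg_zero]
  ext p
  rcases lt_or_ge p L with hp | hp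
  · exact hf p hp
  · have := hnat (p - (L - 1)).toNat
    rwa [Int.toNat_of_nonneg (by omega), add_sub_cancel] at this

theorem exists_polyHom_z_pow (c : ℂ) (j : ℕ) : ∃ g : Ser A,
    polyHom A c (z ^ j) = coeffOp g * tauOp A ^ j ∧ ∀ f, f * g = 0 → f = 0 := by
  induction j with
  | zero =>
    refine ⟨1, ?_, fun f hf => by rwa [mul_one] at hf⟩
    rw [pow_zero, pow_zero, map_one, coeffOp_one, mul_one]
  | succ j ih =>
    obtain ⟨g, hg, hcancel⟩ := ih
    -- The coefficient of τ^j is the product of the factors u - c + k for k < j. Each of them can be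
    -- cancelled on the right.
    refine ⟨g * shift j (uSub A c), ?_, fun f hf => hcancel f ?_⟩
    · have := monomial_mul_monomial g (uSub A c) j 1
      rw [pow_one] at this
      rw [pow_succ, map_mul, hg, polyHom_z, this]
    · rw [← mul_assoc] at hf
      have h1 : shift j (uSub A c) = uVar A + HahnSeries.C ((j : A) - algebraMap ℂ A c) := by
        have h2 : uSub A c = uVar A + HahnSeries.C (-algebraMap ℂ A c) := by
          rw [uSub, map_neg, sub_eq_add_neg]
        rw [h2, shift_add, shift_uVar, shift_C, map_sub, map_neg, Int.cast_natCast, map_natCast]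
        abel
      rw [h1] at hf
      exact eq_zero_of_mul_uVar_add hf

/-- The linear combinations of the elements `r ⊗ aⁱ zʲ`. -/
def monomialSum (A : Type*) [Ring A] [Algebra ℂ A] :
    (ℕ × ℕ →₀ A) →ₗ[ℂ] TensorProduct ℂ A ShiftAlg :=
  Finsupp.lsum ℂ fun p => (TensorProduct.mk ℂ A ShiftAlg).flip (a ^ p.1 * z ^ p.2)

theorem monomialSum_single (p : ℕ × ℕ) (r : A) :
    monomialSum A (Finsupp.single p r) = r ⊗ₜ (a ^ p.1 * z ^ p.2) := by
  simp [monomialSum]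

theorem monomialSum_surjective : Function.Surjective (monomialSum A) := by
  rw [← LinearMap.range_eq_top, eq_top_iff]
  rintro x -
  induction x using TensorProduct.induction_on with
  | zero => exact zero_mem _
  | add x y hx hy => exact add_mem hx hy
  | tmul r w =>
    have hw : w ∈ Submodule.span ℂ (Set.range fun p : ℕ × ℕ => a ^ p.1 * z ^ p.2) := by
      rw [span_monomials]
      trivial
    induction hw using Submodule.span_induction with
    | mem w hw =>
      obtain ⟨p, rfl⟩ := hw
      exact ⟨_, monomialSum_single p r⟩
    | zero => rw [TensorProduct.tmul_zero]; exact zero_mem _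
    | add x y _ _ hx hy => rw [TensorProduct.tmul_add]; exact add_mem hx hy
    | smul c x _ hx => rw [TensorProduct.tmul_smul]; exact Submodule.smul_mem _ _ hx

/-- The series `∑ i, b (i, j) uⁱ`. -/
def columnSeries {R : Type*} [Ring R] (j : ℕ) : (ℕ × ℕ →₀ R) →+ Ser R :=
  Finsupp.liftAddHom fun p =>
    if p.2 = j then HahnSeries.single.addMonoidHom (-(p.1 : ℤ)) else 0

theorem columnSeries_single {R : Type*} [Ring R] (j : ℕ) (p : ℕ × ℕ) (r : R) :
    columnSeries j (Finsupp.single p r) =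
      if p.2 = j then HahnSeries.single (-(p.1 : ℤ)) r else 0 := by
  rw [columnSeries, Finsupp.liftAddHom_apply_single]
  split_ifs <;> rfl

theorem coeff_columnSeries {R : Type*} [Ring R] (i j : ℕ) (b : ℕ × ℕ →₀ R) :
    (columnSeries j b).coeff (-(i : ℤ)) = b (i, j) := by
  induction b using Finsupp.induction_linear with
  | zero => rw [map_zero]; rfl
  | add b b' hb hb' => rw [map_add, HahnSeries.coeff_add, hb, hb', Finsupp.add_apply]
  | single p r =>
    obtain ⟨k, l⟩ := p
    rw [columnSeries_single, Finsupp.single_apply]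
    by_cases hl : l = j
    · subst hl
      rw [if_pos rfl]
      by_cases hk : k = i
      · subst hk
        rw [HahnSeries.coeff_single_same, if_pos rfl]
      · rw [HahnSeries.coeff_single_of_ne (by simpa using Ne.symm hk), if_neg (by simp [hk])]
    · rw [if_neg hl, if_neg (by simp [hl])]
      rfl

/-- The coefficient of τ^j in the image of ∑ b(i, j) ⊗ aⁱ zʲ is ∑ b(i, j) uⁱ times a cancellable
series. If the image is zero, every polynomial in u vanishes, and with it every b(i, j). This also
shows the independence of the monomials aⁱ zʲ. -/
theorem tensorHom_injective (A : Type*) [Ring A] [Algebra ℂ A] (c : ℂ) :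
    Function.Injective (tensorHom A c) := by
  choose g hg hcancel using exists_polyHom_z_pow (A := A) c
  have hpow : ∀ i : ℕ, polyHom A c (a ^ i) = coeffOp (HahnSeries.single (-(i : ℤ)) 1) := by
    intro i
    rw [map_pow, polyHom_a]
    induction i with
    | zero =>
      rw [pow_zero, ← coeffOp_one]
      rfl
    | succ i ih =>
      rw [pow_succ, ih, ← coeffOp_mul, uVar, HahnSeries.single_mul_single, mul_one]
      congr 2
      rw [Nat.cast_succ, neg_add]
  have key : ∀ b : ℕ × ℕ →₀ A, ∀ j,
      (coeffEquiv A).symm (tensorHom A c (monomialSum A b)) j = columnSeries j b * g j := by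
    intro b j
    induction b using Finsupp.induction_linear with
    | zero => simp only [map_zero, zero_mul]; rfl
    | add b b' hb hb' => simp only [map_add, Finsupp.add_apply, hb, hb', add_mul]
    | single p r =>
      rw [monomialSum_single, tensorHom_tmul, map_mul (polyHom A c), hpow, hg, constOp_apply, ← mul_assoc,
        ← coeffOp_mul, ← mul_assoc, ← coeffOp_mul, ← coeffEquiv_single,
        LinearEquiv.symm_apply_apply, columnSeries_single, Finsupp.single_apply]
      split_ifs with h
      · rw [HahnSeries.C_apply, HahnSeries.single_mul_single, zero_add, mul_one, h]
      · rw [zero_mul]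
  rw [injective_iff_map_eq_zero]
  intro x hx
  obtain ⟨b, rfl⟩ := monomialSum_surjective x
  have hb : b = 0 := by
    ext p
    obtain ⟨i, j⟩ := p
    have h1 := key b j
    rw [hx, map_zero] at h1
    rw [← coeff_columnSeries, hcancel j _ h1.symm]
    rfl
  rw [hb, map_zero]

theorem polyHom_injective (c : ℂ) : Function.Injective (polyHom ℂ c) := by
  intro v w h
  have h1 : tensorHom ℂ c (1 ⊗ₜ v) = tensorHom ℂ c (1 ⊗ₜ w) := by
    rw [tensorHom_tmul, tensorHom_tmul, h]
  have h2 := congrArg (TensorProduct.lid ℂ ShiftAlg) (tensorHom_injective ℂ c h1)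
  simpa using h2

end PolynomialOperatorHomomorphism

/-! ### The duality between the two determinants -/

section Duality

open ShiftAlg TensorProduct

theorem colDet_neg {R : Type*} [Ring R] {K : ℕ} (M : Matrix (Fin K) (Fin K) R) :
    colDet (-M) = (-1 : ℤ) ^ K • colDet M := by
  rw [colDet, colDet, Finset.smul_sum]
  refine Finset.sum_congr rfl fun p _ => ?_
  rw [smul_comm]
  congr 1
  have h := mul_prod_ofFn_of_intertwine (fun j => (-1 : R) ^ j) (fun j => (-M) (p j) j)
    (fun j => M (p j) j) (fun j => by
      rw [Matrix.neg_apply, pow_succ, mul_neg, mul_neg, mul_neg, mul_one, neg_inj]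
      exact (Commute.neg_one_left _).pow_left _)
  rw [pow_zero, one_mul] at h
  rw [h, zsmul_eq_mul]
  push_cast
  exact ((Commute.neg_one_left _).pow_left _).symm

theorem colDet_submatrix_cast {R : Type*} [Ring R] {K L : ℕ} (h : K = L)
    (M : Matrix (Fin L) (Fin L) R) :
    colDet (M.submatrix (Fin.cast h) (Fin.cast h)) = colDet M := by
  subst h
  rfl

theorem dualMatrix_map {R R' : Type*} [Ring R] [Ring R'] (f : R →+* R') {K : ℕ} (n : ℕ)
    (e : Fin K → Fin K → R) (x y : R) :
    (dualMatrix n e x y).map f = dualMatrix n (fun i j => f (e i j)) (f x) (f y) := by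
  ext1 i j
  simp only [dualMatrix, Matrix.map_apply, Matrix.of_apply, map_add]
  congr 1
  split_ifs <;> simp

/-! ### Identification with 𝒫(c) and transport of the anti-involution -/

section PolynomialOperatorEquivalence

variable {A : Type*} [Ring A] [Algebra ℂ A]

/-- Since (u - c)d = (u - c)τ - u + c, the element z - a + c represents the second generator of
𝒫(c). This is the form in which the anti-involution is evaluated on it. -/
theorem polyHom_z_sub_a_add (c : ℂ) :
    polyHom A c (z - a + algebraMap ℂ ShiftAlg c) = coeffOp (uSub A c) * (tauOp A - 1) := by
  have h : coeffOp (uSub A c) + coeffOp (HahnSeries.C (algebraMap ℂ A c)) = coeffOp (uVar A) := by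
    rw [← coeffOp_add, uSub, sub_add_cancel]
  have h1 : coeffOp (uSub A c) * (tauOp A - 1) =
      coeffOp (uSub A c) * tauOp A - coeffOp (uSub A c) := by
    apply Subtype.ext
    change lop (uSub A c) * (tau A - 1) = lop (uSub A c) * tau A - lop (uSub A c)
    rw [mul_sub, mul_one]
  rw [map_add, map_sub, polyHom_z, polyHom_a, AlgHom.commutes, algebraMap_diffOp_eq, h1, ← h]
  abel

theorem ucd_eq (c : ℂ) : ucd c = polyHom ℂ c (z - a + algebraMap ℂ ShiftAlg c) := by
  rw [polyHom_z_sub_a_add, ucd, algebraMap_series_eq]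
  rfl

theorem polyHom_range (c : ℂ) : (polyHom ℂ c).range = PolyOp c := by
  apply le_antisymm
  · have ha : a ∈ (PolyOp c).comap (polyHom ℂ c) := by
      rw [Subalgebra.mem_comap, polyHom_a]
      exact (PolyOp.u c).2
    have hz : z ∈ (PolyOp c).comap (polyHom ℂ c) := by
      have h : z = (z - a + algebraMap ℂ ShiftAlg c) + a + algebraMap ℂ ShiftAlg (-c) := by
        rw [map_neg]
        abel
      rw [h]
      refine add_mem (add_mem ?_ ha) (Subalgebra.algebraMap_mem _ _)
      rw [Subalgebra.mem_comap, ← ucd_eq]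
      exact (PolyOp.ud c).2
    have h : Submodule.span ℂ (Set.range fun p : ℕ × ℕ => a ^ p.1 * z ^ p.2) ≤
        Subalgebra.toSubmodule ((PolyOp c).comap (polyHom ℂ c)) := by
      rw [Submodule.span_le]
      rintro _ ⟨p, rfl⟩
      change _ ∈ (PolyOp c).comap (polyHom ℂ c)
      exact mul_mem (pow_mem ha _) (pow_mem hz _)
    rw [span_monomials] at h
    rintro _ ⟨w, rfl⟩
    exact h (Submodule.mem_top (x := w))
  · refine Algebra.adjoin_le ?_
    rintro _ (rfl | rfl)
    · exact ⟨a, polyHom_a c⟩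
    · exact ⟨_, (ucd_eq c).symm⟩

/-- The isomorphism `a ↦ u`, `z ↦ (u - c) τ` onto `𝒫(c)`. -/
def polyEquiv (c : ℂ) : ShiftAlg ≃ₐ[ℂ] PolyOp c :=
  (AlgEquiv.ofInjective (polyHom ℂ c) (polyHom_injective c)).trans
    (Subalgebra.equivOfEq _ _ (polyHom_range c))

theorem coe_polyEquiv (c : ℂ) (w : ShiftAlg) : (polyEquiv c w : DiffOp ℂ) = polyHom ℂ c w := rfl

theorem polyEquiv_a (c : ℂ) : polyEquiv c a = PolyOp.u c := Subtype.ext (polyHom_a c)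

theorem polyEquiv_add_natCast (c : ℂ) (w : ShiftAlg) (k : ℕ) :
    polyEquiv c (w + (k : ShiftAlg)) = polyEquiv c w + (k : PolyOp c) := by
  apply Subtype.ext
  change polyHom ℂ c (w + (k : ShiftAlg)) = polyHom ℂ c w + (k : DiffOp ℂ)
  rw [map_add, map_natCast]

theorem polyEquiv_z_sub_a_add (c : ℂ) :
    polyEquiv c (z - a + algebraMap ℂ ShiftAlg c) = PolyOp.ud c := Subtype.ext (ucd_eq c).symm

theorem tensorToOp_tmul_polyEquiv (c : ℂ) (r : A) (w : ShiftAlg) :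
    tensorToOp A c (r ⊗ₜ polyEquiv c w) = tensorHom A c (r ⊗ₜ w) := by
  rw [tensorHom_tmul, ← mapOp_polyHom (Algebra.ofId ℂ A), ← coe_polyEquiv]
  rfl

theorem tensorToOp_lTensor_polyEquiv (c : ℂ) (x : TensorProduct ℂ A ShiftAlg) :
    tensorToOp A c (LinearMap.lTensor A (polyEquiv c).toLinearMap x) = tensorHom A c x := by
  induction x using TensorProduct.induction_on with
  | zero => simp only [map_zero]
  | add x y hx hy => simp only [map_add, hx, hy]
  | tmul r w => exact tensorToOp_tmul_polyEquiv c r w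

/-- Transports `tensorHom_injective` along `polyEquiv`, so that an operator determines its element
of A ⊗ 𝒫(c) and applying id ⊗ F is unambiguous. -/
theorem tensorToOp_injective (c : ℂ) : Function.Injective (tensorToOp A c) := by
  have hsurj : Function.Surjective (LinearMap.lTensor A (polyEquiv c).toLinearMap) :=
    LinearMap.lTensor_surjective A (polyEquiv c).surjective
  intro x y h
  obtain ⟨x, rfl⟩ := hsurj x
  obtain ⟨y, rfl⟩ := hsurj y
  rw [tensorToOp_lTensor_polyEquiv, tensorToOp_lTensor_polyEquiv] at h
  rw [tensorHom_injective A c h]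

/-- The element of `A ⊗ 𝒫(c)` obtained from an element of `Aᵐᵒᵖ ⊗ ShiftAlg`. -/
def unopTensor (c : ℂ) : TensorProduct ℂ Aᵐᵒᵖ ShiftAlg →ₗ[ℂ] TensorProduct ℂ A (PolyOp c) :=
  TensorProduct.map (MulOpposite.opLinearEquiv ℂ).symm.toLinearMap (polyEquiv c).toLinearMap

theorem opOp_tensorToOp_unopTensor (c : ℂ) (x : TensorProduct ℂ Aᵐᵒᵖ ShiftAlg) :
    opOp (tensorToOp A c (unopTensor c x)) = tensorHom Aᵐᵒᵖ c x := by
  induction x using TensorProduct.induction_on with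
  | zero => rw [LinearMap.map_zero, LinearMap.map_zero, LinearEquiv.map_zero, map_zero]
  | add x y hx hy => rw [LinearMap.map_add, LinearMap.map_add, LinearEquiv.map_add, map_add, hx, hy]
  | tmul r w =>
    rw [tensorHom_tmul, ← MulOpposite.op_unop r, ← opOp_constOp_mul_polyHom]
    exact congrArg _ (tensorToOp_tmul_polyEquiv c r.unop w)

/-- The anti-isomorphism `(u - c) d ↦ u + c + 1`, `u + c' + 1 ↦ (u - c') d` from `𝒫(c)` to
`𝒫(c')`. -/
def polyAntiEquiv (c c' : ℂ) : PolyOp c ≃ₐ[ℂ] (PolyOp c')ᵐᵒᵖ :=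
  ((polyEquiv c).symm.trans antiEquiv).trans (AlgEquiv.op (polyEquiv c'))

theorem polyAntiEquiv_polyEquiv (c c' : ℂ) (w : ShiftAlg) :
    polyAntiEquiv c c' (polyEquiv c w) =
      MulOpposite.op (polyEquiv c' (antiHom w).unop) := by
  change AlgEquiv.op (polyEquiv c') (antiHom ((polyEquiv c).symm (polyEquiv c w))) = _
  rw [AlgEquiv.symm_apply_apply]
  rfl

theorem antiHom_a : antiHom a = MulOpposite.op (z - a - 1) := lift_a _ _ _

theorem antiHom_z : antiHom z = MulOpposite.op z := lift_z _ _ _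

theorem polyAntiEquiv_ud (n : ℕ) (c' : ℂ) :
    polyAntiEquiv ((n : ℂ) - 1) c' (PolyOp.ud ((n : ℂ) - 1)) =
      MulOpposite.op (PolyOp.u c' + (n : PolyOp c')) := by
  rw [← polyEquiv_z_sub_a_add, polyAntiEquiv_polyEquiv, ← polyEquiv_a,
    ← polyEquiv_add_natCast]
  congr 2
  rw [map_add, map_sub, AlgHom.commutes, antiHom_a, antiHom_z, map_sub, map_natCast, map_one]
  change z - (z - a - 1) + ((n : ShiftAlg) - 1) = a + n
  abel

theorem polyAntiEquiv_u (c : ℂ) (m : ℕ) :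
    polyAntiEquiv c ((m : ℂ) - 1) (PolyOp.u c + (m : PolyOp c)) =
      MulOpposite.op (PolyOp.ud ((m : ℂ) - 1)) := by
  rw [← polyEquiv_a, ← polyEquiv_add_natCast, polyAntiEquiv_polyEquiv,
    ← polyEquiv_z_sub_a_add]
  congr 2
  rw [map_add, antiHom_a, map_natCast, map_sub, map_natCast, map_one]
  change z - a - 1 + (m : ShiftAlg) = z - a + ((m : ShiftAlg) - 1)
  abel

/-- The anti-homomorphism induced by the anti-involution of the shift algebra. -/
def tensorAntiHom (A : Type*) [Ring A] [Algebra ℂ A] :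
    TensorProduct ℂ Aᵐᵒᵖ ShiftAlg →ₐ[ℂ] (TensorProduct ℂ A ShiftAlg)ᵐᵒᵖ :=
  Algebra.TensorProduct.lift (AlgHom.op Algebra.TensorProduct.includeLeft)
    ((AlgHom.op Algebra.TensorProduct.includeRight).comp antiHom) fun r w => by
      apply MulOpposite.unop_injective
      change ((1 : A) ⊗ₜ (antiHom w).unop) * (r.unop ⊗ₜ (1 : ShiftAlg)) =
        (r.unop ⊗ₜ (1 : ShiftAlg)) * ((1 : A) ⊗ₜ (antiHom w).unop)
      rw [Algebra.TensorProduct.tmul_mul_tmul, Algebra.TensorProduct.tmul_mul_tmul, one_mul,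
        mul_one, one_mul, mul_one]

theorem tensorAntiHom_tmul (r : Aᵐᵒᵖ) (w : ShiftAlg) :
    tensorAntiHom A (r ⊗ₜ w) = MulOpposite.op (r.unop ⊗ₜ (antiHom w).unop) := by
  apply MulOpposite.unop_injective
  change ((1 : A) ⊗ₜ (antiHom w).unop) * (r.unop ⊗ₜ (1 : ShiftAlg)) = _
  rw [Algebra.TensorProduct.tmul_mul_tmul, one_mul, mul_one]
  rfl

/-- On U ⊗ 𝒫 the duality keeps the order of coefficients and reverses 𝒫. Starting from the opposite
algebra of U it therefore becomes a genuine anti-homomorphism, which can be applied to determinants.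
-/
theorem lTensor_polyAntiEquiv_unopTensor (c c' : ℂ) (x : TensorProduct ℂ Aᵐᵒᵖ ShiftAlg) :
    LinearMap.lTensor A ((MulOpposite.opLinearEquiv ℂ).symm.toLinearMap.comp
      (polyAntiEquiv c c').toLinearMap) (unopTensor c x) =
      LinearMap.lTensor A (polyEquiv c').toLinearMap (tensorAntiHom A x).unop := by
  induction x using TensorProduct.induction_on with
  | zero => simp only [map_zero, MulOpposite.unop_zero]
  | add x y hx hy => simp only [map_add, MulOpposite.unop_add, hx, hy]
  | tmul r w =>
    rw [tensorAntiHom_tmul]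
    change r.unop ⊗ₜ (polyAntiEquiv c c' (polyEquiv c w)).unop =
      r.unop ⊗ₜ polyEquiv c' (antiHom w).unop
    rw [polyAntiEquiv_polyEquiv]
    rfl

/-- The column determinant of the dual matrix with entries in `A ⊗ ShiftAlg`. -/
def dualDet (n : ℕ) {K : ℕ} (e : Fin K → Fin K → A) : TensorProduct ℂ A ShiftAlg :=
  colDet (dualMatrix n (fun i j => e i j ⊗ₜ (1 : ShiftAlg)) ((1 : A) ⊗ₜ (a + (n : ShiftAlg)))
    ((1 : A) ⊗ₜ z))

theorem val_tensorHom_dualDet (n m : ℕ) {K : ℕ} (e : Fin K → Fin K → A) :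
    (tensorHom A ((m : ℂ) - 1) (dualDet n e) : Module.End ℂ (Ser A)) =
      colDet (dualMatrix n (fun i j => lop (HahnSeries.C (e i j)))
        (lop (uVar A) + (n : Module.End ℂ (Ser A)))
        (lop (uVar A + ((1 - m : ℤ) : Ser A)) * tau A)) := by
  let f : TensorProduct ℂ A ShiftAlg →+* Module.End ℂ (Ser A) :=
    ((DiffOp A).val.comp (tensorHom A ((m : ℂ) - 1))).toRingHom
  have hf : ∀ x, f x = (tensorHom A ((m : ℂ) - 1) x : Module.End ℂ (Ser A)) := fun _ => rfl
  have he : ∀ i j, f (e i j ⊗ₜ (1 : ShiftAlg)) = lop (HahnSeries.C (e i j)) := by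
    intro i j
    rw [hf, tensorHom_tmul, map_one, mul_one]
    rfl
  have ha : f ((1 : A) ⊗ₜ (a + (n : ShiftAlg))) =
      lop (uVar A) + (n : Module.End ℂ (Ser A)) := by
    rw [hf, tensorHom_tmul, map_one, one_mul, map_add, polyHom_a, map_natCast]
    rfl
  -- With c = m - 1, the element z is realised as (u - m + 1)τ, the operator that clears the
  -- denominators of D̄_m.
  have hz : f ((1 : A) ⊗ₜ z) = lop (uVar A + ((1 - m : ℤ) : Ser A)) * tau A := by
    have h : uSub A ((m : ℂ) - 1) = uVar A + ((1 - m : ℤ) : Ser A) := by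
      rw [uSub, map_sub, map_sub, map_natCast, map_natCast, map_one, map_one]
      push_cast
      abel
    rw [hf, tensorHom_tmul, map_one, one_mul, polyHom_z, h]
    rfl
  rw [← hf, dualDet, colDet_map f, dualMatrix_map]
  simp only [he, ha, hz]

end PolynomialOperatorEquivalence

/-- The anti-homomorphism sends the matrix to one with reversed rows and columns, whose entries are
minus those of the other dual matrix. The sign is that of negating all m + n columns. -/
theorem unop_tensorAntiHom_dualDet (n m : ℕ) :
    (tensorAntiHom (Ugl (n + m)) (dualDet m (oppositeGen n m))).unop =
      (-1 : ℤ) ^ (m + n) • dualDet n (eGen (n + m)) := by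
  rw [dualDet, dualDet]
  refine (unop_map_colDet (tensorAntiHom (Ugl (n + m))).toRingHom _).trans ?_
  rw [← colDet_submatrix_cast (add_comm m n), ← colDet_neg]
  congr 1
  ext1 i j
  have he : ∀ i j : Fin (m + n),
      (tensorAntiHom (Ugl (n + m)) (oppositeGen n m i.rev j.rev ⊗ₜ 1)).unop =
        -(eGen (n + m) (Fin.cast (add_comm m n) i) (Fin.cast (add_comm m n) j) ⊗ₜ
          (1 : ShiftAlg)) := by
    intro i j
    have hrev : ∀ k : Fin (m + n), (Fin.cast (add_comm m n) k.rev).rev =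
        Fin.cast (add_comm m n) k := by
      intro k
      ext
      simp only [Fin.val_rev, Fin.val_cast]
      omega
    rw [tensorAntiHom_tmul, map_one, ← TensorProduct.neg_tmul]
    change (oppositeGen n m i.rev j.rev).unop ⊗ₜ (1 : ShiftAlg) = _
    congr 1
    rw [oppositeGen, hrev, hrev]
    rfl
  have ha : (tensorAntiHom (Ugl (n + m)) (1 ⊗ₜ (a + (m : ShiftAlg)))).unop =
      (1 : Ugl (n + m)) ⊗ₜ[ℂ] z - (1 : Ugl (n + m)) ⊗ₜ[ℂ] a - 1 + (m : _) := by
    rw [tensorAntiHom_tmul, map_add, antiHom_a, map_natCast]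
    change (1 : Ugl (n + m)) ⊗ₜ[ℂ] (z - a - 1 + (m : ShiftAlg)) = _
    rw [TensorProduct.tmul_add, TensorProduct.tmul_sub, TensorProduct.tmul_sub]
    congr 1
    exact map_natCast (Algebra.TensorProduct.includeRight (R := ℂ) (A := Ugl (n + m))) m
  have hz : (tensorAntiHom (Ugl (n + m)) (1 ⊗ₜ z)).unop = (1 : Ugl (n + m)) ⊗ₜ[ℂ] z := by
    rw [tensorAntiHom_tmul, antiHom_z]
    rfl
  have ha' : (1 : Ugl (n + m)) ⊗ₜ[ℂ] (a + (n : ShiftAlg)) =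
      (1 : Ugl (n + m)) ⊗ₜ[ℂ] a + (n : _) := by
    rw [TensorProduct.tmul_add]
    congr 1
    exact map_natCast (Algebra.TensorProduct.includeRight (R := ℂ) (A := Ugl (n + m))) n
  have hj : ((j.rev : ℕ) : TensorProduct ℂ (Ugl (n + m)) ShiftAlg) = m + n - 1 - ((j : ℕ) : _) := by
    have h : (j.rev : ℕ) + 1 + j = m + n := by
      rw [Fin.val_rev]
      omega
    have h1 := congrArg (Nat.cast (R := TensorProduct ℂ (Ugl (n + m)) ShiftAlg)) h
    push_cast at h1
    rw [← h1]
    abel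
  change (tensorAntiHom (Ugl (n + m)) (dualMatrix m _ _ _ i.rev j.rev)).unop = _
  rw [Matrix.neg_apply, Matrix.submatrix_apply, dualMatrix, dualMatrix, Matrix.of_apply,
    Matrix.of_apply, map_add, MulOpposite.unop_add, he, neg_add]
  congr 1
  by_cases hij : i = j
  · subst hij
    rw [if_pos rfl, if_pos rfl, map_sub, map_sub, MulOpposite.unop_sub, MulOpposite.unop_sub, ha,
      map_natCast, MulOpposite.unop_natCast, hj, ha', Fin.val_cast]
    -- The image z - a - 1 of a brings one z into every diagonal entry. Reversal exchanges the
    -- positions carrying -z with those without it, since m ≤ m + n - 1 - i means i < n. There the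
    -- two z cancel, and elsewhere one remains.
    by_cases hn : n ≤ (i : ℕ)
    · rw [if_pos hn, if_neg (by rw [Fin.val_rev]; omega), map_zero, MulOpposite.unop_zero]
      abel
    · rw [if_neg hn, if_pos (by rw [Fin.val_rev]; omega), hz]
      abel
  · rw [if_neg (by simpa using hij), if_neg (by simpa using hij), map_zero, MulOpposite.unop_zero,
      neg_zero]

theorem tensorHom_dualDet_eGen (n m : ℕ) :
    tensorHom (Ugl (n + m)) ((m : ℂ) - 1) ((-1 : ℤ) ^ m • dualDet n (eGen (n + m))) =
      dbarLower n m := by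
  apply Subtype.ext
  rw [map_zsmul, val_dbarLower, ← val_tensorHom_dualDet]
  rfl

theorem tensorToOp_unopTensor_dualDet (n m : ℕ) :
    tensorToOp (Ugl (n + m)) ((n : ℂ) - 1)
      (unopTensor ((n : ℂ) - 1) ((-1 : ℤ) ^ n • dualDet m (oppositeGen n m))) =
      dbarUpper n m := by
  apply opOp.injective
  rw [opOp_tensorToOp_unopTensor]
  apply Subtype.ext
  rw [map_zsmul, val_opOp_dbarUpper, ← val_tensorHom_dualDet]
  rfl

end Duality

end YangianDuality
end

theorem theorem3p2 (n m : ℕ) :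
    dbarUpper n m ∈ LinearMap.range (tensorToOp (Ugl (n + m)) ((n : ℂ) - 1)) ∧
    dbarLower n m ∈ LinearMap.range (tensorToOp (Ugl (n + m)) ((m : ℂ) - 1)) ∧
    ∃ F : PolyOp ((n : ℂ) - 1) ≃ₐ[ℂ] (PolyOp ((m : ℂ) - 1))ᵐᵒᵖ,
      F (PolyOp.ud ((n : ℂ) - 1)) =
        MulOpposite.op (PolyOp.u ((m : ℂ) - 1) + (n : PolyOp ((m : ℂ) - 1))) ∧
      F (PolyOp.u ((n : ℂ) - 1) + (m : PolyOp ((n : ℂ) - 1))) =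
        MulOpposite.op (PolyOp.ud ((m : ℂ) - 1)) ∧
      ∀ x : TensorProduct ℂ (Ugl (n + m)) (PolyOp ((n : ℂ) - 1)),
        tensorToOp (Ugl (n + m)) ((n : ℂ) - 1) x = dbarUpper n m →
        tensorToOp (Ugl (n + m)) ((m : ℂ) - 1)
          (LinearMap.lTensor (Ugl (n + m))
            ((MulOpposite.opLinearEquiv ℂ).symm.toLinearMap.comp F.toLinearMap) x) =
          dbarLower n m := by
  refine ⟨⟨_, tensorToOp_unopTensor_dualDet n m⟩,
    ⟨_, (tensorToOp_lTensor_polyEquiv _ _).trans (tensorHom_dualDet_eGen n m)⟩,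
    polyAntiEquiv _ _, polyAntiEquiv_ud n _, polyAntiEquiv_u _ m, fun x hx => ?_⟩
  -- By injectivity x is the known preimage built from the determinant, so the duality has only to
  -- be computed there.
  rw [← tensorToOp_unopTensor_dualDet] at hx
  rw [tensorToOp_injective _ hx, lTensor_polyAntiEquiv_unopTensor, tensorToOp_lTensor_polyEquiv,
    map_zsmul, MulOpposite.unop_smul, unop_tensorAntiHom_dualDet, smul_smul, ← pow_add,
    ← tensorHom_dualDet_eGen]
  congr 2
  -- The sign (-1)^n of D̄_n and the sign (-1)^(m+n) of the matrix negation combine to the sign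
  -- (-1)^m of D̄_m.
  rw [show n + (m + n) = m + 2 * n by ring, pow_add, pow_mul]
  simp
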